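/- Write $e(t)=e^{2\pi i t}$. Let $N$ be the Heisenberg group of real unipotent upper triangular $3\times 3$ matrices, with coordinates $(x,y,z)\in\mathbb R^3$ ($x,y$ the entries in positions $(1,2),(2,3)$ and $z$ the entry in position $(1,3)$), so that $(x_1,y_1,z_1)(x_2,y_2,z_2)=(x_1+x_2,\,y_1+y_2,\,z_1+z_2+x_1y_2)$, and let $N_{\mathbb Z}\cong\mathbb Z^3$ be its subgroup of integral matrices. Let $C^{-\infty}(N_{\mathbb Z}\backslash N)$ be the space of distributions on the compact manifold $N_{\mathbb Z}\backslash N$, i.e. the continuous dual of $C^\infty(N_{\mathbb Z}\backslash N)$ with the strong topology (uniform convergence on bounded sets). Functions are regarded as distributions through the measure $dx\,dy\,dz$, and distributions on $N_{\mathbb Z}\backslash N$ are identified with left $N_{\mathbb Z}$-invariant distributions on $N$. **Proposition.** Every $\tau\in C^{-\infty}(N_{\mathbb Z}\backslash N)$ has a Fourier expansion $$\tau(x,y,z)=\sum_{r,s\in\mathbb Z}c_{r,s}\,e(rx+sy)+\sum_{n\in\mathbb Z\setminus\{0\}}\ \sum_{k\in\mathbb Z/n\mathbb Z}\Big(\sum_{\ell\equiv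 k\ (\mathrm{mod}\ n)}e(nz+\ell y)\,\sigma_{n,k}(x+\ell/n)\Big)$$ with $c_{r,s}\in\mathbb C$ and tempered distributions $\sigma_{n,k}\in\mathcal S'(\mathbb R)$. Each inner sum over $\ell$ is a distribution on $N$ (the sum converges when evaluated on any compactly supported smooth function on $N$) that is $N_{\mathbb Z}$-invariant, hence an element of $C^{-\infty}(N_{\mathbb Z}\backslash N)$; the series over $(r,s)$ and over $(n,k)$ converge unconditionally in the strong topology of $C^{-\infty}(N_{\mathbb Z}\backslash N)$. Moreover there are $\rho_{n,k}\in\mathcal S'(\mathbb R)$ such that, for every $n\neq 0$, the contribution of $n$ can be written alternatively as $$\sum_{k\in\mathbb Z/n\mathbb Z}\ \sum_{\ell\equiv k\ (\mathrm{mod}\ n)}e(nz+\ell y)\,\sigma_{n,k}(x+\ell/n)=\sum_{k\in\mathbb Z/n\mathbb Z}\ \sum_{\ell\equiv k\ (\mathrm{mod}\ n)}e(n(z-xy)+\ell x)\,\rho_{n,k}(\ell/n-y)$$ (where the inner sums over $\ell$ on the right again define elements of $C^{-\infty}(N_{\mathbb Z}\backslash N)$), and such that, for every $n\ne0$ and every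 choice of coefficients $(a_k)_{k\in\mathbb Z/n\mathbb Z}$ in $\mathbb C$, $$\sum_{k\in\mathbb Z/n\mathbb Z}a_k\,\rho_{n,k}(y)=\sum_{k\in\mathbb Z/n\mathbb Z}\widehat a_k\,\widehat\sigma_{n,k}(ny).$$ Here $\widehat a_k=\sum_{\ell\in\mathbb Z/n\mathbb Z}e(k\ell/n)\,a_\ell$ is the finite Fourier transform, and $\widehat\sigma$ is the Fourier transform of tempered distributions, defined by $\widehat\sigma(f)=\sigma(\widehat f)$ with $\widehat f(t)=\int_{\mathbb R}f(u)\,e(-ut)\,du$ for $f\in\mathcal S(\mathbb R)$. -/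

import Mathlib

open scoped SchwartzMap FourierTransform ContDiff Distributions
open MeasureTheory

noncomputable section

namespace HeisFourier

/-- The standard character `e(t) = exp(2πit)`. -/
def e (t : ℝ) : ℂ := Complex.exp (2 * Real.pi * Complex.I * t)

/-! ### The Heisenberg group -/

/-- The Heisenberg group `N` of real unipotent upper triangular `3 × 3` matrices, in the global
coordinates `(x, y, z)`. -/
abbrev Heis : Type := ℝ × ℝ × ℝ

/-- The matrix with coordinates `(x, y, z)`. -/
def Heis.toMatrix (p : Heis) : Matrix (Fin 3) (Fin 3) ℝ :=
  !![1, p.1, p.2.2; 0, 1, p.2.1; 0, 0, 1]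

/-- The group law of `N` in coordinates. -/
def Heis.mul (p q : Heis) : Heis :=
  (p.1 + q.1, p.2.1 + q.2.1, p.2.2 + q.2.2 + p.1 * q.2.1)

theorem Heis.toMatrix_mul (p q : Heis) :
    (Heis.mul p q).toMatrix = p.toMatrix * q.toMatrix := by
  ext i j
  fin_cases i <;> fin_cases j <;>
    simp [Heis.toMatrix, Heis.mul, Matrix.mul_apply, Fin.sum_univ_three] <;> ring

/-- The element of `N_ℤ` with integral coordinates `(a, b, c)`. -/
def Heis.ofInt (g : ℤ × ℤ × ℤ) : Heis := (g.1, g.2.1, g.2.2)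

/-! ### Smooth functions on `N_ℤ \ N` -/

/-- The smooth functions on `N` that are invariant under left translation by `N_ℤ`. -/
def invariantSmooth : Submodule ℂ (Heis → ℂ) where
  carrier := {F | ContDiff ℝ ∞ F ∧ ∀ g p, F (Heis.mul (Heis.ofInt g) p) = F p}
  add_mem' {F G} hF hG := ⟨hF.1.add hG.1, fun g p => by simp [hF.2 g p, hG.2 g p]⟩
  zero_mem' := ⟨contDiff_const, fun _ _ => rfl⟩
  smul_mem' c F hF := ⟨hF.1.const_smul c, fun g p => by simp [hF.2 g p]⟩

/-- `C^∞(N_ℤ \ N)`, the space of smooth functions on the compact manifold `N_ℤ \ N`, realized as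
the space of left `N_ℤ`-invariant smooth functions on `N`. It carries the `C^∞` topology defined
below (and not the topology of pointwise convergence that a subspace of `Heis → ℂ` would have). -/
def NilSmooth : Type := invariantSmooth

namespace NilSmooth

instance : AddCommGroup NilSmooth := inferInstanceAs (AddCommGroup invariantSmooth)

instance : Module ℂ NilSmooth := inferInstanceAs (Module ℂ invariantSmooth)

instance : CoeFun NilSmooth (fun _ => Heis → ℂ) := ⟨fun F => F.1⟩

theorem contDiff (F : NilSmooth) : ContDiff ℝ ∞ F := F.2.1

theorem continuous (F : NilSmooth) : Continuous F := F.contDiff.continuous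

theorem add_coe (F G : NilSmooth) : ((F + G : NilSmooth) : Heis → ℂ) = (F : Heis → ℂ) + G := rfl

theorem smul_coe (c : ℂ) (F : NilSmooth) : ((c • F : NilSmooth) : Heis → ℂ) = c • (F : Heis → ℂ) :=
  rfl

theorem bddAbove_iteratedFDeriv (F : NilSmooth) (m R : ℕ) :
    BddAbove (Set.range fun p : Metric.closedBall (0 : Heis) R => ‖iteratedFDeriv ℝ m F p‖) := by
  have hc : Continuous fun p : Heis => ‖iteratedFDeriv ℝ m F p‖ :=
    (F.contDiff.continuous_iteratedFDeriv (by exact_mod_cast le_top)).norm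
  obtain ⟨C, hC⟩ := (isCompact_closedBall (0 : Heis) (R : ℝ)).bddAbove_image hc.continuousOn
  refine ⟨C, ?_⟩
  rintro _ ⟨p, rfl⟩
  exact hC ⟨p, p.2, rfl⟩

/-- The seminorm `sup_{‖p‖ ≤ R} ‖D^m F(p)‖`. -/
def seminorm (m R : ℕ) : Seminorm ℂ NilSmooth :=
  Seminorm.of (fun F => ⨆ p : Metric.closedBall (0 : Heis) R, ‖iteratedFDeriv ℝ m F p‖)
    (fun F G => by
      have : Nonempty (Metric.closedBall (0 : Heis) (R : ℝ)) := ⟨⟨0, by simp⟩⟩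
      refine ciSup_le fun p => ?_
      rw [add_coe, iteratedFDeriv_add_apply
        (F.contDiff.contDiffAt.of_le (by exact_mod_cast le_top))
        (G.contDiff.contDiffAt.of_le (by exact_mod_cast le_top))]
      exact (norm_add_le _ _).trans (add_le_add
        (le_ciSup (bddAbove_iteratedFDeriv F m R) p) (le_ciSup (bddAbove_iteratedFDeriv G m R) p)))
    (fun c F => by
      rw [Real.mul_iSup_of_nonneg (norm_nonneg c)]
      refine congrArg _ (funext fun p => ?_)
      rw [smul_coe, iteratedFDeriv_const_smul_apply
        (F.contDiff.contDiffAt.of_le (by exact_mod_cast le_top)), norm_smul])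

/-- The family of seminorms that defines the `C^∞` topology. -/
def seminormFamily : SeminormFamily ℂ NilSmooth (ℕ × ℕ) := fun i => seminorm i.1 i.2

/-- The `C^∞` topology: uniform convergence of all derivatives on compact subsets of `N`
(equivalently, on a compact fundamental domain of `N_ℤ`). -/
instance : TopologicalSpace NilSmooth := seminormFamily.moduleFilterBasis.topology

theorem withSeminorms : WithSeminorms seminormFamily := ⟨rfl⟩

instance : IsTopologicalAddGroup NilSmooth := withSeminorms.topologicalAddGroup

instance : ContinuousSMul ℂ NilSmooth := withSeminorms.continuousSMul

end NilSmooth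

/-! ### Distributions on `N_ℤ \ N` -/

/-- `C^{-∞}(N_ℤ \ N)`, the continuous dual of `C^∞(N_ℤ \ N)`. Its topology is Mathlib's topology on
spaces of continuous linear maps, that is, the strong topology: uniform convergence on the bounded
subsets of `C^∞(N_ℤ \ N)`. -/
abbrev NilDistribution : Type := NilSmooth →L[ℂ] ℂ

/-- The fundamental domain `0 ≤ x ≤ 1`, `0 ≤ y ≤ 1`, `0 ≤ z ≤ 1` for the action of `N_ℤ` on `N`. -/
def unitCube : Set Heis := Set.Icc 0 1

/-- A smooth function `G` on `N_ℤ \ N` as a distribution: `F ↦ ∫_{N_ℤ \ N} G F dx dy dz`. -/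
def NilSmooth.toDistribution (G : NilSmooth) : NilDistribution where
  toFun F := ∫ p in unitCube, G p * F p
  map_add' F₁ F₂ := by
    have h : ∀ F : NilSmooth, IntegrableOn (fun p => G p * F p) unitCube := fun F =>
      (G.continuous.mul F.continuous).continuousOn.integrableOn_compact isCompact_Icc
    simp only [NilSmooth.add_coe, Pi.add_apply, mul_add]
    exact integral_add (h F₁) (h F₂)
  map_smul' c F := by
    simp only [NilSmooth.smul_coe, Pi.smul_apply, smul_eq_mul, RingHom.id_apply]
    rw [← integral_const_mul]
    congr 1 with p
    ring
  cont := by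
    have h : ∀ F : NilSmooth, IntegrableOn (fun p => G p * F p) unitCube := fun F =>
      (G.continuous.mul F.continuous).continuousOn.integrableOn_compact isCompact_Icc
    let L : NilSmooth →ₗ[ℂ] ℂ :=
      { toFun := fun F => ∫ p in unitCube, G p * F p
        map_add' := fun F₁ F₂ => by
          simp only [NilSmooth.add_coe, Pi.add_apply, mul_add]
          exact integral_add (h F₁) (h F₂)
        map_smul' := fun c F => by
          simp only [NilSmooth.smul_coe, Pi.smul_apply, smul_eq_mul, RingHom.id_apply]
          rw [← integral_const_mul]
          congr 1 with p
          ring }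
    obtain ⟨C, hC⟩ := (isCompact_Icc (a := (0 : Heis)) (b := 1)).exists_bound_of_continuousOn
      G.continuous.continuousOn
    change Continuous L
    refine NilSmooth.withSeminorms.continuous_normedSpace_rng ℂ L
      ⟨{(0, 1)}, Real.toNNReal (C * volume.real unitCube), fun F => ?_⟩
    have hC0 : 0 ≤ C := (norm_nonneg _).trans (hC 0 ⟨le_rfl, zero_le_one⟩)
    have hF : ∀ p ∈ unitCube, ‖F p‖ ≤ NilSmooth.seminorm 0 1 F := by
      intro p hp
      have hb : p ∈ Metric.closedBall (0 : Heis) ((1 : ℕ) : ℝ) := by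
        obtain ⟨⟨h1, h2, h3⟩, ⟨h4, h5, h6⟩⟩ := hp
        simp only [Metric.mem_closedBall, dist_zero_right, Nat.cast_one, Prod.norm_def,
          sup_le_iff, Real.norm_eq_abs, abs_le]
        simp only [Prod.fst_zero, Prod.snd_zero, Prod.fst_one, Prod.snd_one] at h1 h2 h3 h4 h5 h6
        refine ⟨⟨by linarith, h4⟩, ⟨by linarith, h5⟩, ⟨by linarith, h6⟩⟩
      have := le_ciSup (NilSmooth.bddAbove_iteratedFDeriv F 0 1) ⟨p, hb⟩
      change ‖iteratedFDeriv ℝ 0 F p‖ ≤ _ at this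
      rw [norm_iteratedFDeriv_zero] at this
      exact this
    have key : ‖∫ p in unitCube, G p * F p‖
        ≤ C * NilSmooth.seminorm 0 1 F * volume.real unitCube := by
      refine norm_setIntegral_le_of_norm_le_const
        (isCompact_Icc (a := (0 : Heis)) (b := 1)).measure_lt_top fun p hp => ?_
      rw [norm_mul]
      exact mul_le_mul (hC p hp) (hF p hp) (norm_nonneg _) hC0
    have e1 : ((Real.toNNReal (C * volume.real unitCube) : NNReal) : ℝ) = C * volume.real unitCube :=
      Real.coe_toNNReal _ (by positivity)
    simp only [Seminorm.comp_apply, coe_normSeminorm, Finset.sup_singleton, smul_apply,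
      NNReal.smul_def, smul_eq_mul, e1]
    calc ‖L F‖ ≤ _ := key
      _ = _ := by
        simp only [NilSmooth.seminormFamily]
        ring

theorem contDiff_e {f : ℝ × ℝ × ℝ → ℝ} (hf : ContDiff ℝ ∞ f) : ContDiff ℝ ∞ fun q => e (f q) :=
  (contDiff_const.mul (Complex.ofRealCLM.contDiff.comp hf)).cexp

/-- The abelian character `(x, y, z) ↦ e(rx + sy)`, with `r, s ∈ ℤ`, as a function on `N_ℤ \ N`. -/
def abelianChar (r s : ℤ) : NilSmooth :=
  ⟨fun p => e (r * p.1 + s * p.2.1), by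
    refine ⟨?_, fun g p => ?_⟩
    · exact contDiff_e (by fun_prop)
    · unfold e
      rw [Complex.exp_eq_exp_iff_exists_int]
      refine ⟨r * g.1 + s * g.2.1, ?_⟩
      simp only [Heis.mul, Heis.ofInt]
      push_cast
      ring⟩

/-- Test functions on `N`: smooth functions `N → ℂ` with compact support. -/
abbrev HeisTest : Type := 𝓓((⊤ : TopologicalSpace.Opens Heis), ℂ)

theorem finite_translates (φ : HeisTest) (r : ℝ) :
    {g : ℤ × ℤ × ℤ | ∃ p : Heis, ‖p‖ ≤ r ∧ φ (Heis.mul (Heis.ofInt g) p) ≠ 0}.Finite := by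
  obtain ⟨R, hR⟩ := φ.hasCompactSupport.isCompact.isBounded.subset_closedBall (0 : Heis)
  obtain ⟨M, hM⟩ := exists_nat_ge (R + |r| + (R + |r|) * |r|)
  obtain ⟨M', hM'⟩ := exists_nat_ge (R + |r|)
  refine (Set.Finite.prod (Set.finite_Icc (-(M' : ℤ)) M')
    (Set.Finite.prod (Set.finite_Icc (-(M' : ℤ)) M') (Set.finite_Icc (-(M : ℤ)) M))).subset ?_
  rintro ⟨a, b, c⟩ ⟨⟨x, y, z⟩, hp, hφ⟩
  have hq := hR (subset_tsupport _ hφ)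
  simp only [Heis.mul, Heis.ofInt, Metric.mem_closedBall, dist_zero_right, Prod.norm_def,
    sup_le_iff, Real.norm_eq_abs] at hq hp
  obtain ⟨h1, h2, h3⟩ := hq
  obtain ⟨k1, k2, k3⟩ := hp
  have hr := le_abs_self r
  have ha : |(a : ℝ)| ≤ R + |r| := by
    have := abs_sub (a + x : ℝ) x
    rw [add_sub_cancel_right] at this
    linarith
  have hb : |(b : ℝ)| ≤ R + |r| := by
    have := abs_sub (b + y : ℝ) y
    rw [add_sub_cancel_right] at this
    linarith
  have hay : |(a : ℝ) * y| ≤ (R + |r|) * |r| := by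
    rw [abs_mul]
    exact mul_le_mul ha (k2.trans hr) (abs_nonneg _) ((abs_nonneg _).trans ha)
  have hc : |(c : ℝ)| ≤ R + |r| + (R + |r|) * |r| := by
    have h4 := abs_sub (c + z + a * y : ℝ) (z + a * y)
    have h5 := abs_add_le z (a * y)
    rw [add_assoc, add_sub_cancel_right, ← add_assoc] at h4
    linarith
  have ha' := abs_le.1 (ha.trans hM')
  have hb' := abs_le.1 (hb.trans hM')
  have hc' := abs_le.1 (hc.trans hM)
  simp only [Set.mem_prod, Set.mem_Icc]
  refine ⟨⟨?_, ?_⟩, ⟨?_, ?_⟩, ?_, ?_⟩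
  · exact_mod_cast ha'.1
  · exact_mod_cast ha'.2
  · exact_mod_cast hb'.1
  · exact_mod_cast hb'.2
  · exact_mod_cast hc'.1
  · exact_mod_cast hc'.2

theorem contDiff_mul_left (q : Heis) : ContDiff ℝ ∞ (Heis.mul q) := by
  unfold Heis.mul
  fun_prop

/-- The sum `p ↦ ∑_{γ ∈ N_ℤ} φ(γ p)` of the translates of a test function on `N`, which is a smooth
function on `N_ℤ \ N`. The sum is locally finite. -/
def average (φ : HeisTest) : NilSmooth :=
  ⟨fun p => ∑' g : ℤ × ℤ × ℤ, φ (Heis.mul (Heis.ofInt g) p), by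
    refine ⟨?_, fun g p => ?_⟩
    · rw [contDiff_iff_contDiffAt]
      intro p₀
      have hfin := finite_translates φ (‖p₀‖ + 1)
      have hs : ContDiff ℝ ∞ fun p => ∑ g ∈ hfin.toFinset, φ (Heis.mul (Heis.ofInt g) p) :=
        ContDiff.sum fun g _ => φ.contDiff.comp (contDiff_mul_left _)
      refine hs.contDiffAt.congr_of_eventuallyEq ?_
      filter_upwards [Metric.ball_mem_nhds p₀ one_pos] with p hp
      refine tsum_eq_sum fun g hg => ?_
      by_contra hne
      refine hg ((Set.Finite.mem_toFinset _).2 ⟨p, ?_, hne⟩)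
      have := norm_sub_norm_le p p₀
      rw [Metric.mem_ball, dist_eq_norm] at hp
      linarith
    · let E : ℤ × ℤ × ℤ ≃ ℤ × ℤ × ℤ :=
        { toFun := fun h => (h.1 + g.1, h.2.1 + g.2.1, h.2.2 + g.2.2 + h.1 * g.2.1)
          invFun := fun h =>
            (h.1 - g.1, h.2.1 - g.2.1, h.2.2 - g.2.2 - (h.1 - g.1) * g.2.1)
          left_inv := fun h => by ext <;> (simp; try ring)
          right_inv := fun h => by ext <;> (simp; try ring) }
      change ∑' h, φ (Heis.mul (Heis.ofInt h) (Heis.mul (Heis.ofInt g) p))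
        = ∑' h, φ (Heis.mul (Heis.ofInt h) p)
      rw [← E.tsum_eq fun h => φ (Heis.mul (Heis.ofInt h) p)]
      refine tsum_congr fun h => congrArg φ ?_
      simp only [Heis.mul, Heis.ofInt, E, Equiv.coe_fn_mk]
      push_cast
      ext <;> simp only <;> ring⟩

/-- A distribution `T` on `N_ℤ \ N`, regarded as an `N_ℤ`-invariant distribution on `N`: its value at
the test function `φ`, or symbolically
`∫_N T φ dx dy dz = ∫_{N_ℤ \ N} T(p) (∑_{γ ∈ N_ℤ} φ(γ p)) dx dy dz`. -/
def NilDistribution.onGroup (T : NilDistribution) (φ : HeisTest) : ℂ := T (average φ)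

/-! ### The non-abelian Fourier components -/

/-- For a smooth, compactly supported `f` on `ℝ × ℝ²`, the function `t ↦ ∫ f(t, w) dw`, which is a
Schwartz function on `ℝ`. -/
def fiberIntegral (f : ℝ × ℝ × ℝ → ℂ) (hf : ContDiff ℝ ∞ f) (hc : HasCompactSupport f) : 𝓢(ℝ, ℂ) :=
  HasCompactSupport.toSchwartzMap (f := fun t => ∫ w : ℝ × ℝ, f (t, w))
    (by
      refine HasCompactSupport.intro (hc.isCompact.image continuous_fst) fun t ht => ?_
      have h : ∀ w : ℝ × ℝ, f (t, w) = 0 := fun w => by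
        by_contra hne
        exact ht ⟨(t, w), subset_tsupport _ hne, rfl⟩
      simp [h])
    (by
      have hk : IsCompact (Prod.snd '' tsupport f) := hc.isCompact.image continuous_snd
      have h := contDiffOn_convolution_right_with_param_comp (𝕜 := ℝ) (μ := volume) (n := ⊤)
        (ContinuousLinearMap.lsmul ℝ ℝ) (s := Set.univ) (v := fun _ : ℝ => (0 : ℝ × ℝ))
        contDiffOn_const (f := fun _ : ℝ × ℝ => (1 : ℝ)) (g := fun (t : ℝ) (w : ℝ × ℝ) => f (t, w))
        isOpen_univ hk
        (fun t w _ hw => by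
          by_contra hne
          exact hw ⟨(t, w), subset_tsupport _ hne, rfl⟩)
        (locallyIntegrable_const 1) (by exact hf.contDiffOn)
      rw [contDiffOn_univ] at h
      convert h using 2 with t
      simp only [convolution_def, ContinuousLinearMap.lsmul_apply, one_smul, zero_sub]
      exact (integral_neg_eq_self (fun w : ℝ × ℝ => f (t, w)) volume).symm)

/-- The function `t ↦ ∫∫ e(nz + ℓy) φ(t - ℓ/n, y, z) dy dz` on `ℝ`. -/
def sigmaTest (n ℓ : ℤ) (φ : HeisTest) : 𝓢(ℝ, ℂ) :=
  fiberIntegral (fun q => e (n * q.2.2 + ℓ * q.2.1) * φ (q.1 - ℓ / n, q.2.1, q.2.2))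
    ((contDiff_e (by fun_prop)).mul (φ.contDiff.comp (by fun_prop)))
    (HasCompactSupport.mul_left (φ.hasCompactSupport.comp_homeomorph
      ((Homeomorph.subRight ((ℓ : ℝ) / n)).prodCongr (Homeomorph.refl (ℝ × ℝ)))))

/-- The distribution `e(nz + ℓy) σ(x + ℓ/n)` on `N`, evaluated at the test function `φ`; the variable
of `σ` is `t = x + ℓ/n`. -/
def sigmaTerm (n ℓ : ℤ) (σ : 𝓢'(ℝ, ℂ)) (φ : HeisTest) : ℂ := σ (sigmaTest n ℓ φ)

/-- The homeomorphism `(t, x, z) ↦ (x, a - t, z)`. -/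
def swapHomeomorph (a : ℝ) : ℝ × ℝ × ℝ ≃ₜ ℝ × ℝ × ℝ where
  toFun q := (q.2.1, a - q.1, q.2.2)
  invFun q := (a - q.2.1, q.1, q.2.2)
  left_inv q := by simp
  right_inv q := by simp
  continuous_toFun := by fun_prop
  continuous_invFun := by fun_prop

/-- The function `t ↦ ∫∫ e(n(z - xy) + ℓx) φ(x, y, z) dx dz` on `ℝ`, where `y = ℓ/n - t`. -/
def rhoTest (n ℓ : ℤ) (φ : HeisTest) : 𝓢(ℝ, ℂ) :=
  fiberIntegral
    (fun q => e (n * (q.2.2 - q.2.1 * (ℓ / n - q.1)) + ℓ * q.2.1) * φ (q.2.1, ℓ / n - q.1, q.2.2))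
    ((contDiff_e (by fun_prop)).mul (φ.contDiff.comp (by fun_prop)))
    (HasCompactSupport.mul_left
      (φ.hasCompactSupport.comp_homeomorph (swapHomeomorph ((ℓ : ℝ) / n))))

/-- The distribution `e(n(z - xy) + ℓx) ρ(ℓ/n - y)` on `N`, evaluated at the test function `φ`; the
variable of `ρ` is `t = ℓ/n - y`. -/
def rhoTerm (n ℓ : ℤ) (ρ : 𝓢'(ℝ, ℂ)) (φ : HeisTest) : ℂ := ρ (rhoTest n ℓ φ)

/-- The nonzero integers, which index the nontrivial central characters. -/
abbrev NonzeroInt : Type := {n : ℤ // n ≠ 0}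

instance (n : NonzeroInt) : NeZero n.1.natAbs := ⟨Int.natAbs_ne_zero.2 n.2⟩

/-- The residue classes `ℤ/nℤ`, where `n` may be negative. -/
abbrev Residue (n : NonzeroInt) : Type := ZMod n.1.natAbs

/-- `T = ∑_{ℓ ≡ k (mod n)} e(nz + ℓy) σ(x + ℓ/n)`, as distributions on `N`. -/
def IsSigmaComponent (n : NonzeroInt) (k : Residue n) (σ : 𝓢'(ℝ, ℂ)) (T : NilDistribution) : Prop :=
  ∀ φ : HeisTest,
    HasSum (fun ℓ : {ℓ : ℤ // (ℓ : Residue n) = k} => sigmaTerm n ℓ σ φ) (T.onGroup φ)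

/-- `T = ∑_{ℓ ≡ k (mod n)} e(n(z - xy) + ℓx) ρ(ℓ/n - y)`, as distributions on `N`. -/
def IsRhoComponent (n : NonzeroInt) (k : Residue n) (ρ : 𝓢'(ℝ, ℂ)) (T : NilDistribution) : Prop :=
  ∀ φ : HeisTest,
    HasSum (fun ℓ : {ℓ : ℤ // (ℓ : Residue n) = k} => rhoTerm n ℓ ρ φ) (T.onGroup φ)

/-! ### Fourier transforms -/

/-- The finite Fourier transform `â_k = ∑_{ℓ ∈ ℤ/nℤ} e(kℓ/n) a_ℓ`. -/
def finiteFourier (n : NonzeroInt) (a : Residue n → ℂ) (k : Residue n) : ℂ :=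
  ∑ ℓ : Residue n, e ((k.val : ℝ) * (ℓ.val : ℝ) / (n.1 : ℝ)) * a ℓ

/-- The tempered distribution `σ(cy)` in the variable `y`, for `c ≠ 0`: it sends `f` to
`|c|⁻¹ σ(f(·/c))`. -/
def dilate (c : ℝ) (hc : c ≠ 0) (σ : 𝓢'(ℝ, ℂ)) : 𝓢'(ℝ, ℂ) :=
  ((|c|⁻¹ : ℝ) : ℂ) • PointwiseConvergenceCLM.precomp ℂ
    (SchwartzMap.compCLMOfContinuousLinearEquiv ℂ
      (ContinuousLinearEquiv.smulLeft (Units.mk0 c hc)⁻¹ : ℝ ≃L[ℝ] ℝ)) σ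

theorem dilate_apply (c : ℝ) (hc : c ≠ 0) (σ : 𝓢'(ℝ, ℂ)) (f g : 𝓢(ℝ, ℂ))
    (hg : ∀ t, g t = f (t / c)) : dilate c hc σ f = ((|c|⁻¹ : ℝ) : ℂ) * σ g := by
  have : g = SchwartzMap.compCLMOfContinuousLinearEquiv ℂ
      (ContinuousLinearEquiv.smulLeft (Units.mk0 c hc)⁻¹ : ℝ ≃L[ℝ] ℝ) f := by
    ext t
    rw [hg, div_eq_inv_mul]
    rfl
  rw [this]
  rfl

end HeisFourier

end

/-!
The group `N_ℤ \ N` carries three left-invariant vector fields, and sup norms of their iterated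
applications (`NilSmooth.fieldNorm`) define the `C^∞` topology. All operators below commute with
these vector fields, so convergence in `C^∞(N_ℤ \ N)` reduces to uniform bounds on functions:
`NilSmooth.hasSum_of_commute`. Strong convergence of series of distributions follows from operator
bounds in the same way.

The expansion is dual to a decomposition of smooth functions. Averaging against `e(nt)` over the
central circle projects to the functions that transform under the centre by `e(-nt)`; for `n ≠ 0`
this projection may be combined with left translation by `(0, j/n, 0)`, and a finite Fourier
transform in `j` splits it into the projections `residueProj n k`. For `n = 0` the functions live on
a two-torus and have ordinary Fourier series. Composition of `τ` with these projections gives the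
terms of the expansion (`exists_expansion`).

A Schwartz function `f` has a theta series `theta n k f = ∑ e(-nz - ℓy) f(x + ℓ/n)`, summed over
`ℓ ≡ k (mod n)`, and `σ_{n,k}` is the pullback of `τ` under `theta n k`. For a test function `φ` on
`N`, unfolding the average in the central variable and Poisson summation in `y` identify
`residueProj n k (average φ)` with the sum of the theta series of the functions `sigmaTest n ℓ φ`,
`ℓ ≡ k` (`hasSum_theta_sigmaTest`). Application of `τ` is the formula for the component of `τ` in
terms of `σ_{n,k}`.

The second family of components is the first one seen through the automorphism
`(x, y, z) ↦ (-y, x, z - xy)` of order four (`quarterTurn`), which preserves `N_ℤ` and fixes the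
centre: `rhoTest n ℓ φ` is `sigmaTest n ℓ` of the transported test function, and `ρ_{n,k}` is the
pullback under `theta n k` of the transported `τ`. Since the projections to central characters
commute with the automorphism, the sums over `k` agree. Finally, Poisson summation expresses the
transport of a theta series through theta series of the Fourier transform (`turn_theta`), which is
the relation between `ρ_{n,k}` and the Fourier transforms of the `σ_{n,j}`.
-/

noncomputable section

namespace HeisFourier

/-! ### Left-invariant vector fields -/

/-- The value at `p` of the left-invariant vector field on `N` whose value at the identity is `v`. -/
def leftField (v p : Heis) : Heis := (v.1, v.2.1, v.2.2 + p.1 * v.2.1)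

/-- The derivative of a function on `N` along the left-invariant vector field attached to `v`. -/
def fieldDeriv (v : Heis) (F : Heis → ℂ) (p : Heis) : ℂ := fderiv ℝ F p (leftField v p)

theorem contDiff_leftField (v : Heis) : ContDiff ℝ ∞ (leftField v) := by
  unfold leftField
  fun_prop

theorem hasFDerivAt_mul_left (q p : Heis) :
    HasFDerivAt (Heis.mul q) ((ContinuousLinearMap.fst ℝ ℝ (ℝ × ℝ)).prod
      (((ContinuousLinearMap.fst ℝ ℝ ℝ).comp (ContinuousLinearMap.snd ℝ ℝ (ℝ × ℝ))).prod
        ((ContinuousLinearMap.snd ℝ ℝ ℝ).comp (ContinuousLinearMap.snd ℝ ℝ (ℝ × ℝ)) +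
          q.1 • (ContinuousLinearMap.fst ℝ ℝ ℝ).comp (ContinuousLinearMap.snd ℝ ℝ (ℝ × ℝ))))) p := by
  have h1 : HasFDerivAt (fun p : Heis => p.1) (ContinuousLinearMap.fst ℝ ℝ (ℝ × ℝ)) p :=
    hasFDerivAt_fst
  have h2 : HasFDerivAt (fun p : Heis => p.2.1)
      ((ContinuousLinearMap.fst ℝ ℝ ℝ).comp (ContinuousLinearMap.snd ℝ ℝ (ℝ × ℝ))) p :=
    ((ContinuousLinearMap.fst ℝ ℝ ℝ).comp (ContinuousLinearMap.snd ℝ ℝ (ℝ × ℝ))).hasFDerivAt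
  have h3 : HasFDerivAt (fun p : Heis => p.2.2)
      ((ContinuousLinearMap.snd ℝ ℝ ℝ).comp (ContinuousLinearMap.snd ℝ ℝ (ℝ × ℝ))) p :=
    ((ContinuousLinearMap.snd ℝ ℝ ℝ).comp (ContinuousLinearMap.snd ℝ ℝ (ℝ × ℝ))).hasFDerivAt
  exact (h1.const_add q.1).prodMk ((h2.const_add q.2.1).prodMk
    ((h3.const_add q.2.2).add (h2.const_mul q.1)))

/-- Left-invariant vector fields commute with left translations. -/
theorem fieldDeriv_comp_mul_left (v q p : Heis) {F : Heis → ℂ}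
    (hF : DifferentiableAt ℝ F (Heis.mul q p)) :
    fieldDeriv v (fun p => F (Heis.mul q p)) p = fieldDeriv v F (Heis.mul q p) := by
  have h := (hF.hasFDerivAt.comp p (hasFDerivAt_mul_left q p)).fderiv
  unfold fieldDeriv
  change (fderiv ℝ (F ∘ Heis.mul q) p) _ = _
  rw [h, ContinuousLinearMap.comp_apply]
  congr 1
  ext <;> simp [leftField, Heis.mul]
  ring

theorem contDiff_fieldDeriv (v : Heis) {F : Heis → ℂ} (hF : ContDiff ℝ ∞ F) :
    ContDiff ℝ ∞ (fieldDeriv v F) :=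
  (hF.fderiv_right (by simp)).clm_apply (contDiff_leftField v)

/-- The standard basis of the Lie algebra of `N`. -/
def frame : Fin 3 → Heis := ![(1, 0, 0), (0, 1, 0), (0, 0, 1)]

theorem fderiv_eq_fieldDeriv (F : Heis → ℂ) (p w : Heis) :
    fderiv ℝ F p w = (w.1 : ℂ) * fieldDeriv (frame 0) F p
      + (w.2.1 : ℂ) * (fieldDeriv (frame 1) F p - p.1 * fieldDeriv (frame 2) F p)
      + (w.2.2 : ℂ) * fieldDeriv (frame 2) F p := by
  have h : w = w.1 • leftField (frame 0) p + w.2.1 • (leftField (frame 1) p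
      - p.1 • leftField (frame 2) p) + w.2.2 • leftField (frame 2) p := by
    ext <;> simp [leftField, frame]
  conv_lhs => rw [h]
  simp only [map_add, map_sub, map_smul, fieldDeriv, Complex.real_smul]

namespace NilSmooth

@[ext] theorem ext {F G : NilSmooth} (h : ∀ p, F p = G p) : F = G := Subtype.ext (funext h)

theorem sub_coe (F G : NilSmooth) (p : Heis) : (F - G) p = F p - G p := rfl

theorem add_apply (F G : NilSmooth) (p : Heis) : (F + G) p = F p + G p := rfl

theorem neg_apply (F : NilSmooth) (p : Heis) : (-F) p = -F p := rfl

theorem smul_apply (c : ℂ) (F : NilSmooth) (p : Heis) : (c • F) p = c * F p := rfl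

theorem sum_apply {ι : Type*} (s : Finset ι) (F : ι → NilSmooth) (p : Heis) :
    (∑ i ∈ s, F i) p = ∑ i ∈ s, F i p := by
  classical
  induction s using Finset.induction_on with
  | empty => rfl
  | insert a s ha ih => rw [Finset.sum_insert ha, Finset.sum_insert ha, add_apply, ih]

theorem differentiableAt (F : NilSmooth) (p : Heis) : DifferentiableAt ℝ F p :=
  F.contDiff.contDiffAt.differentiableAt (by simp)

theorem invariant (F : NilSmooth) (g : ℤ × ℤ × ℤ) (p : Heis) :
    F (Heis.mul (Heis.ofInt g) p) = F p := F.2.2 g p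

/-- The action on `C^∞(N_ℤ \ N)` of the left-invariant vector field attached to `v`. -/
def D (v : Heis) : NilSmooth →ₗ[ℂ] NilSmooth where
  toFun F := ⟨fieldDeriv v F, contDiff_fieldDeriv v F.contDiff, fun g p => by
    rw [← fieldDeriv_comp_mul_left v _ p (F.differentiableAt _)]
    simp only [F.invariant]⟩
  map_add' F G := by
    ext p
    change fderiv ℝ ((F : Heis → ℂ) + (G : Heis → ℂ)) p _ = fderiv ℝ F p _ + fderiv ℝ G p _
    rw [fderiv_add (F.differentiableAt p) (G.differentiableAt p)]
    rfl
  map_smul' c F := by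
    ext p
    change fderiv ℝ (c • (F : Heis → ℂ)) p _ = c * fderiv ℝ F p _
    rw [fderiv_const_smul (F.differentiableAt p)]
    rfl

theorem D_apply (v : Heis) (F : NilSmooth) (p : Heis) : D v F p = fieldDeriv v F p := rfl

theorem norm_le_seminorm (F : NilSmooth) (m R : ℕ) {p : Heis} (hp : ‖p‖ ≤ R) :
    ‖iteratedFDeriv ℝ m F p‖ ≤ seminorm m R F :=
  le_ciSup (bddAbove_iteratedFDeriv F m R) ⟨p, by simpa using hp⟩

theorem seminorm_le (F : NilSmooth) (m R : ℕ) {C : ℝ}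
    (h : ∀ p : Heis, ‖p‖ ≤ R → ‖iteratedFDeriv ℝ m F p‖ ≤ C) : seminorm m R F ≤ C := by
  have : Nonempty (Metric.closedBall (0 : Heis) (R : ℝ)) := ⟨⟨0, by simp⟩⟩
  exact ciSup_le fun p => h p (mem_closedBall_zero_iff.1 p.2)

theorem exists_norm_le_one (p : Heis) : ∃ g : ℤ × ℤ × ℤ, ‖Heis.mul (Heis.ofInt g) p‖ ≤ 1 := by
  obtain ⟨x, y, z⟩ := p
  refine ⟨(-⌊x⌋, -⌊y⌋, -⌊z - ⌊x⌋ * y⌋), ?_⟩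
  have key : ∀ t : ℝ, ‖-(⌊t⌋ : ℝ) + t‖ ≤ 1 := fun t => by
    rw [Real.norm_eq_abs, abs_le]
    constructor <;> linarith [Int.floor_le t, Int.lt_floor_add_one t]
  simp only [Heis.mul, Heis.ofInt, Prod.norm_def, sup_le_iff]
  push_cast
  refine ⟨key x, key y, ?_⟩
  have h := key (z - ⌊x⌋ * y)
  rwa [show -(⌊z - ⌊x⌋ * y⌋ : ℝ) + (z - ⌊x⌋ * y) = -(⌊z - ⌊x⌋ * y⌋ : ℝ) + z + -⌊x⌋ * y by ring] at h

/-- The sup norm over `N` is attained on a fixed ball, because `N_ℤ \ N` is compact. -/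
theorem norm_apply_le (F : NilSmooth) (p : Heis) : ‖F p‖ ≤ seminorm 0 1 F := by
  obtain ⟨g, hg⟩ := exists_norm_le_one p
  rw [← F.invariant g p, ← norm_iteratedFDeriv_zero (𝕜 := ℝ)]
  exact norm_le_seminorm F 0 1 (by exact_mod_cast hg)

/-- The norms `sup_N` of all left-invariant derivatives of order at most `m`, added up with
multiplicities. Unlike the derivatives in the coordinates `(x, y, z)`, the left-invariant
derivatives of an element of `C^∞(N_ℤ \ N)` descend to the compact quotient. -/
def fieldNorm : ℕ → Seminorm ℂ NilSmooth
  | 0 => seminorm 0 1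
  | m + 1 => fieldNorm m + ∑ j, (fieldNorm m).comp (D (frame j))

theorem fieldNorm_zero_le {F : NilSmooth} {C : ℝ} (h : ∀ p, ‖F p‖ ≤ C) : fieldNorm 0 F ≤ C :=
  seminorm_le F 0 1 fun p _ => by rw [norm_iteratedFDeriv_zero]; exact h p

theorem norm_le_fieldNorm_zero (F : NilSmooth) (p : Heis) : ‖F p‖ ≤ fieldNorm 0 F :=
  norm_apply_le F p

theorem fieldNorm_succ (m : ℕ) (F : NilSmooth) :
    fieldNorm (m + 1) F = fieldNorm m F + ∑ j, fieldNorm m (D (frame j) F) := by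
  simp [fieldNorm, Fin.sum_univ_three]

theorem fieldNorm_le_succ (m : ℕ) (F : NilSmooth) : fieldNorm m F ≤ fieldNorm (m + 1) F := by
  rw [fieldNorm_succ]
  exact le_add_of_nonneg_right (Finset.sum_nonneg fun _ _ => apply_nonneg _ _)

theorem fieldNorm_D_le (m : ℕ) (j : Fin 3) (F : NilSmooth) :
    fieldNorm m (D (frame j) F) ≤ fieldNorm (m + 1) F := by
  rw [fieldNorm_succ]
  exact le_add_of_nonneg_of_le (apply_nonneg _ _) (Finset.single_le_sum
    (f := fun j => fieldNorm m (D (frame j) F)) (fun _ _ => apply_nonneg _ _) (Finset.mem_univ j))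

theorem fieldNorm_mono {m k : ℕ} (h : m ≤ k) (F : NilSmooth) : fieldNorm m F ≤ fieldNorm k F :=
  monotone_nat_of_le_succ (f := fun m => fieldNorm m F) (fun m => fieldNorm_le_succ m F) h

theorem exists_iteratedFDeriv_bound {E G : Type*} [NormedAddCommGroup E] [NormedSpace ℝ E]
    [ProperSpace E] [NormedAddCommGroup G] [NormedSpace ℝ G] {f : E → G} (hf : ContDiff ℝ ∞ f)
    (m : ℕ) (R : ℝ) : ∃ C, 0 ≤ C ∧ ∀ i ≤ m, ∀ p : E, ‖p‖ ≤ R → ‖iteratedFDeriv ℝ i f p‖ ≤ C := by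
  have h : ∀ i : ℕ, ∃ C, ∀ p ∈ Metric.closedBall (0 : E) R, ‖iteratedFDeriv ℝ i f p‖ ≤ C :=
    fun i => (isCompact_closedBall (0 : E) R).exists_bound_of_continuousOn
      (hf.continuous_iteratedFDeriv (by exact_mod_cast le_top)).continuousOn
  choose C hC using h
  refine ⟨∑ i ∈ Finset.range (m + 1), |C i|, by positivity, fun i hi p hp => ?_⟩
  refine (hC i p (by simpa using hp)).trans ((le_abs_self _).trans ?_)
  exact Finset.single_le_sum (f := fun i => |C i|) (fun _ _ => abs_nonneg _)
    (Finset.mem_range.2 (by omega))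

theorem exists_seminorm_D_le (v : Heis) (m R : ℕ) : ∃ C, 0 ≤ C ∧ ∀ F : NilSmooth,
    seminorm m R (D v F) ≤ ∑ i ∈ Finset.range (m + 1), C * seminorm (i + 1) R F := by
  obtain ⟨C, hC0, hC⟩ := exists_iteratedFDeriv_bound (contDiff_leftField v) m R
  refine ⟨2 ^ m * C, by positivity, fun F => seminorm_le _ m R fun p hp => ?_⟩
  refine (norm_iteratedFDeriv_clm_apply (N := ∞) (n := m) (F.contDiff.fderiv_right (by simp))
    (contDiff_leftField v) p (by exact_mod_cast le_top)).trans
    (Finset.sum_le_sum fun i hi => ?_)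
  rw [norm_iteratedFDeriv_fderiv]
  have h1 : ((m.choose i : ℕ) : ℝ) ≤ 2 ^ m := by exact_mod_cast Nat.choose_le_two_pow m i
  have h2 := norm_le_seminorm F (i + 1) R hp
  have h3 := hC (m - i) (by omega) p hp
  calc _ ≤ 2 ^ m * seminorm (i + 1) R F * C := by gcongr
    _ = _ := by ring

theorem continuous_D (v : Heis) : Continuous (D v) := by
  refine withSeminorms.continuous_of_continuous_comp (D v) fun i => ?_
  obtain ⟨C, hC0, hC⟩ := exists_seminorm_D_le v i.1 i.2
  let q : Seminorm ℂ NilSmooth :=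
    ∑ j ∈ Finset.range (i.1 + 1), C.toNNReal • seminorm (j + 1) i.2
  have hqF : ∀ F, q F = ∑ j ∈ Finset.range (i.1 + 1), C * seminorm (j + 1) i.2 F := fun F => by
    simp [q, _root_.sum_apply, NNReal.smul_def, hC0]
  have hq : Continuous q := by
    rw [show (q : NilSmooth → ℝ) = _ from funext hqF]
    exact continuous_finsetSum _ fun j _ => continuous_const.mul
      (withSeminorms.continuous_seminorm (j + 1, i.2))
  refine Seminorm.continuous_of_le hq fun F => ?_
  change seminorm i.1 i.2 (D v F) ≤ q F
  exact hqF F ▸ hC F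

theorem continuous_fieldNorm (m : ℕ) : Continuous (fieldNorm m) := by
  induction m with
  | zero => exact withSeminorms.continuous_seminorm (0, 1)
  | succ m ih =>
    have : (fieldNorm (m + 1) : NilSmooth → ℝ) =
        fun F => fieldNorm m F + ∑ j, fieldNorm m (D (frame j) F) := funext (fieldNorm_succ m)
    rw [this]
    exact ih.add (continuous_finsetSum _ fun j _ => ih.comp (continuous_D _))

/-- The seminorms that define the `C^∞` topology are dominated by the left-invariant ones. -/
theorem exists_seminorm_le_fieldNorm (m R : ℕ) :
    ∃ C, 0 ≤ C ∧ ∀ F : NilSmooth, seminorm m R F ≤ C * fieldNorm m F := by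
  induction m using Nat.strong_induction_on with
  | _ m ih =>
  rcases m with _ | m
  · exact ⟨1, zero_le_one, fun F => seminorm_le F 0 R fun p _ => by
      rw [norm_iteratedFDeriv_zero, one_mul]; exact norm_apply_le F p⟩
  · choose! C hC0 hC using ih
    set B := ∑ i ∈ Finset.range (m + 1), C i with hB
    have hB0 : 0 ≤ B := Finset.sum_nonneg fun i hi => hC0 i (Finset.mem_range.1 hi)
    have hCB : ∀ i ≤ m, C i ≤ B := fun i hi => Finset.single_le_sum
      (f := C) (fun i hi => hC0 i (Finset.mem_range.1 hi)) (Finset.mem_range.2 (by omega))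
    have hx : ContDiff ℝ ∞ fun p : Heis => (p.1 : ℂ) := Complex.ofRealCLM.contDiff.comp contDiff_fst
    obtain ⟨A, hA0, hA⟩ := exists_iteratedFDeriv_bound hx m R
    have hbound : ∀ (j : Fin 3) (F : NilSmooth) (i : ℕ), i ≤ m → ∀ p : Heis, ‖p‖ ≤ R →
        ‖iteratedFDeriv ℝ i (D (frame j) F) p‖ ≤ B * fieldNorm (m + 1) F := by
      intro j F i hi p hp
      calc _ ≤ C i * fieldNorm i (D (frame j) F) :=
            (norm_le_seminorm _ i R hp).trans (hC i (by omega) _)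
        _ ≤ B * fieldNorm (m + 1) F := by
            refine mul_le_mul (hCB i hi) ?_ (apply_nonneg _ _) hB0
            exact (fieldNorm_D_le i j F).trans (fieldNorm_mono (by omega) F)
    let L : (Heis →L[ℝ] ℝ) → ℂ →L[ℝ] (Heis →L[ℝ] ℂ) := fun l =>
      ContinuousLinearMap.smulRightL ℝ Heis ℂ l
    let l₀ : Heis →L[ℝ] ℝ := ContinuousLinearMap.fst ℝ ℝ (ℝ × ℝ)
    let l₁ : Heis →L[ℝ] ℝ := (ContinuousLinearMap.fst ℝ ℝ ℝ).comp (.snd ℝ ℝ (ℝ × ℝ))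
    let l₂ : Heis →L[ℝ] ℝ := (ContinuousLinearMap.snd ℝ ℝ ℝ).comp (.snd ℝ ℝ (ℝ × ℝ))
    refine ⟨‖L l₀‖ * B + ‖L l₁‖ * (B + 2 ^ m * (A * B) * (m + 1)) + ‖L l₂‖ * B, by positivity,
      fun F => seminorm_le F (m + 1) R fun p hp => ?_⟩
    have hmul : ContDiff ℝ ∞ fun p : Heis => (p.1 : ℂ) * D (frame 2) F p :=
      hx.mul (D (frame 2) F).contDiff
    -- in the coordinates, `∂_x = D₀`, `∂_y = D₁ - x D₂` and `∂_z = D₂`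
    have hF : fderiv ℝ F = fun p => L l₀ (D (frame 0) F p)
        + L l₁ (D (frame 1) F p - p.1 * D (frame 2) F p) + L l₂ (D (frame 2) F p) := by
      ext1 p
      refine ContinuousLinearMap.ext fun w => ?_
      rw [fderiv_eq_fieldDeriv]
      simp [L, l₀, l₁, l₂, D_apply]
    have hle : ((m : ℕ) : ℕ∞ω) ≤ ∞ := by exact_mod_cast le_top
    have c0 : ContDiff ℝ ∞ fun p => L l₀ (D (frame 0) F p) :=
      (L l₀).contDiff.comp (D (frame 0) F).contDiff
    have c1 : ContDiff ℝ ∞ fun p => L l₁ (D (frame 1) F p - p.1 * D (frame 2) F p) :=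
      (L l₁).contDiff.comp ((D (frame 1) F).contDiff.sub hmul)
    have c2 : ContDiff ℝ ∞ fun p => L l₂ (D (frame 2) F p) :=
      (L l₂).contDiff.comp (D (frame 2) F).contDiff
    rw [← norm_iteratedFDeriv_fderiv, hF, fun_iteratedFDeriv_add_apply
      ((c0.add c1).contDiffAt.of_le hle) (c2.contDiffAt.of_le hle),
      fun_iteratedFDeriv_add_apply (c0.contDiffAt.of_le hle) (c1.contDiffAt.of_le hle)]
    have b0 := (L l₀).norm_iteratedFDeriv_comp_left (x := p) (D (frame 0) F).contDiff.contDiffAt hle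
    have b1 := (L l₁).norm_iteratedFDeriv_comp_left (x := p)
      ((D (frame 1) F).contDiff.sub hmul).contDiffAt hle
    have b2 := (L l₂).norm_iteratedFDeriv_comp_left (x := p) (D (frame 2) F).contDiff.contDiffAt hle
    have hm := norm_iteratedFDeriv_mul_le (𝕜 := ℝ) (n := m) hx (D (frame 2) F).contDiff p hle
    have hm' : ‖iteratedFDeriv ℝ m (fun p : Heis => (p.1 : ℂ) * D (frame 2) F p) p‖
        ≤ 2 ^ m * (A * B) * (m + 1) * fieldNorm (m + 1) F := by
      refine hm.trans ((Finset.sum_le_card_nsmul _ _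
        (2 ^ m * (A * (B * fieldNorm (m + 1) F))) fun i hi => ?_).trans (le_of_eq ?_))
      · have h1 : ((m.choose i : ℕ) : ℝ) ≤ 2 ^ m := by exact_mod_cast Nat.choose_le_two_pow m i
        have h2 := hA i (by simpa [Nat.lt_succ_iff] using hi) p hp
        have h3 := hbound 2 F (m - i) (by omega) p hp
        rw [mul_assoc]
        gcongr
      · simp
        ring
    have hs : ‖iteratedFDeriv ℝ m (fun p : Heis => D (frame 1) F p - (p.1 : ℂ) * D (frame 2) F p) p‖
        ≤ B * fieldNorm (m + 1) F + 2 ^ m * (A * B) * (m + 1) * fieldNorm (m + 1) F := by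
      rw [fun_iteratedFDeriv_sub_apply ((D (frame 1) F).contDiff.contDiffAt.of_le hle)
        (hmul.contDiffAt.of_le hle)]
      exact (norm_sub_le _ _).trans (add_le_add (hbound 1 F m le_rfl p hp) hm')
    calc _ ≤ ‖L l₀‖ * (B * fieldNorm (m + 1) F)
          + ‖L l₁‖ * (B * fieldNorm (m + 1) F + 2 ^ m * (A * B) * (m + 1) * fieldNorm (m + 1) F)
          + ‖L l₂‖ * (B * fieldNorm (m + 1) F) := by
          refine (norm_add_le _ _).trans (add_le_add ((norm_add_le _ _).trans (add_le_add ?_ ?_)) ?_)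
          · exact b0.trans (by gcongr; exact hbound 0 F m le_rfl p hp)
          · exact b1.trans (by gcongr)
          · exact b2.trans (by gcongr; exact hbound 2 F m le_rfl p hp)
      _ = _ := by ring

end NilSmooth

/-! ### Convergence in the smooth and in the strong topology -/

namespace NilSmooth

open Filter Topology

theorem continuous_of_fieldNorm {E : Type*} [AddCommGroup E] [Module ℂ E] [TopologicalSpace E]
    [IsTopologicalAddGroup E] (L : E →ₗ[ℂ] NilSmooth)
    (h : ∀ m, Continuous fun x => fieldNorm m (L x)) : Continuous L := by
  refine withSeminorms.continuous_of_continuous_comp L fun i => ?_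
  obtain ⟨C, hC0, hC⟩ := exists_seminorm_le_fieldNorm i.1 i.2
  let q : Seminorm ℂ E := C.toNNReal • (fieldNorm i.1).comp L
  have hq : (q : E → ℝ) = fun x => C * fieldNorm i.1 (L x) := by
    ext x
    simp [q, NNReal.smul_def, hC0]
  refine Seminorm.continuous_of_le (q := q) ?_ fun x => ?_
  · rw [hq]
    exact continuous_const.mul (h i.1)
  · rw [hq]
    exact hC (L x)

theorem tendsto_of_fieldNorm {ι : Type*} {l : Filter ι} (u : ι → NilSmooth) (F : NilSmooth)
    (h : ∀ m, Tendsto (fun i => fieldNorm m (u i - F)) l (𝓝 0)) : Tendsto u l (𝓝 F) := by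
  rw [withSeminorms.tendsto_nhds u F]
  intro i ε hε
  obtain ⟨C, hC0, hC⟩ := exists_seminorm_le_fieldNorm i.1 i.2
  have h1 := (h i.1).const_mul C
  rw [mul_zero] at h1
  filter_upwards [h1.eventually_lt_const hε] with j hj
  exact (hC _).trans_lt hj

/-- Termwise convergence in the `C^∞` topology of families of elements of `C^∞(N_ℤ \ N)` that depend
on a parameter and are stable under the left-invariant vector fields: a uniform bound on the terms
themselves suffices, because the derivatives are again members of the family. -/
theorem hasSum_of_commute {E ι : Type*} (d : Fin 3 → E → E) (G : ι → E → NilSmooth)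
    (G' : E → NilSmooth) (hG : ∀ i j φ, D (frame j) (G i φ) = G i (d j φ))
    (hG' : ∀ j φ, D (frame j) (G' φ) = G' (d j φ))
    (hbd : ∀ φ, ∃ u : ι → ℝ, Summable u ∧ ∀ i p, ‖G i φ p‖ ≤ u i)
    (hsum : ∀ φ p, HasSum (fun i => G i φ p) (G' φ p)) (φ : E) :
    HasSum (fun i => G i φ) (G' φ) := by
  refine tendsto_of_fieldNorm _ _ fun m => ?_
  induction m generalizing φ with
  | zero =>
    obtain ⟨u, hu, hb⟩ := hbd φ
    have h := tendstoUniformly_tsum hu hb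
    rw [Metric.tendstoUniformly_iff] at h
    rw [Metric.tendsto_nhds]
    intro ε hε
    filter_upwards [h (ε / 2) (half_pos hε)] with s hs
    rw [Real.dist_eq, sub_zero, abs_of_nonneg (apply_nonneg _ _)]
    refine lt_of_le_of_lt (fieldNorm_zero_le fun p => ?_) (half_lt_self hε)
    have := hs p
    rw [(hsum φ p).tsum_eq, dist_comm, dist_eq_norm] at this
    rw [sub_coe, sum_apply]
    exact this.le
  | succ m ih =>
    have key : ∀ j, Tendsto (fun s => fieldNorm m (D (frame j) (∑ i ∈ s, G i φ - G' φ)))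
        (atTop : Filter (Finset ι)) (𝓝 0) := fun j => by
      simp only [map_sub, map_sum, hG, hG']
      exact ih (d j φ)
    have h := (ih φ).add (tendsto_finsetSum Finset.univ fun j _ => key j)
    simp only [Finset.sum_const_zero, add_zero] at h
    exact h.congr fun s => (fieldNorm_succ m _).symm

/-- Bounds for an operator that commutes with the left-invariant vector fields propagate from the
sup norm to all the norms `fieldNorm m`. -/
theorem fieldNorm_le_of_commute (P : NilSmooth → NilSmooth)
    (hP : ∀ j F, D (frame j) (P F) = P (D (frame j) F)) (c : ℝ) (k : ℕ)
    (h : ∀ F p, ‖P F p‖ ≤ c * fieldNorm k F) (m : ℕ) (F : NilSmooth) :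
    fieldNorm m (P F) ≤ c * fieldNorm (m + k) F := by
  induction m generalizing F with
  | zero => simpa using fieldNorm_zero_le (h F)
  | succ m ih =>
    rw [fieldNorm_succ, show m + 1 + k = (m + k) + 1 by ring, fieldNorm_succ, mul_add,
      Finset.mul_sum]
    refine add_le_add (ih F) (Finset.sum_le_sum fun j _ => ?_)
    rw [hP]
    exact ih _

theorem exists_norm_le_fieldNorm (τ : NilDistribution) :
    ∃ C m, 0 ≤ C ∧ ∀ F, ‖τ F‖ ≤ C * fieldNorm m F := by
  obtain ⟨s, C, -, hC⟩ := Seminorm.bound_of_continuous withSeminorms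
    ((normSeminorm ℂ ℂ).comp (τ : NilSmooth →ₗ[ℂ] ℂ)) (continuous_norm.comp τ.continuous)
  choose A hA0 hA using exists_seminorm_le_fieldNorm
  refine ⟨C * ∑ i ∈ s, A i.1 i.2, ∑ i ∈ s, i.1,
    mul_nonneg C.2 (Finset.sum_nonneg fun i _ => hA0 _ _), fun F => ?_⟩
  refine (hC F).trans ?_
  change (C : ℝ) * s.sup seminormFamily F ≤ _
  rw [mul_assoc]
  refine mul_le_mul_of_nonneg_left (Seminorm.finset_sup_apply_le (by
    exact mul_nonneg (Finset.sum_nonneg fun i _ => hA0 _ _) (apply_nonneg _ _)) fun i hi => ?_) C.2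
  refine (hA i.1 i.2 F).trans (mul_le_mul ?_ (fieldNorm_mono ?_ F) (apply_nonneg _ _)
    (Finset.sum_nonneg fun i _ => hA0 _ _))
  · exact Finset.single_le_sum (f := fun i : ℕ × ℕ => A i.1 i.2) (fun i _ => hA0 _ _) hi
  · exact Finset.single_le_sum (f := fun i : ℕ × ℕ => i.1) (fun i _ => Nat.zero_le _) hi

theorem exists_fieldNorm_le_of_isVonNBounded {B : Set NilSmooth} (hB : Bornology.IsVonNBounded ℂ B)
    (m : ℕ) : ∃ r > 0, ∀ F ∈ B, fieldNorm m F ≤ r := by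
  obtain ⟨s, C, -, hC⟩ := Seminorm.bound_of_continuous withSeminorms (fieldNorm m) (continuous_fieldNorm m)
  obtain ⟨r, hr, h⟩ := (withSeminorms.isVonNBounded_iff_finset_seminorm_bounded.1 hB) s
  refine ⟨C * r + 1, by positivity, fun F hF => (hC F).trans ?_⟩
  change (C : ℝ) * s.sup seminormFamily F ≤ _
  exact (mul_le_mul_of_nonneg_left (h F hF).le C.2).trans (le_add_of_nonneg_right zero_le_one)

end NilSmooth

open NilSmooth Filter Topology in
/-- A family of distributions with summable bounds is unconditionally summable in the strong
topology. -/
theorem exists_hasSum_distribution {ι : Type*} (T : ι → NilDistribution) {w : ι → ℝ}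
    (hw : Summable w) (m : ℕ) (h : ∀ i F, ‖T i F‖ ≤ w i * fieldNorm m F) :
    ∃ L : NilDistribution, HasSum T L := by
  have hs : ∀ F, Summable fun i => T i F := fun F =>
    Summable.of_norm_bounded (hw.mul_right _) fun i => h i F
  let L : NilSmooth →ₗ[ℂ] ℂ :=
    { toFun := fun F => ∑' i, T i F
      map_add' := fun F G => by
        simp only [map_add]
        exact (hs F).tsum_add (hs G)
      map_smul' := fun c F => by
        simp only [map_smul, smul_eq_mul, RingHom.id_apply]
        exact tsum_mul_left }
  have hL : ∀ F, ‖L F‖ ≤ (∑' i, w i) * fieldNorm m F := fun F => by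
    rw [← tsum_mul_right]
    exact tsum_of_norm_bounded (hw.mul_right _).hasSum fun i => h i F
  have hcont : Continuous L := by
    refine continuous_of_continuousAt_zero L ?_
    rw [ContinuousAt, map_zero]
    refine squeeze_zero_norm hL ?_
    have := ((continuous_fieldNorm m).tendsto 0).const_mul (∑' i, w i)
    rwa [map_zero, mul_zero] at this
  refine ⟨⟨L, hcont⟩, ?_⟩
  rw [HasSum]
  refine (UniformConvergenceCLM.tendsto_iff_tendstoUniformlyOn (RingHom.id ℂ) (F := ℂ)
    {B | Bornology.IsVonNBounded ℂ B}).2 fun B hB => ?_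
  obtain ⟨r, hr, hBr⟩ := exists_fieldNorm_le_of_isVonNBounded hB m
  -- negative weights are harmless: the norms are bounded by `|w i| r` on `B`
  have := tendstoUniformlyOn_tsum (f := fun i F => T i F) (s := B) (hw.abs.mul_right r)
    fun i F hF => (h i F).trans (mul_le_mul (le_abs_self _) (hBr F hF) (apply_nonneg _ _)
      (abs_nonneg _))
  refine this.congr (Eventually.of_forall fun s F _ => ?_)
  exact (_root_.sum_apply s T F).symm

theorem hasSum_distribution_apply {ι : Type*} {T : ι → NilDistribution} {L : NilDistribution}
    (h : HasSum T L) (F : NilSmooth) : HasSum (fun i => T i F) (L F) :=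
  h.map (⟨⟨fun T : NilDistribution => T F, rfl⟩, fun _ _ => rfl⟩ : NilDistribution →+ ℂ)
    (continuous_eval_const F)

/-! ### The character `e` and Fourier series on the circle -/

theorem e_add (s t : ℝ) : e (s + t) = e s * e t := by
  simp only [e, ← Complex.exp_add]
  congr 1
  push_cast
  ring

@[simp] theorem e_zero : e 0 = 1 := by simp [e]

theorem e_intCast (n : ℤ) : e n = 1 := by
  rw [e, Complex.exp_eq_one_iff]
  exact ⟨n, by push_cast; ring⟩

theorem e_add_intCast (t : ℝ) (n : ℤ) : e (t + n) = e t := by rw [e_add, e_intCast, mul_one]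

theorem norm_e (t : ℝ) : ‖e t‖ = 1 := by
  rw [e, show (2 * Real.pi * Complex.I * t : ℂ) = ((2 * Real.pi * t : ℝ) : ℂ) * Complex.I by
    push_cast; ring, Complex.norm_exp_ofReal_mul_I]

theorem contDiff_e_id : ContDiff ℝ ∞ e :=
  (contDiff_const.mul Complex.ofRealCLM.contDiff).cexp

theorem continuous_e : Continuous e := contDiff_e_id.continuous

theorem hasDerivAt_e_mul (c t : ℝ) :
    HasDerivAt (fun t => e (c * t)) (2 * Real.pi * Complex.I * c * e (c * t)) t := by
  have h : HasDerivAt (fun t : ℝ => 2 * Real.pi * Complex.I * ((c * t : ℝ) : ℂ))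
      (2 * Real.pi * Complex.I * ((c * 1 : ℝ) : ℂ)) t :=
    (((hasDerivAt_id t).const_mul c).ofReal_comp).const_mul _
  have h' := h.cexp
  unfold e
  convert! h' using 1
  push_cast
  ring

/-- The Fourier series of a continuous function with period `1`, evaluated at the origin. -/
theorem hasSum_fourier_at_zero {Φ : ℝ → ℂ} (hc : Continuous Φ) (hp : Function.Periodic Φ 1)
    (hs : Summable fun n : ℤ => ∫ t in (0 : ℝ)..1, e (n * t) * Φ t) :
    HasSum (fun n : ℤ => ∫ t in (0 : ℝ)..1, e (n * t) * Φ t) (Φ 0) := by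
  have : Fact ((0 : ℝ) < 1) := ⟨one_pos⟩
  let f : C(AddCircle (1 : ℝ), ℂ) := ⟨hp.lift, continuous_coinduced_dom.mpr hc⟩
  have hcoef : ∀ n : ℤ, fourierCoeff f (-n) = ∫ t in (0 : ℝ)..1, e (n * t) * Φ t := fun n => by
    rw [fourierCoeff_eq_intervalIntegral f (-n) 0]
    simp only [neg_neg, zero_add, div_one, one_smul, smul_eq_mul]
    congr 1
    ext t
    congr 1
    rw [fourier_coe_apply, e]
    congr 1
    push_cast
    ring
  have hs' : Summable (fourierCoeff f) := by
    rw [← (Equiv.neg ℤ).summable_iff]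
    exact hs.congr fun n => (hcoef n).symm
  have h := has_pointwise_sum_fourier_series_of_summable hs' ((0 : ℝ) : AddCircle (1 : ℝ))
  rw [← (Equiv.neg ℤ).hasSum_iff] at h
  convert! h using 1
  ext n
  simp [hcoef]

/-! ### Averages of left translates -/

theorem contDiff_fderiv_left {G : Type*} [NormedAddCommGroup G] [NormedSpace ℝ G]
    {f : Heis × ℝ → G} (hf : ContDiff ℝ ∞ f) :
    ContDiff ℝ ∞ fun q : Heis × ℝ => fderiv ℝ (fun p => f (p, q.2)) q.1 := by
  have hf' : ∀ q : Heis × ℝ, fderiv ℝ (fun p => f (p, q.2)) q.1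
      = (fderiv ℝ f q).comp (ContinuousLinearMap.inl ℝ Heis ℝ) := fun q => by
    have h1 := (hf.contDiffAt.differentiableAt (x := q) (by simp)).hasFDerivAt
    exact (h1.comp q.1 (f := fun p : Heis => (p, q.2)) (hasFDerivAt_prodMk_left q.1 q.2)).fderiv
  simp only [hf']
  exact (hf.fderiv_right (by simp)).clm_comp contDiff_const

theorem hasFDerivAt_intervalIntegral {G : Type*} [NormedAddCommGroup G] [NormedSpace ℝ G]
    [CompleteSpace G] {f : Heis × ℝ → G} (hf : ContDiff ℝ ∞ f) (p₀ : Heis) :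
    HasFDerivAt (fun p => ∫ t in (0 : ℝ)..1, f (p, t))
      (∫ t in (0 : ℝ)..1, fderiv ℝ (fun p => f (p, t)) p₀) p₀ := by
  have hg := contDiff_fderiv_left hf
  obtain ⟨C, hC⟩ := ((isCompact_closedBall p₀ 1).prod (isCompact_Icc (a := (0 : ℝ)) (b := 1)))
    |>.exists_bound_of_continuousOn hg.continuous.continuousOn
  refine (intervalIntegral.hasFDerivAt_integral_of_dominated_of_fderiv_le
    (F := fun p t => f (p, t)) (F' := fun p t => fderiv ℝ (fun p => f (p, t)) p)
    (bound := fun _ => C) (Metric.ball_mem_nhds p₀ one_pos) ?_ ?_ ?_ ?_ ?_ ?_)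
  · exact Filter.Eventually.of_forall fun p =>
      (hf.continuous.comp (by fun_prop : Continuous fun t : ℝ => (p, t))).aestronglyMeasurable
  · exact (hf.continuous.comp
      (by fun_prop : Continuous fun t : ℝ => (p₀, t))).intervalIntegrable _ _
  · exact (hg.continuous.comp
      (by fun_prop : Continuous fun t : ℝ => (p₀, t))).aestronglyMeasurable
  · refine Filter.Eventually.of_forall fun t ht p hp => hC (p, t) ⟨Metric.ball_subset_closedBall hp, ?_⟩
    rw [Set.uIoc_of_le zero_le_one] at ht
    exact ⟨ht.1.le, ht.2⟩
  · exact intervalIntegrable_const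
  · refine Filter.Eventually.of_forall fun t _ p _ => ?_
    exact ((hf.comp (by fun_prop : ContDiff ℝ ∞ fun p : Heis => (p, t))).contDiffAt.differentiableAt
      (by simp)).hasFDerivAt

theorem contDiff_intervalIntegral_nat (n : ℕ) {G : Type} [NormedAddCommGroup G] [NormedSpace ℝ G]
    [CompleteSpace G] {f : Heis × ℝ → G} (hf : ContDiff ℝ ∞ f) :
    ContDiff ℝ n fun p => ∫ t in (0 : ℝ)..1, f (p, t) := by
  induction n generalizing G with
  | zero =>
    exact contDiff_zero.2 (continuous_iff_continuousAt.2 fun p =>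
      (hasFDerivAt_intervalIntegral hf p).continuousAt)
  | succ n ih =>
    exact_mod_cast contDiff_succ_iff_hasFDerivAt.2
      ⟨_, ih (contDiff_fderiv_left hf), hasFDerivAt_intervalIntegral hf⟩

/-- The average `p ↦ ∫₀¹ e(nt) Φ(q(t) p) dt` of the left translates of `Φ` along the curve `q`. -/
def leftAvg (q : ℝ → Heis) (n : ℤ) (Φ : Heis → ℂ) (p : Heis) : ℂ :=
  ∫ t in (0 : ℝ)..1, e (n * t) * Φ (Heis.mul (q t) p)

theorem contDiff_mul_uncurry {E : Type*} [NormedAddCommGroup E] [NormedSpace ℝ E]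
    {a b : E → Heis} (ha : ContDiff ℝ ∞ a) (hb : ContDiff ℝ ∞ b) :
    ContDiff ℝ ∞ fun x => Heis.mul (a x) (b x) := by
  unfold Heis.mul
  fun_prop

theorem contDiff_leftAvg_integrand {q : ℝ → Heis} (hq : ContDiff ℝ ∞ q) {n : ℤ} {Φ : Heis → ℂ}
    (hΦ : ContDiff ℝ ∞ Φ) :
    ContDiff ℝ ∞ fun x : Heis × ℝ => e (n * x.2) * Φ (Heis.mul (q x.2) x.1) :=
  (contDiff_e_id.comp (by fun_prop)).mul
    (hΦ.comp (contDiff_mul_uncurry (hq.comp contDiff_snd) contDiff_fst))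

theorem contDiff_leftAvg {q : ℝ → Heis} (hq : ContDiff ℝ ∞ q) {n : ℤ} {Φ : Heis → ℂ}
    (hΦ : ContDiff ℝ ∞ Φ) : ContDiff ℝ ∞ (leftAvg q n Φ) :=
  contDiff_infty.2 fun m => contDiff_intervalIntegral_nat m (contDiff_leftAvg_integrand hq hΦ)

theorem fieldDeriv_leftAvg {q : ℝ → Heis} (hq : ContDiff ℝ ∞ q) {n : ℤ} {Φ : Heis → ℂ}
    (hΦ : ContDiff ℝ ∞ Φ) (v : Heis) :
    fieldDeriv v (leftAvg q n Φ) = leftAvg q n (fieldDeriv v Φ) := by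
  ext p
  have hf := contDiff_leftAvg_integrand hq hΦ (n := n)
  unfold leftAvg fieldDeriv
  rw [(hasFDerivAt_intervalIntegral hf p).fderiv]
  rw [ContinuousLinearMap.intervalIntegral_apply]
  · congr 1
    ext t
    have hd : DifferentiableAt ℝ (fun p => Φ (Heis.mul (q t) p)) p :=
      (hΦ.comp (contDiff_mul_left (q t))).contDiffAt.differentiableAt (by simp)
    simp only
    rw [fderiv_const_mul hd]
    exact congrArg (e (n * t) * ·) (fieldDeriv_comp_mul_left v (q t) p
      (hΦ.contDiffAt.differentiableAt (by simp)))
  · exact ((contDiff_fderiv_left hf).continuous.comp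
      (by fun_prop : Continuous fun t : ℝ => (p, t))).intervalIntegrable _ _

theorem norm_leftAvg_le {q : ℝ → Heis} {n : ℤ} {Φ : Heis → ℂ} {C : ℝ} (h : ∀ p, ‖Φ p‖ ≤ C)
    (p : Heis) : ‖leftAvg q n Φ p‖ ≤ C := by
  have := intervalIntegral.norm_integral_le_of_norm_le_const (a := 0) (b := 1) (C := C)
    (f := fun t => e (n * t) * Φ (Heis.mul (q t) p)) fun t _ => by
      rw [norm_mul, norm_e, one_mul]
      exact h _
  simpa [leftAvg] using this

theorem leftAvg_add {q : ℝ → Heis} (hq : Continuous q) (n : ℤ) {Φ Ψ : Heis → ℂ}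
    (hΦ : Continuous Φ) (hΨ : Continuous Ψ) (p : Heis) :
    leftAvg q n (fun p => Φ p + Ψ p) p = leftAvg q n Φ p + leftAvg q n Ψ p := by
  have h : ∀ {Φ : Heis → ℂ}, Continuous Φ → IntervalIntegrable
      (fun t : ℝ => e (n * t) * Φ (Heis.mul (q t) p)) volume 0 1 := fun hΦ => by
    refine Continuous.intervalIntegrable ?_ _ _
    refine (continuous_e.comp (by fun_prop)).mul (hΦ.comp ?_)
    unfold Heis.mul
    fun_prop
  unfold leftAvg
  rw [← intervalIntegral.integral_add (h hΦ) (h hΨ)]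
  simp only [mul_add]

theorem leftAvg_const_mul (q : ℝ → Heis) (n : ℤ) (c : ℂ) (Φ : Heis → ℂ) (p : Heis) :
    leftAvg q n (fun p => c * Φ p) p = c * leftAvg q n Φ p := by
  unfold leftAvg
  rw [← intervalIntegral.integral_const_mul]
  congr 1
  ext t
  ring

theorem integral_e_mul_shift {g : ℝ → ℂ} (hg : Function.Periodic g 1) (n : ℤ) (s : ℝ) :
    ∫ t in (0 : ℝ)..1, e (n * t) * g (t + s) = e (-(n * s)) * ∫ t in (0 : ℝ)..1, e (n * t) * g t := by
  have hper : Function.Periodic (fun t => e (n * t) * g t) 1 := fun t => by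
    simp only [hg t, mul_add, mul_one, e_add_intCast]
  rw [← intervalIntegral.integral_const_mul]
  have h1 : ∀ t : ℝ, e (n * t) * g (t + s)
      = (fun t => e (-(n * s)) * (e (n * t) * g t)) (t + s) := fun t => by
    simp only [← mul_assoc, ← e_add]
    congr 2
    ring
  simp only [h1]
  rw [intervalIntegral.integral_comp_add_right
    (fun t => e (-(n * s)) * (e (n * t) * g t)), zero_add, add_comm (1 : ℝ) s,
    intervalIntegral.integral_const_mul, intervalIntegral.integral_const_mul,
    hper.intervalIntegral_add_eq s 0, zero_add]

/-- A function that transforms under a character along a curve tangent to a left-invariant field is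
an eigenfunction of that field. -/
theorem fieldDeriv_of_eigen {G : Heis → ℂ} (hG : ContDiff ℝ ∞ G) (v p : Heis) (l : ℝ)
    (h : ∀ t : ℝ, G (p + t • leftField v p) = e (l * t) * G p) :
    fieldDeriv v G p = 2 * Real.pi * Complex.I * l * G p := by
  have h1 : HasDerivAt (fun t : ℝ => G (p + t • leftField v p)) (fieldDeriv v G p) 0 := by
    have hd : HasFDerivAt G (fderiv ℝ G p) (p + (0 : ℝ) • leftField v p) := by
      rw [zero_smul, add_zero]
      exact (hG.contDiffAt.differentiableAt (by simp)).hasFDerivAt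
    have hc : HasDerivAt (fun t : ℝ => p + t • leftField v p) (leftField v p) 0 := by
      simpa using ((hasDerivAt_id (0 : ℝ)).smul_const (leftField v p)).const_add p
    exact hd.comp_hasDerivAt 0 hc
  have h2 : HasDerivAt (fun t : ℝ => e (l * t) * G p)
      (2 * Real.pi * Complex.I * l * e (l * 0) * G p) 0 := (hasDerivAt_e_mul l 0).mul_const _
  rw [mul_zero, e_zero, mul_one] at h2
  simp only [h] at h1
  exact h1.unique h2

namespace NilSmooth

/-- The operator `1 - D_j²`, which is inverted on eigenfunctions of `D_j`. -/
def oneSubSq (j : Fin 3) : NilSmooth →ₗ[ℂ] NilSmooth := LinearMap.id - D (frame j) ∘ₗ D (frame j)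

theorem fieldNorm_oneSubSq_le (j : Fin 3) (m : ℕ) (F : NilSmooth) :
    fieldNorm m (oneSubSq j F) ≤ 2 * fieldNorm (m + 2) F := by
  have h1 : fieldNorm m (oneSubSq j F) ≤ fieldNorm m F + fieldNorm m (D (frame j) (D (frame j) F)) :=
    map_sub_le_add _ _ _
  have h2 := fieldNorm_mono (show m ≤ m + 2 by omega) F
  have h3 := (fieldNorm_D_le m j (D (frame j) F)).trans (fieldNorm_D_le (m + 1) j F)
  linarith

/-- A functional that turns `D_j` into multiplication by `2πil` turns `1 - D_j²` into multiplication
by `1 + (2πl)²`, which does not vanish. -/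
theorem eigen_oneSubSq {j : Fin 3} {l : ℝ} {P : NilSmooth →ₗ[ℂ] ℂ}
    (hP : ∀ F, P (D (frame j) F) = 2 * Real.pi * Complex.I * l * P F) (F : NilSmooth) :
    P (oneSubSq j F) = ((1 + (2 * Real.pi * l) ^ 2 : ℝ) : ℂ) * P F := by
  simp only [oneSubSq, LinearMap.sub_apply, LinearMap.id_apply, LinearMap.comp_apply, map_sub, hP]
  push_cast
  linear_combination -(2 * Real.pi * l : ℂ) ^ 2 * P F * Complex.I_sq

/-- A loss of two derivatives gains a factor that is quadratic in the frequency. -/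
theorem norm_le_of_eigen {j : Fin 3} {l : ℝ} {P : NilSmooth →ₗ[ℂ] ℂ}
    (hP : ∀ F, P (D (frame j) F) = 2 * Real.pi * Complex.I * l * P F) {C : ℝ} {k : ℕ} (hC : 0 ≤ C)
    (h : ∀ F, ‖P F‖ ≤ C * fieldNorm k F) (F : NilSmooth) :
    ‖P F‖ ≤ (1 + (2 * Real.pi * l) ^ 2)⁻¹ * (2 * C) * fieldNorm (k + 2) F := by
  have h1 := (h (oneSubSq j F)).trans (mul_le_mul_of_nonneg_left (fieldNorm_oneSubSq_le j k F) hC)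
  have hpos : 0 < 1 + (2 * Real.pi * l) ^ 2 := by positivity
  rw [eigen_oneSubSq hP, norm_mul, Complex.norm_real, Real.norm_eq_abs, abs_of_pos hpos] at h1
  rw [mul_assoc, ← div_eq_inv_mul, le_div_iff₀ hpos]
  linarith

end NilSmooth

theorem summable_inv_one_add_sq :
    Summable fun n : ℤ => (1 + (2 * Real.pi * (n : ℝ)) ^ 2)⁻¹ := by
  refine Summable.of_nonneg_of_le (fun n => by positivity) (fun n => ?_)
    ((Real.summable_one_div_int_pow (p := 2)).2 one_lt_two |>.add
      (summable_of_hasFiniteSupport (f := fun n : ℤ => if n = 0 then (1 : ℝ) else 0)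
        ((Set.finite_singleton 0).subset fun n hn => by
          by_contra h
          simp_all)))
  rcases eq_or_ne n 0 with rfl | hn
  · simp
  · have : (0 : ℝ) < (n : ℝ) ^ 2 := by positivity
    simp only [hn, if_false, add_zero, one_div]
    refine inv_anti₀ this ?_
    have h4 : 1 ≤ (2 * Real.pi) ^ 2 := by nlinarith [Real.pi_gt_three]
    rw [mul_pow]
    nlinarith

/-! ### Central characters -/

theorem NilSmooth.apply_z_add (F : NilSmooth) (c : ℤ) (x y z : ℝ) :
    F (x, y, z + c) = F (x, y, z) := by
  rw [← F.invariant (0, 0, c) (x, y, z)]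
  exact congrArg (F : Heis → ℂ) (by ext <;> simp [Heis.mul, Heis.ofInt, add_comm])

theorem NilSmooth.periodic_z (F : NilSmooth) (x y z : ℝ) :
    Function.Periodic (fun t => F (x, y, z + t)) 1 := fun t => by
  simpa [add_assoc] using F.apply_z_add 1 x y (z + t)

theorem NilSmooth.apply_x_add (F : NilSmooth) (a : ℤ) (x y z : ℝ) :
    F (x + a, y, z + a * y) = F (x, y, z) := by
  rw [← F.invariant (a, 0, 0) (x, y, z)]
  exact congrArg (F : Heis → ℂ) (by ext <;> simp [Heis.mul, Heis.ofInt, add_comm])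

theorem NilSmooth.apply_y_add (F : NilSmooth) (b : ℤ) (x y z : ℝ) :
    F (x, y + b, z) = F (x, y, z) := by
  rw [← F.invariant (0, b, 0) (x, y, z)]
  exact congrArg (F : Heis → ℂ) (by ext <;> simp [Heis.mul, Heis.ofInt, add_comm])

/-- Left translation by `(0, j/n, 0)` followed by the projection to the functions that transform
under `(0, 0, t)` by `e(-nt)`. The translation is compatible with the action of `N_ℤ` only after
this projection. -/
def centralProj (n j : ℤ) : NilSmooth →ₗ[ℂ] NilSmooth where
  toFun F := ⟨leftAvg (fun t => (0, j / n, t)) n F,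
    contDiff_leftAvg (by fun_prop) F.contDiff, fun g p => by
      obtain ⟨a, b, c⟩ := g
      obtain ⟨x, y, z⟩ := p
      have h : ∀ t : ℝ, F (Heis.mul (0, j / n, t) (Heis.mul (Heis.ofInt (a, b, c)) (x, y, z)))
          = F (Heis.mul (0, j / n, t + -(a * (j / n))) (x, y, z)) := fun t => by
        rw [← F.invariant (a, b, c) (Heis.mul (0, j / n, t + -(a * (j / n))) (x, y, z))]
        exact congrArg (F : Heis → ℂ) (by ext <;> simp [Heis.mul, Heis.ofInt] <;> ring)
      unfold leftAvg
      simp only [h]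
      rw [integral_e_mul_shift (g := fun t => F (Heis.mul (0, j / n, t) (x, y, z)))
        (fun t => by
          refine Eq.trans (congrArg (F : Heis → ℂ) ?_)
            (F.apply_z_add 1 (0 + x) (j / n + y) (t + z + 0 * y))
          ext <;> simp [Heis.mul]
          ring)]
      have he : e (-(n * -(a * (j / n)) : ℝ)) = 1 := by
        rcases eq_or_ne n 0 with rfl | hn
        · simp
        · have : (n : ℝ) ≠ 0 := Int.cast_ne_zero.2 hn
          rw [← e_intCast (a * j)]
          congr 1
          push_cast
          field_simp
      rw [he, one_mul]⟩
  map_add' F G := NilSmooth.ext fun p =>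
    leftAvg_add (by fun_prop) n F.continuous G.continuous p
  map_smul' c F := NilSmooth.ext fun p => leftAvg_const_mul _ n c F p

theorem centralProj_apply (n j : ℤ) (F : NilSmooth) (x y z : ℝ) :
    centralProj n j F (x, y, z) = ∫ t in (0 : ℝ)..1, e (n * t) * F (x, y + j / n, z + t) := by
  change leftAvg _ n F _ = _
  unfold leftAvg
  congr 1
  ext t
  exact congrArg (fun q => e (n * t) * F q) (by ext <;> simp [Heis.mul, add_comm])

theorem D_centralProj (n j : ℤ) (v : Heis) (F : NilSmooth) :
    NilSmooth.D v (centralProj n j F) = centralProj n j (NilSmooth.D v F) :=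
  NilSmooth.ext fun p => congrFun (fieldDeriv_leftAvg (by fun_prop) F.contDiff v) p

theorem norm_centralProj_le (n j : ℤ) (F : NilSmooth) (p : Heis) :
    ‖centralProj n j F p‖ ≤ NilSmooth.fieldNorm 0 F :=
  norm_leftAvg_le F.norm_le_fieldNorm_zero p

theorem centralProj_z_add (n j : ℤ) (F : NilSmooth) (x y z t : ℝ) :
    centralProj n j F (x, y, z + t) = e (-(n * t)) * centralProj n j F (x, y, z) := by
  simp only [centralProj_apply]
  rw [← integral_e_mul_shift (g := fun s => F (x, y + j / n, z + s)) (F.periodic_z _ _ _)]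
  simp only [add_assoc, add_comm t]

theorem D_two_centralProj (n j : ℤ) (F : NilSmooth) (p : Heis) :
    centralProj n j (NilSmooth.D (frame 2) F) p
      = 2 * Real.pi * Complex.I * ((-n : ℝ) : ℂ) * centralProj n j F p := by
  rw [← D_centralProj]
  refine fieldDeriv_of_eigen (centralProj n j F).contDiff (frame 2) p (-n) fun t => ?_
  obtain ⟨x, y, z⟩ := p
  have : ((x, y, z) + t • leftField (frame 2) (x, y, z) : Heis) = (x, y, z + t) := by
    ext <;> simp [leftField, frame]
  rw [this, centralProj_z_add, neg_mul]

/-! ### Residue classes -/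

theorem e_div_eq_stdAddChar (n : NonzeroInt) (a : ℤ) :
    e ((a : ℝ) / n.1) = ZMod.stdAddChar ((n.1.sign * a : ℤ) : Residue n) := by
  rw [ZMod.stdAddChar_coe, e]
  congr 1
  have hn : (n.1 : ℂ) ≠ 0 := Int.cast_ne_zero.2 n.2
  have h1 : ((n.1.natAbs : ℕ) : ℂ) = n.1.sign * n.1 := by
    rw [← Int.cast_mul, Int.sign_mul_self_eq_natAbs]
    simp
  have h2 : (n.1.sign : ℂ) * n.1.sign = 1 := by
    have h : n.1.sign * n.1.sign = 1 := by
      rcases lt_trichotomy n.1 0 with h | h | h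
      · simp [Int.sign_eq_neg_one_of_neg h]
      · exact absurd h n.2
      · simp [Int.sign_eq_one_of_pos h]
    exact_mod_cast h
  have h3 : (n.1.sign : ℂ) ≠ 0 := left_ne_zero_of_mul_eq_one h2
  rw [h1]
  push_cast
  field_simp

theorem isUnit_sign (n : NonzeroInt) : IsUnit ((n.1.sign : ℤ) : Residue n) :=
  (Int.isUnit_iff_natAbs_eq.2 (Int.natAbs_sign_of_ne_zero n.2)).map (Int.castRingHom (Residue n))

theorem e_div_congr (n : NonzeroInt) {a b : ℤ} (h : (a : Residue n) = b) :
    e ((a : ℝ) / n.1) = e ((b : ℝ) / n.1) := by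
  rw [e_div_eq_stdAddChar, e_div_eq_stdAddChar]
  push_cast
  rw [h]

theorem sum_e_val_mul_val (n : NonzeroInt) (j : Residue n) :
    ∑ k : Residue n, e ((j.val : ℝ) * (k.val : ℝ) / n.1)
      = if j = 0 then (n.1.natAbs : ℂ) else 0 := by
  have h := AddChar.sum_mulShift (((n.1.sign : ℤ) : Residue n) * j)
    (ZMod.isPrimitive_stdAddChar n.1.natAbs)
  simp only [(isUnit_sign n).mul_right_eq_zero, ZMod.card] at h
  convert h using 2 with k
  · rw [show ((j.val : ℝ) * (k.val : ℝ) / n.1) = (((j.val * k.val : ℕ) : ℤ) : ℝ) / n.1 by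
      push_cast; rfl, e_div_eq_stdAddChar]
    congr 1
    push_cast
    simp only [ZMod.natCast_zmod_val]
    ring
  · split_ifs <;> simp

/-- The projection of `C^∞(N_ℤ \ N)` that is dual to the component with indices `n` and `k`. Up to
the central character, it keeps the frequencies `-ℓ` in the variable `y` with `ℓ ≡ k (mod n)`. -/
def residueProj (n : NonzeroInt) (k : Residue n) : NilSmooth →ₗ[ℂ] NilSmooth :=
  (n.1.natAbs : ℂ)⁻¹ • ∑ j : Residue n,
    e ((j.val : ℝ) * (k.val : ℝ) / n.1) • centralProj n.1 (j.val : ℤ)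

theorem residueProj_apply (n : NonzeroInt) (k : Residue n) (F : NilSmooth) (p : Heis) :
    residueProj n k F p = (n.1.natAbs : ℂ)⁻¹ * ∑ j : Residue n,
      e ((j.val : ℝ) * (k.val : ℝ) / n.1) * centralProj n.1 (j.val : ℤ) F p := by
  rw [residueProj, LinearMap.smul_apply, NilSmooth.smul_apply, LinearMap.sum_apply,
    NilSmooth.sum_apply]
  rfl

theorem natAbs_cast_ne_zero (n : NonzeroInt) : (n.1.natAbs : ℂ) ≠ 0 :=
  Nat.cast_ne_zero.2 (Int.natAbs_ne_zero.2 n.2)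

theorem sum_residueProj (n : NonzeroInt) (F : NilSmooth) :
    ∑ k, residueProj n k F = centralProj n.1 0 F := by
  refine NilSmooth.ext fun p => ?_
  rw [NilSmooth.sum_apply]
  simp only [residueProj_apply]
  rw [← Finset.mul_sum, Finset.sum_comm]
  simp only [← Finset.sum_mul, sum_e_val_mul_val, ite_mul, zero_mul]
  rw [Finset.sum_ite_eq' Finset.univ (0 : Residue n), if_pos (Finset.mem_univ _), ZMod.val_zero,
    inv_mul_cancel_left₀ (natAbs_cast_ne_zero n)]
  rfl

theorem D_residueProj (n : NonzeroInt) (k : Residue n) (v : Heis) (F : NilSmooth) :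
    NilSmooth.D v (residueProj n k F) = residueProj n k (NilSmooth.D v F) := by
  simp only [residueProj, LinearMap.smul_apply, LinearMap.sum_apply, map_smul, map_sum,
    D_centralProj]

theorem norm_residueProj_le (n : NonzeroInt) (k : Residue n) (F : NilSmooth) (p : Heis) :
    ‖residueProj n k F p‖ ≤ NilSmooth.fieldNorm 0 F := by
  have hpos : (0 : ℝ) < n.1.natAbs := Nat.cast_pos.2 (Int.natAbs_pos.2 n.2)
  rw [residueProj_apply, norm_mul, norm_inv, Complex.norm_natCast, inv_mul_le_iff₀ hpos]
  refine (norm_sum_le_of_le _ (n := fun _ => NilSmooth.fieldNorm 0 F) fun j _ => ?_).trans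
    (le_of_eq ?_)
  · rw [norm_mul, norm_e, one_mul]
    exact norm_centralProj_le _ _ F p
  · simp

/-- The summable weights that dominate the projections `residueProj n k`. -/
def residueWeight (n : NonzeroInt) : ℝ :=
  (1 + (2 * Real.pi * (n.1 : ℝ)) ^ 2)⁻¹ * ((1 + (2 * Real.pi * (n.1 : ℝ)) ^ 2)⁻¹ * 4)

theorem norm_residueProj_le_weight (n : NonzeroInt) (k : Residue n) (F : NilSmooth) (p : Heis) :
    ‖residueProj n k F p‖ ≤ residueWeight n * NilSmooth.fieldNorm 4 F := by
  let P : NilSmooth →ₗ[ℂ] ℂ :=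
    { toFun := fun F => residueProj n k F p
      map_add' := fun F G => by rw [map_add]; rfl
      map_smul' := fun c F => by rw [map_smul]; rfl }
  have hP : ∀ F, P (NilSmooth.D (frame 2) F)
      = 2 * Real.pi * Complex.I * ((-n.1 : ℝ) : ℂ) * P F := fun F => by
    change residueProj n k _ p = _ * residueProj n k F p
    simp only [residueProj_apply, D_two_centralProj, Finset.mul_sum]
    exact Finset.sum_congr rfl fun j _ => by ring
  have h1 := NilSmooth.norm_le_of_eigen hP zero_le_one (k := 0) fun F => by
    rw [one_mul]
    exact norm_residueProj_le n k F p
  have h2 := NilSmooth.norm_le_of_eigen hP (by positivity) h1 F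
  refine h2.trans (le_of_eq ?_)
  rw [residueWeight, mul_neg, neg_sq]
  ring

theorem summable_residueWeight :
    Summable fun i : (n : NonzeroInt) × Residue n => residueWeight i.1 := by
  refine (summable_sigma_of_nonneg fun i => by unfold residueWeight; positivity).2
    ⟨fun n => (hasSum_fintype _).summable, ?_⟩
  simp only [tsum_fintype, Finset.sum_const, Finset.card_univ, ZMod.card, nsmul_eq_mul]
  refine Summable.of_nonneg_of_le (fun n => by unfold residueWeight; positivity) (fun n => ?_)
    ((summable_inv_one_add_sq.comp_injective
      (Subtype.val_injective (p := fun n : ℤ => n ≠ 0))).mul_right 4)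
  have hpos : 0 < 1 + (2 * Real.pi * (n.1 : ℝ)) ^ 2 := by positivity
  have hle : (n.1.natAbs : ℝ) ≤ 1 + (2 * Real.pi * (n.1 : ℝ)) ^ 2 := by
    rw [Nat.cast_natAbs, Int.cast_abs, mul_pow]
    have h4 : 1 ≤ (2 * Real.pi) ^ 2 := by nlinarith [Real.pi_gt_three]
    nlinarith [sq_nonneg (|(n.1 : ℝ)| - 1), sq_abs (n.1 : ℝ), sq_nonneg (n.1 : ℝ)]
  change (n.1.natAbs : ℝ) * residueWeight n ≤ (1 + (2 * Real.pi * (n.1 : ℝ)) ^ 2)⁻¹ * 4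
  calc (n.1.natAbs : ℝ) * residueWeight n
      ≤ (1 + (2 * Real.pi * (n.1 : ℝ)) ^ 2) * residueWeight n := by
        refine mul_le_mul_of_nonneg_right hle ?_
        unfold residueWeight
        positivity
    _ = _ := by rw [residueWeight, mul_inv_cancel_left₀ hpos.ne']

theorem hasSum_residueProj_apply (F : NilSmooth) (p : Heis) :
    HasSum (fun i : (n : NonzeroInt) × Residue n => residueProj i.1 i.2 F p)
      (F p - centralProj 0 0 F p) := by
  have hs : Summable fun i : (n : NonzeroInt) × Residue n => residueProj i.1 i.2 F p :=
    Summable.of_norm_bounded (summable_residueWeight.mul_right _)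
      fun i => norm_residueProj_le_weight i.1 i.2 F p
  have hfib : ∀ n : NonzeroInt, HasSum (fun k => residueProj n k F p) (centralProj n.1 0 F p) :=
    fun n => by
      rw [← sum_residueProj, NilSmooth.sum_apply]
      exact hasSum_fintype _
  have hs' : Summable fun n : NonzeroInt => centralProj n.1 0 F p :=
    (hs.hasSum.sigma hfib).summable
  obtain ⟨x, y, z⟩ := p
  have hco : ∀ n : ℤ, centralProj n 0 F (x, y, z)
      = ∫ t in (0 : ℝ)..1, e (n * t) * F (x, y, z + t) := fun n => by
    simp [centralProj_apply]
  have hsZ : Summable fun n : ℤ => centralProj n 0 F (x, y, z) :=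
    (Set.finite_singleton (0 : ℤ)).summable_compl_iff.1 (hs'.congr fun _ => rfl)
  have hF : HasSum (fun n : ℤ => centralProj n 0 F (x, y, z)) (F (x, y, z)) := by
    simp only [hco] at hsZ ⊢
    have := hasSum_fourier_at_zero (Φ := fun t => F (x, y, z + t))
      (F.continuous.comp (by fun_prop)) (F.periodic_z x y z) hsZ
    simpa using this
  have hne : HasSum (fun n : NonzeroInt => centralProj n.1 0 F (x, y, z))
      (F (x, y, z) - centralProj 0 0 F (x, y, z)) := by
    refine (hasSum_subtype_iff_indicator (s := {n : ℤ | n ≠ 0})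
      (f := fun n : ℤ => centralProj n 0 F (x, y, z))).2 ?_
    convert! hF.sub (hasSum_ite_eq (0 : ℤ) (centralProj 0 0 F (x, y, z))) using 1
    ext n
    by_cases hn : n = 0 <;> simp [hn]
  exact HasSum.sigma_of_hasSum hne hfib hs

theorem continuous_residueProj (n : NonzeroInt) (k : Residue n) :
    Continuous (residueProj n k) :=
  NilSmooth.continuous_of_fieldNorm _ fun m => by
    refine Seminorm.continuous_of_le (p := (NilSmooth.fieldNorm m).comp (residueProj n k))
      (NilSmooth.continuous_fieldNorm m) fun F => ?_
    have := NilSmooth.fieldNorm_le_of_commute (residueProj n k)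
      (fun j F => D_residueProj n k (frame j) F) 1 0
      (fun F p => by rw [one_mul]; exact norm_residueProj_le n k F p) m F
    simpa using this

theorem hasSum_residueProj (F : NilSmooth) :
    HasSum (fun i : (n : NonzeroInt) × Residue n => residueProj i.1 i.2 F)
      (F - centralProj 0 0 F) :=
  NilSmooth.hasSum_of_commute (fun j F => NilSmooth.D (frame j) F)
    (fun (i : (n : NonzeroInt) × Residue n) F => residueProj i.1 i.2 F)
    (fun F => F - centralProj 0 0 F) (fun i j F => D_residueProj i.1 i.2 (frame j) F)
    (fun j F => by rw [map_sub, D_centralProj])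
    (fun F => ⟨_, summable_residueWeight.mul_right _,
      fun i p => norm_residueProj_le_weight i.1 i.2 F p⟩)
    hasSum_residueProj_apply F

/-! ### Abelian characters -/

/-- The average of `centralProj 0 0 F` against `e(sb)` over the translations `(0, b, 0)`. -/
def torusAvgY (s : ℤ) (F : NilSmooth) : Heis → ℂ :=
  leftAvg (fun b => (0, b, 0)) s (centralProj 0 0 F)

/-- The average of `centralProj 0 0 F` against `e(ra + sb)` over the translations by `(a, 0, 0)`
and `(0, b, 0)`. -/
def torusAvg (r s : ℤ) (F : NilSmooth) : Heis → ℂ :=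
  leftAvg (fun a => (a, 0, 0)) r (torusAvgY s F)

theorem contDiff_torusAvgY (s : ℤ) (F : NilSmooth) : ContDiff ℝ ∞ (torusAvgY s F) :=
  contDiff_leftAvg (by fun_prop) (centralProj 0 0 F).contDiff

theorem contDiff_torusAvg (r s : ℤ) (F : NilSmooth) : ContDiff ℝ ∞ (torusAvg r s F) :=
  contDiff_leftAvg (by fun_prop) (contDiff_torusAvgY s F)

theorem fieldDeriv_torusAvgY (s : ℤ) (F : NilSmooth) (v : Heis) :
    fieldDeriv v (torusAvgY s F) = torusAvgY s (NilSmooth.D v F) := by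
  rw [torusAvgY, fieldDeriv_leftAvg (by fun_prop) (centralProj 0 0 F).contDiff, torusAvgY,
    ← D_centralProj]
  rfl

theorem fieldDeriv_torusAvg (r s : ℤ) (F : NilSmooth) (v : Heis) :
    fieldDeriv v (torusAvg r s F) = torusAvg r s (NilSmooth.D v F) := by
  rw [torusAvg, fieldDeriv_leftAvg (by fun_prop) (contDiff_torusAvgY s F), fieldDeriv_torusAvgY,
    torusAvg]

theorem centralProj_zero_z (F : NilSmooth) (x y z : ℝ) :
    centralProj 0 0 F (x, y, z) = centralProj 0 0 F (x, y, 0) := by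
  have := centralProj_z_add 0 0 F x y 0 z
  simpa using this

theorem centralProj_zero_periodic_x (F : NilSmooth) (y z : ℝ) :
    Function.Periodic (fun a => centralProj 0 0 F (a, y, z)) 1 := fun a => by
  have := (centralProj 0 0 F).apply_x_add 1 a y z
  rw [centralProj_zero_z] at this
  simpa [centralProj_zero_z F _ _ z] using this

theorem centralProj_zero_periodic_y (F : NilSmooth) (x y z : ℝ) :
    Function.Periodic (fun b => centralProj 0 0 F (x, y + b, z)) 1 := fun b => by
  simpa [add_assoc] using (centralProj 0 0 F).apply_y_add 1 x (y + b) z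

theorem torusAvgY_apply (s : ℤ) (F : NilSmooth) (x y z : ℝ) :
    torusAvgY s F (x, y, z) = ∫ b in (0 : ℝ)..1, e (s * b) * centralProj 0 0 F (x, y + b, 0) := by
  unfold torusAvgY leftAvg
  congr 1
  ext b
  rw [← centralProj_zero_z F x (y + b) z]
  exact congrArg (fun q => e (s * b) * centralProj 0 0 F q) (by ext <;> simp [Heis.mul, add_comm])

theorem torusAvgY_z (s : ℤ) (F : NilSmooth) (x y z : ℝ) :
    torusAvgY s F (x, y, z) = torusAvgY s F (x, y, 0) := by
  rw [torusAvgY_apply, torusAvgY_apply]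

theorem torusAvg_apply (r s : ℤ) (F : NilSmooth) (x y z : ℝ) :
    torusAvg r s F (x, y, z) = ∫ a in (0 : ℝ)..1, e (r * a) * torusAvgY s F (x + a, y, 0) := by
  unfold torusAvg leftAvg
  congr 1
  ext a
  rw [← torusAvgY_z s F (x + a) y (z + a * y)]
  exact congrArg (fun q => e (r * a) * torusAvgY s F q) (by ext <;> simp [Heis.mul, add_comm])

theorem torusAvgY_periodic_x (s : ℤ) (F : NilSmooth) (x y z : ℝ) :
    Function.Periodic (fun a => torusAvgY s F (x + a, y, z)) 1 := fun a => by
  simp only [torusAvgY_apply]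
  congr 1
  ext b
  have := centralProj_zero_periodic_x F (y + b) 0 (x + a)
  rw [← add_assoc]
  exact congrArg (e (s * b) * ·) this

theorem torusAvgY_y_add (s : ℤ) (F : NilSmooth) (x y z t : ℝ) :
    torusAvgY s F (x, y + t, z) = e (-(s * t)) * torusAvgY s F (x, y, z) := by
  rw [torusAvgY_apply, torusAvgY_apply,
    ← integral_e_mul_shift (centralProj_zero_periodic_y F x y 0)]
  simp only [add_assoc, add_comm t]

theorem torusAvg_y_add (r s : ℤ) (F : NilSmooth) (x y z t : ℝ) :
    torusAvg r s F (x, y + t, z) = e (-(s * t)) * torusAvg r s F (x, y, z) := by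
  rw [torusAvg_apply, torusAvg_apply, ← intervalIntegral.integral_const_mul]
  congr 1
  ext a
  rw [torusAvgY_y_add]
  ring

theorem torusAvg_x_add (r s : ℤ) (F : NilSmooth) (x y z t : ℝ) :
    torusAvg r s F (x + t, y, z) = e (-(r * t)) * torusAvg r s F (x, y, z) := by
  rw [torusAvg_apply, torusAvg_apply,
    ← integral_e_mul_shift (torusAvgY_periodic_x s F x y 0)]
  simp only [add_assoc, add_comm t]

theorem torusAvg_z (r s : ℤ) (F : NilSmooth) (x y z : ℝ) :
    torusAvg r s F (x, y, z) = torusAvg r s F (x, y, 0) := by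
  rw [torusAvg_apply, torusAvg_apply]

/-- At the origin, the iterated average is the integral over the fundamental domain. -/
theorem torusAvg_zero (r s : ℤ) (F : NilSmooth) :
    torusAvg r s F 0 = (abelianChar r s).toDistribution F := by
  change torusAvg r s F (0, 0, 0) = ∫ p in unitCube, e (r * p.1 + s * p.2.1) * F p
  have hcont : Continuous fun p : Heis => e (r * p.1 + s * p.2.1) * F p :=
    (continuous_e.comp (by fun_prop)).mul F.continuous
  have hcube : unitCube = Set.Icc (0 : ℝ) 1 ×ˢ (Set.Icc (0 : ℝ) 1 ×ˢ Set.Icc (0 : ℝ) 1) := by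
    rw [Set.Icc_prod_Icc, Set.Icc_prod_Icc]
    rfl
  rw [hcube, Measure.volume_eq_prod, setIntegral_prod _ (by
    rw [← Measure.volume_eq_prod]
    exact hcont.continuousOn.integrableOn_compact
      (isCompact_Icc.prod (isCompact_Icc.prod isCompact_Icc)))]
  rw [torusAvg_apply, intervalIntegral.integral_of_le zero_le_one, ← integral_Icc_eq_integral_Ioc]
  congr 1
  ext a
  rw [Measure.volume_eq_prod, setIntegral_prod _ (by
    rw [← Measure.volume_eq_prod]
    exact (hcont.comp (by fun_prop : Continuous fun w : ℝ × ℝ => (a, w))).continuousOn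
      |>.integrableOn_compact (isCompact_Icc.prod isCompact_Icc))]
  rw [torusAvgY_apply, intervalIntegral.integral_of_le zero_le_one, ← integral_Icc_eq_integral_Ioc,
    ← integral_const_mul]
  congr 1
  ext b
  rw [centralProj_apply, intervalIntegral.integral_of_le zero_le_one,
    ← integral_Icc_eq_integral_Ioc, ← mul_assoc, ← e_add, ← integral_const_mul]
  congr 1
  ext t
  simp

/-- The projection of `C^∞(N_ℤ \ N)` that is dual to the component of the character `e(rx + sy)`. -/
def abelianProj (r s : ℤ) (F : NilSmooth) : NilSmooth :=
  (abelianChar r s).toDistribution F • abelianChar (-r) (-s)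

theorem abelianProj_apply (r s : ℤ) (F : NilSmooth) (p : Heis) :
    abelianProj r s F p = torusAvg r s F p := by
  obtain ⟨x, y, z⟩ := p
  change (abelianChar r s).toDistribution F * e ((-r : ℤ) * x + (-s : ℤ) * y) = _
  have h1 := torusAvg_x_add r s F 0 y z x
  have h2 := torusAvg_y_add r s F 0 0 z y
  rw [zero_add] at h1 h2
  rw [h1, h2, torusAvg_z, show ((0, 0, 0) : Heis) = 0 from rfl, torusAvg_zero, ← mul_assoc,
    ← e_add, mul_comm]
  congr 2
  push_cast
  ring

theorem D_abelianProj (r s : ℤ) (v : Heis) (F : NilSmooth) :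
    NilSmooth.D v (abelianProj r s F) = abelianProj r s (NilSmooth.D v F) := by
  refine NilSmooth.ext fun p => ?_
  rw [abelianProj_apply, ← fieldDeriv_torusAvg, NilSmooth.D_apply,
    show (abelianProj r s F : Heis → ℂ) = torusAvg r s F from funext (abelianProj_apply r s F)]

theorem norm_torusAvgY_le (s : ℤ) (F : NilSmooth) (p : Heis) :
    ‖torusAvgY s F p‖ ≤ NilSmooth.fieldNorm 0 F :=
  norm_leftAvg_le (norm_centralProj_le 0 0 F) p

theorem norm_torusAvg_le (r s : ℤ) (F : NilSmooth) (p : Heis) :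
    ‖torusAvg r s F p‖ ≤ NilSmooth.fieldNorm 0 F :=
  norm_leftAvg_le (norm_torusAvgY_le s F) p

/-- `torusAvgY s` as a linear functional, at a fixed point. -/
def torusAvgYAt (s : ℤ) (p : Heis) : NilSmooth →ₗ[ℂ] ℂ where
  toFun F := torusAvgY s F p
  map_add' F G := by
    unfold torusAvgY
    rw [map_add]
    exact leftAvg_add (by fun_prop) s (centralProj 0 0 F).continuous
      (centralProj 0 0 G).continuous p
  map_smul' c F := by
    unfold torusAvgY
    rw [map_smul]
    exact leftAvg_const_mul _ s c (centralProj 0 0 F) p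

/-- `torusAvg r s` as a linear functional, at a fixed point. -/
def torusAvgAt (r s : ℤ) (p : Heis) : NilSmooth →ₗ[ℂ] ℂ where
  toFun F := torusAvg r s F p
  map_add' F G := by
    simp only [← abelianProj_apply, abelianProj, map_add, add_smul]
    rfl
  map_smul' c F := by
    simp only [← abelianProj_apply, abelianProj, map_smul, smul_assoc]
    rfl

theorem add_smul_leftField_frame_zero (x y z t : ℝ) :
    ((x, y, z) + t • leftField (frame 0) (x, y, z) : Heis) = (x + t, y, z) := by
  ext <;> simp [leftField, frame]

theorem add_smul_leftField_frame_one (x y z t : ℝ) :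
    ((x, y, z) + t • leftField (frame 1) (x, y, z) : Heis) = (x, y + t, z + t * x) := by
  ext <;> simp [leftField, frame]

theorem torusAvgYAt_D_one (s : ℤ) (p : Heis) (F : NilSmooth) :
    torusAvgYAt s p (NilSmooth.D (frame 1) F)
      = 2 * Real.pi * Complex.I * ((-s : ℝ) : ℂ) * torusAvgYAt s p F := by
  change torusAvgY s _ p = _ * torusAvgY s F p
  rw [← fieldDeriv_torusAvgY]
  refine fieldDeriv_of_eigen (contDiff_torusAvgY s F) _ p _ fun t => ?_
  obtain ⟨x, y, z⟩ := p
  rw [add_smul_leftField_frame_one, torusAvgY_y_add, torusAvgY_z, torusAvgY_z s F x y z, neg_mul]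

theorem torusAvgAt_D_one (r s : ℤ) (p : Heis) (F : NilSmooth) :
    torusAvgAt r s p (NilSmooth.D (frame 1) F)
      = 2 * Real.pi * Complex.I * ((-s : ℝ) : ℂ) * torusAvgAt r s p F := by
  change torusAvg r s _ p = _ * torusAvg r s F p
  rw [← fieldDeriv_torusAvg]
  refine fieldDeriv_of_eigen (contDiff_torusAvg r s F) _ p _ fun t => ?_
  obtain ⟨x, y, z⟩ := p
  rw [add_smul_leftField_frame_one, torusAvg_y_add, torusAvg_z, torusAvg_z r s F x y z, neg_mul]

theorem torusAvgAt_D_zero (r s : ℤ) (p : Heis) (F : NilSmooth) :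
    torusAvgAt r s p (NilSmooth.D (frame 0) F)
      = 2 * Real.pi * Complex.I * ((-r : ℝ) : ℂ) * torusAvgAt r s p F := by
  change torusAvg r s _ p = _ * torusAvg r s F p
  rw [← fieldDeriv_torusAvg]
  refine fieldDeriv_of_eigen (contDiff_torusAvg r s F) _ p _ fun t => ?_
  obtain ⟨x, y, z⟩ := p
  rw [add_smul_leftField_frame_zero, torusAvg_x_add, neg_mul]

/-- The summable weights that dominate the projections `abelianProj r s`. -/
def abelianWeight (i : ℤ × ℤ) : ℝ :=
  (1 + (2 * Real.pi * (i.1 : ℝ)) ^ 2)⁻¹ * (1 + (2 * Real.pi * (i.2 : ℝ)) ^ 2)⁻¹ * 4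

theorem summable_abelianWeight : Summable abelianWeight :=
  (summable_inv_one_add_sq.mul_of_nonneg summable_inv_one_add_sq (fun _ => by positivity)
    fun _ => by positivity).mul_right 4

theorem norm_abelianProj_le_weight (r s : ℤ) (F : NilSmooth) (p : Heis) :
    ‖abelianProj r s F p‖ ≤ abelianWeight (r, s) * NilSmooth.fieldNorm 4 F := by
  rw [abelianProj_apply]
  have h1 := NilSmooth.norm_le_of_eigen (torusAvgAt_D_one r s p) zero_le_one (k := 0) fun F => by
    rw [one_mul]
    exact norm_torusAvg_le r s F p
  have h2 := NilSmooth.norm_le_of_eigen (torusAvgAt_D_zero r s p) (by positivity) h1 F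
  refine h2.trans (le_of_eq ?_)
  rw [abelianWeight]
  simp only [mul_neg, neg_sq]
  ring

theorem hasSum_torusAvgY (F : NilSmooth) (p : Heis) :
    HasSum (fun s : ℤ => torusAvgY s F p) (centralProj 0 0 F p) := by
  have hs : Summable fun s : ℤ => torusAvgY s F p := by
    refine Summable.of_norm_bounded
      ((summable_inv_one_add_sq.mul_right (2 * 1)).mul_right (NilSmooth.fieldNorm 2 F)) fun s => ?_
    have := NilSmooth.norm_le_of_eigen (torusAvgYAt_D_one s p) zero_le_one (k := 0)
      (fun F => by rw [one_mul]; exact norm_torusAvgY_le s F p) F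
    simp only [mul_neg, neg_sq] at this
    exact this
  obtain ⟨x, y, z⟩ := p
  simp only [torusAvgY_apply] at hs ⊢
  rw [centralProj_zero_z]
  have h := hasSum_fourier_at_zero (Φ := fun b => centralProj 0 0 F (x, y + b, 0))
    ((centralProj 0 0 F).continuous.comp (by fun_prop)) (centralProj_zero_periodic_y F x y 0) hs
  rwa [add_zero] at h

theorem hasSum_abelianProj_apply (F : NilSmooth) (p : Heis) :
    HasSum (fun i : ℤ × ℤ => abelianProj i.1 i.2 F p) (centralProj 0 0 F p) := by
  have hs : Summable fun i : ℤ × ℤ => abelianProj i.1 i.2 F p :=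
    Summable.of_norm_bounded (summable_abelianWeight.mul_right _)
      fun i => norm_abelianProj_le_weight i.1 i.2 F p
  have hs' : Summable fun i : ℤ × ℤ => abelianProj i.2 i.1 F p :=
    (Equiv.prodComm ℤ ℤ).summable_iff.2 hs
  have hfib : ∀ s : ℤ, HasSum (fun r : ℤ => abelianProj r s F p) (torusAvgY s F p) := fun s => by
    have hs1 : Summable fun r : ℤ => abelianProj r s F p :=
      hs'.comp_injective (i := fun r : ℤ => (s, r)) (Prod.mk_right_injective s)
    obtain ⟨x, y, z⟩ := p
    simp only [abelianProj_apply, torusAvg_apply] at hs1 ⊢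
    rw [torusAvgY_z]
    have h := hasSum_fourier_at_zero (Φ := fun a => torusAvgY s F (x + a, y, 0))
      ((contDiff_torusAvgY s F).continuous.comp (by fun_prop)) (torusAvgY_periodic_x s F x y 0) hs1
    rwa [add_zero] at h
  have h1 := hs'.hasSum.prod_fiberwise hfib
  rw [← h1.unique (hasSum_torusAvgY F p)]
  exact (Equiv.prodComm ℤ ℤ).hasSum_iff.1 hs'.hasSum

theorem hasSum_abelianProj (F : NilSmooth) :
    HasSum (fun i : ℤ × ℤ => abelianProj i.1 i.2 F) (centralProj 0 0 F) :=
  NilSmooth.hasSum_of_commute (fun j F => NilSmooth.D (frame j) F)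
    (fun (i : ℤ × ℤ) F => abelianProj i.1 i.2 F) (fun F => centralProj 0 0 F)
    (fun i j F => D_abelianProj i.1 i.2 (frame j) F) (fun j F => D_centralProj 0 0 (frame j) F)
    (fun F => ⟨_, summable_abelianWeight.mul_right _,
      fun i p => norm_abelianProj_le_weight i.1 i.2 F p⟩)
    hasSum_abelianProj_apply F

/-! ### The expansion of a distribution -/

/-- The component of `τ` with indices `n` and `k`. -/
def residuePart (τ : NilDistribution) (n : NonzeroInt) (k : Residue n) : NilDistribution :=
  τ.comp ⟨residueProj n k, continuous_residueProj n k⟩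

theorem residuePart_apply (τ : NilDistribution) (n : NonzeroInt) (k : Residue n) (F : NilSmooth) :
    residuePart τ n k F = τ (residueProj n k F) := rfl

theorem norm_apply_le_of_commute {τ : NilDistribution} {C : ℝ} {m : ℕ} (hC : 0 ≤ C)
    (hτ : ∀ F, ‖τ F‖ ≤ C * NilSmooth.fieldNorm m F) {P : NilSmooth → NilSmooth}
    (hP : ∀ j F, NilSmooth.D (frame j) (P F) = P (NilSmooth.D (frame j) F)) {w : ℝ} {k : ℕ}
    (h : ∀ F p, ‖P F p‖ ≤ w * NilSmooth.fieldNorm k F) (F : NilSmooth) :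
    ‖τ (P F)‖ ≤ C * w * NilSmooth.fieldNorm (m + k) F := by
  rw [mul_assoc]
  exact (hτ _).trans (mul_le_mul_of_nonneg_left
    (NilSmooth.fieldNorm_le_of_commute P hP w k h m F) hC)

/-- The expansion of `τ`, dual to the decomposition of a smooth function by `abelianProj` and
`residueProj`. -/
theorem exists_expansion (τ : NilDistribution) :
    ∃ A B : NilDistribution,
      HasSum (fun rs : ℤ × ℤ => τ (abelianChar (-rs.1) (-rs.2)) •
        (abelianChar rs.1 rs.2).toDistribution) A ∧
      HasSum (fun nk : (n : NonzeroInt) × Residue n => residuePart τ nk.1 nk.2) B ∧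
      τ = A + B := by
  obtain ⟨C, m, hC, hτ⟩ := NilSmooth.exists_norm_le_fieldNorm τ
  have hab : ∀ (i : ℤ × ℤ) (F : NilSmooth), (τ (abelianChar (-i.1) (-i.2)) •
      (abelianChar i.1 i.2).toDistribution : NilDistribution) F = τ (abelianProj i.1 i.2 F) :=
    fun i F => by
      rw [abelianProj, map_smul, _root_.smul_apply, smul_eq_mul, smul_eq_mul, mul_comm]
  obtain ⟨A, hA⟩ := exists_hasSum_distribution (fun rs : ℤ × ℤ =>
    τ (abelianChar (-rs.1) (-rs.2)) • (abelianChar rs.1 rs.2).toDistribution)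
    (summable_abelianWeight.mul_left C) (m + 4) fun i F => by
      rw [hab]
      exact norm_apply_le_of_commute hC hτ (fun j F => D_abelianProj i.1 i.2 (frame j) F)
        (norm_abelianProj_le_weight i.1 i.2) F
  obtain ⟨B, hB⟩ := exists_hasSum_distribution
    (fun nk : (n : NonzeroInt) × Residue n => residuePart τ nk.1 nk.2)
    (summable_residueWeight.mul_left C) (m + 4) fun i F =>
      norm_apply_le_of_commute hC hτ (fun j F => D_residueProj i.1 i.2 (frame j) F)
        (norm_residueProj_le_weight i.1 i.2) F
  refine ⟨A, B, hA, hB, ?_⟩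
  ext F
  have h1 := hasSum_distribution_apply hA F
  simp only [hab] at h1
  have h2 := hasSum_distribution_apply hB F
  have h3 := h1.unique (τ.hasSum (hasSum_abelianProj F))
  have h4 := h2.unique (τ.hasSum (hasSum_residueProj F))
  rw [_root_.add_apply, h3, h4, ← map_add, add_sub_cancel]

/-! ### Theta series -/

/-- The seminorm `sup (1 + t²)|f(t)|` of a Schwartz function, up to a factor `2`. -/
def decayNorm : Seminorm ℂ 𝓢(ℝ, ℂ) := SchwartzMap.seminorm ℂ 0 0 + SchwartzMap.seminorm ℂ 2 0

theorem continuous_decayNorm : Continuous decayNorm :=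
  ((schwartz_withSeminorms ℂ ℝ ℂ).continuous_seminorm (0, 0)).add
    ((schwartz_withSeminorms ℂ ℝ ℂ).continuous_seminorm (2, 0))

theorem norm_le_decayNorm (f : 𝓢(ℝ, ℂ)) (t : ℝ) : (1 + t ^ 2) * ‖f t‖ ≤ decayNorm f := by
  have h0 := SchwartzMap.norm_le_seminorm ℂ f t
  have h2 := SchwartzMap.norm_pow_mul_le_seminorm ℂ f 2 t
  rw [Real.norm_eq_abs, sq_abs] at h2
  change _ ≤ SchwartzMap.seminorm ℂ 0 0 f + SchwartzMap.seminorm ℂ 2 0 f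
  linarith

theorem norm_apply_add_intCast_le (f : 𝓢(ℝ, ℂ)) (s : ℝ) (a : ℤ) :
    ‖f (s + a)‖ ≤ 2 * (1 + s ^ 2) * decayNorm f * (1 + (a : ℝ) ^ 2)⁻¹ := by
  have h := norm_le_decayNorm f (s + a)
  rw [← div_eq_mul_inv, le_div_iff₀ (by positivity)]
  have h1 : 1 + (a : ℝ) ^ 2 ≤ 2 * (1 + s ^ 2) * (1 + (s + a) ^ 2) := by
    nlinarith [sq_nonneg (2 * s + a), sq_nonneg (s * (s + a))]
  calc ‖f (s + a)‖ * (1 + (a : ℝ) ^ 2)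
      ≤ ‖f (s + a)‖ * (2 * (1 + s ^ 2) * (1 + (s + a) ^ 2)) := by gcongr
    _ = 2 * (1 + s ^ 2) * ((1 + (s + a) ^ 2) * ‖f (s + a)‖) := by ring
    _ ≤ _ := by gcongr

theorem summable_inv_one_add_int_sq : Summable fun a : ℤ => (1 + (a : ℝ) ^ 2)⁻¹ := by
  refine Summable.of_nonneg_of_le (fun n => by positivity) (fun n => ?_)
    (summable_inv_one_add_sq.mul_right ((2 * Real.pi) ^ 2))
  have h4 : 1 ≤ (2 * Real.pi) ^ 2 := by nlinarith [Real.pi_gt_three]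
  rw [← div_eq_inv_mul, inv_eq_one_div, div_le_div_iff₀ (by positivity) (by positivity), mul_pow]
  nlinarith

/-- The term `e(-nz - ℓy) f(x + ℓ/n)` of the theta series, for `ℓ = k + na`. -/
def thetaTerm (n : NonzeroInt) (k : ℤ) (f : 𝓢(ℝ, ℂ)) (a : ℤ) (p : Heis) : ℂ :=
  e (-(n.1 * p.2.2 + (k + n.1 * a) * p.2.1)) * f (p.1 + k / n.1 + a)

/-- The sum `∑ e(-nz - ℓy) f(x + ℓ/n)` over all `ℓ ≡ k (mod n)`. -/
def thetaFun (n : NonzeroInt) (k : ℤ) (f : 𝓢(ℝ, ℂ)) (p : Heis) : ℂ := ∑' a, thetaTerm n k f a p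

theorem norm_thetaTerm_le (n : NonzeroInt) (k : ℤ) (f : 𝓢(ℝ, ℂ)) (a : ℤ) (p : Heis) :
    ‖thetaTerm n k f a p‖
      ≤ 2 * (1 + (p.1 + k / n.1) ^ 2) * decayNorm f * (1 + (a : ℝ) ^ 2)⁻¹ := by
  rw [thetaTerm, norm_mul, norm_e, one_mul]
  exact norm_apply_add_intCast_le f _ a

theorem norm_thetaTerm_le_of_norm_le (n : NonzeroInt) (k : ℤ) (f : 𝓢(ℝ, ℂ)) (a : ℤ) {p : Heis}
    {R : ℝ} (hp : ‖p‖ ≤ R) : ‖thetaTerm n k f a p‖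
      ≤ 2 * (1 + (R + |(k : ℝ) / n.1|) ^ 2) * decayNorm f * (1 + (a : ℝ) ^ 2)⁻¹ := by
  have hx : |p.1| ≤ R := (norm_fst_le p).trans hp
  have h : (p.1 + k / n.1) ^ 2 ≤ (R + |(k : ℝ) / n.1|) ^ 2 := by
    rw [← sq_abs]
    gcongr
    exact (abs_add_le _ _).trans (by gcongr)
  have h0 : 0 ≤ decayNorm f := apply_nonneg _ _
  exact (norm_thetaTerm_le n k f a p).trans (by gcongr)

theorem summable_thetaTerm (n : NonzeroInt) (k : ℤ) (f : 𝓢(ℝ, ℂ)) (p : Heis) :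
    Summable fun a => thetaTerm n k f a p :=
  Summable.of_norm_bounded (summable_inv_one_add_int_sq.mul_left _)
    fun a => norm_thetaTerm_le n k f a p

/-- Multiplication of Schwartz functions by `-2πint`. -/
def mulVar (n : NonzeroInt) : 𝓢(ℝ, ℂ) →L[ℂ] 𝓢(ℝ, ℂ) :=
  SchwartzMap.smulLeftCLM ℂ fun t : ℝ => -(2 * Real.pi * Complex.I * n.1) * (t : ℂ)

theorem mulVar_apply (n : NonzeroInt) (f : 𝓢(ℝ, ℂ)) (t : ℝ) :
    mulVar n f t = -(2 * Real.pi * Complex.I * n.1) * (t : ℂ) * f t := by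
  have : (fun t : ℝ => -(2 * Real.pi * Complex.I * n.1) * (t : ℂ)).HasTemperateGrowth := by
    have h : (fun t : ℝ => (t : ℂ)).HasTemperateGrowth :=
      Complex.ofRealCLM.hasTemperateGrowth
    fun_prop
  rw [mulVar, SchwartzMap.smulLeftCLM_apply_apply this, smul_eq_mul]

/-- The coordinate `x` of `N`, with complex values. -/
def coordX : Heis →L[ℝ] ℂ := Complex.ofRealCLM.comp (.fst ℝ ℝ (ℝ × ℝ))

/-- The coordinate `y` of `N`, with complex values. -/
def coordY : Heis →L[ℝ] ℂ :=
  Complex.ofRealCLM.comp ((ContinuousLinearMap.fst ℝ ℝ ℝ).comp (.snd ℝ ℝ (ℝ × ℝ)))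

/-- The coordinate `z` of `N`, with complex values. -/
def coordZ : Heis →L[ℝ] ℂ :=
  Complex.ofRealCLM.comp ((ContinuousLinearMap.snd ℝ ℝ ℝ).comp (.snd ℝ ℝ (ℝ × ℝ)))

/-- The combination of `thetaTerm`s or `thetaFun`s that is their derivative. -/
def thetaDeriv (n : NonzeroInt) (x : ℝ) (u v w : ℂ) : Heis →L[ℝ] ℂ :=
  u • coordX + (v + 2 * Real.pi * Complex.I * n.1 * x * w) • coordY
    + (-(2 * Real.pi * Complex.I * n.1) * w) • coordZ

theorem hasFDerivAt_thetaTerm (n : NonzeroInt) (k : ℤ) (f : 𝓢(ℝ, ℂ)) (a : ℤ) (p : Heis) :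
    HasFDerivAt (thetaTerm n k f a) (thetaDeriv n p.1
      (thetaTerm n k (SchwartzMap.derivCLM ℂ ℂ f) a p) (thetaTerm n k (mulVar n f) a p)
      (thetaTerm n k f a p)) p := by
  have hn : (n.1 : ℂ) ≠ 0 := Int.cast_ne_zero.2 n.2
  have h1 : HasFDerivAt (fun p : Heis => p.1 + k / n.1 + (a : ℝ))
      (ContinuousLinearMap.fst ℝ ℝ (ℝ × ℝ)) p :=
    ((ContinuousLinearMap.fst ℝ ℝ (ℝ × ℝ)).hasFDerivAt.add_const _).add_const _
  have h2 := (f.hasDerivAt (p.1 + k / n.1 + a)).hasFDerivAt.comp p h1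
  have h3 : HasFDerivAt (fun p : Heis => -(n.1 * p.2.2 + (k + n.1 * a) * p.2.1 : ℝ))
      (-((n.1 : ℝ) • (ContinuousLinearMap.snd ℝ ℝ ℝ).comp (.snd ℝ ℝ (ℝ × ℝ))
        + (k + n.1 * a : ℝ) • (ContinuousLinearMap.fst ℝ ℝ ℝ).comp (.snd ℝ ℝ (ℝ × ℝ)))) p :=
    ((((ContinuousLinearMap.snd ℝ ℝ ℝ).comp (.snd ℝ ℝ (ℝ × ℝ))).hasFDerivAt.const_mul _).add
      (((ContinuousLinearMap.fst ℝ ℝ ℝ).comp (.snd ℝ ℝ (ℝ × ℝ))).hasFDerivAt.const_mul _)).neg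
  have he := hasDerivAt_e_mul 1 (-(n.1 * p.2.2 + (k + n.1 * a) * p.2.1))
  simp only [one_mul] at he
  have h4 := he.hasFDerivAt.comp p h3
  have h5 := h4.mul h2
  refine h5.congr_fderiv (ContinuousLinearMap.ext fun w => ?_)
  simp [thetaDeriv, coordX, coordY, coordZ, thetaTerm, mulVar_apply, SchwartzMap.derivCLM_apply]
  field_simp
  ring

theorem norm_thetaDeriv_le (n : NonzeroInt) {x R A B C : ℝ} {u v w : ℂ} (hx : |x| ≤ R)
    (hu : ‖u‖ ≤ A) (hv : ‖v‖ ≤ B) (hw : ‖w‖ ≤ C) :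
    ‖thetaDeriv n x u v w‖ ≤ A * ‖coordX‖ + (B + ‖2 * Real.pi * Complex.I * (n.1 : ℂ)‖ * R * C)
      * ‖coordY‖ + ‖2 * Real.pi * Complex.I * (n.1 : ℂ)‖ * C * ‖coordZ‖ := by
  have hR : 0 ≤ R := (abs_nonneg x).trans hx
  refine (norm_add_le _ _).trans (add_le_add ((norm_add_le _ _).trans (add_le_add ?_ ?_)) ?_)
  · rw [norm_smul]
    gcongr
  · rw [norm_smul]
    gcongr
    refine (norm_add_le _ _).trans (add_le_add hv ?_)
    rw [norm_mul, norm_mul, Complex.norm_real, Real.norm_eq_abs]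
    gcongr
  · rw [norm_smul, norm_mul, norm_neg]
    gcongr

theorem hasFDerivAt_thetaFun (n : NonzeroInt) (k : ℤ) (f : 𝓢(ℝ, ℂ)) (p : Heis) :
    HasFDerivAt (thetaFun n k f) (thetaDeriv n p.1
      (thetaFun n k (SchwartzMap.derivCLM ℂ ℂ f) p) (thetaFun n k (mulVar n f) p)
      (thetaFun n k f p)) p := by
  set R := ‖p‖ + 1 with hR
  set K := 2 * (1 + (R + |(k : ℝ) / n.1|) ^ 2) with hK
  have hsum := summable_inv_one_add_int_sq
  have hu := (((hsum.mul_left (K * decayNorm (SchwartzMap.derivCLM ℂ ℂ f))).mul_right ‖coordX‖).add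
    (((hsum.mul_left (K * decayNorm (mulVar n f))).add
      ((hsum.mul_left (K * decayNorm f)).mul_left
        (‖2 * Real.pi * Complex.I * (n.1 : ℂ)‖ * R))).mul_right ‖coordY‖)).add
    (((hsum.mul_left (K * decayNorm f)).mul_left
      ‖2 * Real.pi * Complex.I * (n.1 : ℂ)‖).mul_right ‖coordZ‖)
  have hp : p ∈ Metric.ball (0 : Heis) R := by
    rw [mem_ball_zero_iff]
    linarith
  have h := hasFDerivAt_tsum_of_isPreconnected hu Metric.isOpen_ball
    (convex_ball (0 : Heis) R).isPreconnected (fun a q _ => hasFDerivAt_thetaTerm n k f a q)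
    (fun a q hq => by
      have hq' : ‖q‖ ≤ R := (mem_ball_zero_iff.1 hq).le
      exact norm_thetaDeriv_le n ((norm_fst_le q).trans hq')
        (norm_thetaTerm_le_of_norm_le n k _ a hq') (norm_thetaTerm_le_of_norm_le n k _ a hq')
        (norm_thetaTerm_le_of_norm_le n k f a hq'))
    hp (summable_thetaTerm n k f p) hp
  refine h.congr_fderiv ?_
  unfold thetaDeriv
  have s1 := summable_thetaTerm n k (SchwartzMap.derivCLM ℂ ℂ f) p
  have s2 := summable_thetaTerm n k (mulVar n f) p
  have s3 := summable_thetaTerm n k f p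
  have s4 := s2.add (s3.mul_left (2 * Real.pi * Complex.I * n.1 * p.1))
  have s5 := s3.mul_left (-(2 * Real.pi * Complex.I * n.1))
  rw [((s1.smul_const coordX).add (s4.smul_const coordY)).tsum_add (s5.smul_const coordZ),
    (s1.smul_const coordX).tsum_add (s4.smul_const coordY), s1.tsum_smul_const,
    s4.tsum_smul_const, s5.tsum_smul_const, s2.tsum_add (s3.mul_left _), tsum_mul_left,
    tsum_mul_left]
  rfl

/-- The induction runs over all Schwartz functions at once: the derivative of a theta series is a
combination of theta series of other Schwartz functions. -/
theorem contDiff_thetaFun (n : NonzeroInt) (k : ℤ) (f : 𝓢(ℝ, ℂ)) :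
    ContDiff ℝ ∞ (thetaFun n k f) := by
  refine contDiff_infty.2 fun m => ?_
  induction m generalizing f with
  | zero =>
    exact contDiff_zero.2 (continuous_iff_continuousAt.2 fun p =>
      (hasFDerivAt_thetaFun n k f p).continuousAt)
  | succ m ih =>
    refine mod_cast contDiff_succ_iff_hasFDerivAt.2 ⟨_, ?_, hasFDerivAt_thetaFun n k f⟩
    have hx : ContDiff ℝ m fun p : Heis => (p.1 : ℂ) :=
      Complex.ofRealCLM.contDiff.comp contDiff_fst
    unfold thetaDeriv
    exact (((ih _).smul contDiff_const).add (((ih _).add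
      ((contDiff_const.mul hx).mul (ih f))).smul contDiff_const)).add
      ((contDiff_const.mul (ih f)).smul contDiff_const)

theorem thetaTerm_mul_ofInt (n : NonzeroInt) (k : ℤ) (f : 𝓢(ℝ, ℂ)) (a : ℤ) (g : ℤ × ℤ × ℤ)
    (p : Heis) :
    thetaTerm n k f a (Heis.mul (Heis.ofInt g) p) = thetaTerm n k f (a + g.1) p := by
  unfold thetaTerm Heis.mul Heis.ofInt
  congr 1
  · rw [← e_add_intCast _ (n.1 * g.2.2 + (k + n.1 * a) * g.2.1)]
    congr 1
    push_cast
    ring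
  · congr 1
    push_cast
    ring

/-- The theta series attached to a Schwartz function, as an element of `C^∞(N_ℤ \ N)`. -/
def theta (n : NonzeroInt) (k : ℤ) : 𝓢(ℝ, ℂ) →ₗ[ℂ] NilSmooth where
  toFun f := ⟨thetaFun n k f, contDiff_thetaFun n k f, fun g p => by
    unfold thetaFun
    simp only [thetaTerm_mul_ofInt]
    exact (Equiv.addRight g.1).tsum_eq fun a => thetaTerm n k f a p⟩
  map_add' f g := by
    refine NilSmooth.ext fun p => ?_
    change ∑' a, thetaTerm n k (f + g) a p = ∑' a, thetaTerm n k f a p + ∑' a, thetaTerm n k g a p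
    rw [← (summable_thetaTerm n k f p).tsum_add (summable_thetaTerm n k g p)]
    exact tsum_congr fun a => mul_add _ _ _
  map_smul' c f := by
    refine NilSmooth.ext fun p => ?_
    change ∑' a, thetaTerm n k (c • f) a p = c * ∑' a, thetaTerm n k f a p
    rw [← tsum_mul_left]
    exact tsum_congr fun a => mul_left_comm _ _ _

theorem theta_apply (n : NonzeroInt) (k : ℤ) (f : 𝓢(ℝ, ℂ)) (p : Heis) :
    theta n k f p = ∑' a, thetaTerm n k f a p := rfl

/-- The operators on Schwartz functions that correspond, through theta series, to the three
left-invariant vector fields of the standard frame. -/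
def schwartzFrame (n : NonzeroInt) : Fin 3 → 𝓢(ℝ, ℂ) →L[ℂ] 𝓢(ℝ, ℂ) :=
  ![SchwartzMap.derivCLM ℂ ℂ, mulVar n,
    (-(2 * Real.pi * Complex.I * n.1) : ℂ) • ContinuousLinearMap.id ℂ 𝓢(ℝ, ℂ)]

theorem D_theta (n : NonzeroInt) (k : ℤ) (j : Fin 3) (f : 𝓢(ℝ, ℂ)) :
    NilSmooth.D (frame j) (theta n k f) = theta n k (schwartzFrame n j f) := by
  refine NilSmooth.ext fun p => ?_
  change fderiv ℝ (thetaFun n k f) p _ = _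
  rw [(hasFDerivAt_thetaFun n k f p).fderiv]
  fin_cases j
  · simp [frame, leftField, thetaDeriv, coordX, coordY, coordZ, schwartzFrame]
    rfl
  · simp [frame, leftField, thetaDeriv, coordX, coordY, coordZ, schwartzFrame]
    ring_nf
    rfl
  · simp [frame, leftField, thetaDeriv, coordX, coordY, coordZ, schwartzFrame]
    rfl

theorem fieldNorm_zero_theta_le (n : NonzeroInt) (k : ℤ) (f : 𝓢(ℝ, ℂ)) :
    NilSmooth.fieldNorm 0 (theta n k f) ≤ 2 * (1 + (1 + |(k : ℝ) / n.1|) ^ 2)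
      * (∑' a : ℤ, (1 + (a : ℝ) ^ 2)⁻¹) * decayNorm f := by
  refine NilSmooth.seminorm_le _ 0 1 fun p hp => ?_
  rw [norm_iteratedFDeriv_zero, theta_apply]
  refine (tsum_of_norm_bounded (summable_inv_one_add_int_sq.mul_left _).hasSum fun a =>
    norm_thetaTerm_le_of_norm_le n k f a (by exact_mod_cast hp)).trans (le_of_eq ?_)
  rw [tsum_mul_left]
  ring

theorem continuous_theta (n : NonzeroInt) (k : ℤ) : Continuous (theta n k) := by
  refine NilSmooth.continuous_of_fieldNorm _ fun m => ?_
  induction m with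
  | zero =>
    set C := 2 * (1 + (1 + |(k : ℝ) / n.1|) ^ 2) * ∑' a : ℤ, (1 + (a : ℝ) ^ 2)⁻¹ with hC
    have hC0 : 0 ≤ C := mul_nonneg (by positivity) (tsum_nonneg fun a => by positivity)
    let q : Seminorm ℂ 𝓢(ℝ, ℂ) := C.toNNReal • decayNorm
    have hq : (q : 𝓢(ℝ, ℂ) → ℝ) = fun f => C * decayNorm f := by
      ext f
      simp [q, NNReal.smul_def, hC0]
    refine Seminorm.continuous_of_le (p := (NilSmooth.fieldNorm 0).comp (theta n k)) (q := q)
      ?_ fun f => ?_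
    · rw [hq]
      exact continuous_const.mul continuous_decayNorm
    · rw [hq]
      exact fieldNorm_zero_theta_le n k f
  | succ m ih =>
    simp only [NilSmooth.fieldNorm_succ, D_theta]
    exact ih.add (continuous_finsetSum _ fun j _ => ih.comp (schwartzFrame n j).continuous)

/-- Theta series as a continuous linear map. -/
def thetaCLM (n : NonzeroInt) (k : ℤ) : 𝓢(ℝ, ℂ) →L[ℂ] NilSmooth := ⟨theta n k, continuous_theta n k⟩

/-! ### Test functions and their partial Fourier coefficients -/

/-- The derivative of a test function along a smooth vector field. -/
def testDeriv (W : Heis → Heis) (hW : ContDiff ℝ ∞ W) (φ : HeisTest) : HeisTest :=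
  ⟨fun p => fderiv ℝ φ p (W p),
    (φ.contDiff.fderiv_right (m := ∞) (by simp)).clm_apply hW,
    (φ.hasCompactSupport.fderiv (𝕜 := ℝ)).mono fun p hp h => hp (by simp [h]),
    fun _ _ => trivial⟩

theorem testDeriv_apply (W : Heis → Heis) (hW : ContDiff ℝ ∞ W) (φ : HeisTest) (p : Heis) :
    testDeriv W hW φ p = fderiv ℝ φ p (W p) := rfl

/-- The derivative of a test function along a left-invariant vector field. -/
def testD (v : Heis) (φ : HeisTest) : HeisTest := testDeriv (leftField v) (contDiff_leftField v) φ

/-- The derivative of a test function in the coordinate `y`. Unlike the left-invariant derivatives,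
it yields a decay of the Fourier coefficients in `ℓ` that is uniform in `x`. -/
def testDy (φ : HeisTest) : HeisTest := testDeriv (fun _ => (0, 1, 0)) contDiff_const φ

theorem testD_apply (v : Heis) (φ : HeisTest) (p : Heis) : testD v φ p = fieldDeriv v φ p := rfl

theorem testFunction_differentiableAt (φ : HeisTest) (p : Heis) : DifferentiableAt ℝ φ p :=
  φ.contDiff.contDiffAt.differentiableAt (by simp)

theorem average_apply (φ : HeisTest) (p : Heis) :
    average φ p = ∑' g : ℤ × ℤ × ℤ, φ (Heis.mul (Heis.ofInt g) p) := rfl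

theorem D_average (v : Heis) (φ : HeisTest) :
    NilSmooth.D v (average φ) = average (testD v φ) := by
  refine NilSmooth.ext fun p₀ => ?_
  have hfin := finite_translates φ (‖p₀‖ + 1)
  have hzero : ∀ g ∉ hfin.toFinset, ∀ p ∈ Metric.ball p₀ 1, φ (Heis.mul (Heis.ofInt g) p) = 0 := by
    intro g hg p hp
    by_contra hne
    refine hg ((Set.Finite.mem_toFinset _).2 ⟨p, ?_, hne⟩)
    have := norm_sub_norm_le p p₀
    rw [Metric.mem_ball, dist_eq_norm] at hp
    linarith
  have hev : (average φ : Heis → ℂ) =ᶠ[nhds p₀]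
      fun p => ∑ g ∈ hfin.toFinset, φ (Heis.mul (Heis.ofInt g) p) := by
    filter_upwards [Metric.ball_mem_nhds p₀ one_pos] with p hp
    exact tsum_eq_sum fun g hg => hzero g hg p hp
  have hd : ∀ g : ℤ × ℤ × ℤ, DifferentiableAt ℝ (fun p => φ (Heis.mul (Heis.ofInt g) p)) p₀ :=
    fun g => (φ.contDiff.comp (contDiff_mul_left _)).contDiffAt.differentiableAt (by simp)
  rw [NilSmooth.D_apply, fieldDeriv, hev.fderiv_eq, fderiv_fun_sum fun g _ => hd g,
    average_apply, _root_.sum_apply, tsum_eq_sum fun g hg => ?_]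
  · exact Finset.sum_congr rfl fun g _ =>
      fieldDeriv_comp_mul_left v _ p₀ (testFunction_differentiableAt φ _)
  · rw [testD_apply, ← fieldDeriv_comp_mul_left v _ p₀ (testFunction_differentiableAt φ _),
      fieldDeriv, Filter.EventuallyEq.fderiv_eq (f := fun _ => (0 : ℂ)) ?_]
    · simp
    · filter_upwards [Metric.ball_mem_nhds p₀ one_pos] with p hp
      exact hzero g hg p hp

/-- The Fourier coefficient `∫∫ e(nz + ℓy) φ(x, y, z) dy dz` of a test function. -/
def fiberCoeff (n ℓ : ℤ) (φ : HeisTest) (x : ℝ) : ℂ :=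
  ∫ w : ℝ × ℝ, e (n * w.2 + ℓ * w.1) * φ (x, w)

theorem sigmaTest_apply (n ℓ : ℤ) (φ : HeisTest) (t : ℝ) :
    sigmaTest n ℓ φ t = fiberCoeff n ℓ φ (t - ℓ / n) := rfl

theorem hasCompactSupport_fiber (φ : HeisTest) (x : ℝ) :
    HasCompactSupport fun w : ℝ × ℝ => φ (x, w) :=
  HasCompactSupport.intro (φ.hasCompactSupport.isCompact.image continuous_snd) fun w hw => by
    by_contra hne
    exact hw ⟨(x, w), subset_tsupport _ hne, rfl⟩

theorem contDiff_fiberChar (n ℓ : ℤ) : ContDiff ℝ ∞ fun w : ℝ × ℝ => e (n * w.2 + ℓ * w.1) :=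
  contDiff_e_id.comp (by fun_prop)

theorem integrable_fiber (n ℓ : ℤ) (φ : HeisTest) (x : ℝ) :
    Integrable fun w : ℝ × ℝ => e (n * w.2 + ℓ * w.1) * φ (x, w) :=
  ((contDiff_fiberChar n ℓ).continuous.mul
    (φ.continuous.comp (by fun_prop))).integrable_of_hasCompactSupport
    (hasCompactSupport_fiber φ x).mul_left

theorem integral_fderiv_eq_zero {g : ℝ × ℝ → ℂ} (hg : ContDiff ℝ ∞ g) (hc : HasCompactSupport g)
    (v : ℝ × ℝ) : ∫ w, fderiv ℝ g w v = 0 := by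
  have hi : Integrable fun w => fderiv ℝ g w v :=
    ((hg.continuous_fderiv (by simp)).clm_apply continuous_const).integrable_of_hasCompactSupport
      ((hc.fderiv (𝕜 := ℝ)).mono fun p hp h => hp (by simp [h]))
  have h := integral_bilinear_hasFDerivAt_right_eq_neg_left_of_integrable (μ := volume)
    (f := fun _ : ℝ × ℝ => (1 : ℂ)) (f' := fun _ => 0) (g := g) (g' := fderiv ℝ g) (v := v)
    (B := ContinuousLinearMap.mul ℝ ℂ) (by simp) (by simpa using hi)
    (by simpa using hg.continuous.integrable_of_hasCompactSupport hc)
    (fun _ _ => hasFDerivAt_const _ _)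
    (fun w _ => (hg.contDiffAt.differentiableAt (by simp)).hasFDerivAt)
  simpa using h

/-- Integration by parts in the variables `y` and `z`. -/
theorem fiberCoeff_testDeriv (n ℓ : ℤ) (φ : HeisTest) (x : ℝ) (v : ℝ × ℝ) {W : Heis → Heis}
    (hW : ContDiff ℝ ∞ W) (hv : ∀ w, W (x, w) = (0, v)) :
    fiberCoeff n ℓ (testDeriv W hW φ) x
      = -(2 * Real.pi * Complex.I) * (n * v.2 + ℓ * v.1) * fiberCoeff n ℓ φ x := by
  have hφ : ContDiff ℝ ∞ fun w : ℝ × ℝ => φ (x, w) :=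
    φ.contDiff.comp (contDiff_const.prodMk contDiff_id)
  have hg := (contDiff_fiberChar n ℓ).mul hφ
  have h0 := integral_fderiv_eq_zero hg (hasCompactSupport_fiber φ x).mul_left v
  have hfd : ∀ w : ℝ × ℝ, fderiv ℝ (fun w => e (n * w.2 + ℓ * w.1) * φ (x, w)) w v
      = e (n * w.2 + ℓ * w.1) * testDeriv W hW φ (x, w)
        + 2 * Real.pi * Complex.I * (n * v.2 + ℓ * v.1)
          * (e (n * w.2 + ℓ * w.1) * φ (x, w)) := by
    intro w
    have h1 : HasFDerivAt (fun w : ℝ × ℝ => (n * w.2 + ℓ * w.1 : ℝ))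
        ((n : ℝ) • ContinuousLinearMap.snd ℝ ℝ ℝ + (ℓ : ℝ) • ContinuousLinearMap.fst ℝ ℝ ℝ) w :=
      (hasFDerivAt_snd.const_mul _).add (hasFDerivAt_fst.const_mul _)
    have h2 := hasDerivAt_e_mul 1 (n * w.2 + ℓ * w.1)
    simp only [one_mul] at h2
    have h3 := h2.hasFDerivAt.comp w h1
    have h4 : HasFDerivAt (fun w : ℝ × ℝ => φ (x, w)) _ w :=
      (testFunction_differentiableAt φ (x, w)).hasFDerivAt.comp w (hasFDerivAt_prodMk_right x w)
    rw [testDeriv_apply, hv]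
    have h5 := (h3.mul h4).fderiv
    simp only [Function.comp_def] at h5
    rw [show (fun w : ℝ × ℝ => e (n * w.2 + ℓ * w.1) * φ (x, w)) = (fun x ↦ e (↑n * x.2 + ↑ℓ * x.1))
      * fun w => φ (x, w) from rfl, h5]
    simp
    ring
  simp only [hfd] at h0
  rw [integral_add (integrable_fiber n ℓ _ x) ((integrable_fiber n ℓ φ x).const_mul _),
    integral_const_mul] at h0
  unfold fiberCoeff
  linear_combination h0

theorem fiberCoeff_testDy (n ℓ : ℤ) (φ : HeisTest) (x : ℝ) :
    fiberCoeff n ℓ (testDy φ) x = -(2 * Real.pi * Complex.I) * ℓ * fiberCoeff n ℓ φ x := by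
  have := fiberCoeff_testDeriv n ℓ φ x (1, 0) (contDiff_const (c := ((0, 1, 0) : Heis)))
    fun _ => rfl
  simpa [testDy] using this

theorem fiberCoeff_testD_one (n ℓ : ℤ) (φ : HeisTest) (x : ℝ) :
    fiberCoeff n ℓ (testD (frame 1) φ) x
      = -(2 * Real.pi * Complex.I) * (n * x + ℓ) * fiberCoeff n ℓ φ x := by
  have := fiberCoeff_testDeriv n ℓ φ x (1, x) (contDiff_leftField (frame 1))
    fun w => by ext <;> simp [leftField, frame]
  simpa [testD] using this

theorem fiberCoeff_testD_two (n ℓ : ℤ) (φ : HeisTest) (x : ℝ) :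
    fiberCoeff n ℓ (testD (frame 2) φ) x
      = -(2 * Real.pi * Complex.I) * n * fiberCoeff n ℓ φ x := by
  have := fiberCoeff_testDeriv n ℓ φ x (0, 1) (contDiff_leftField (frame 2))
    fun w => by ext <;> simp [leftField, frame]
  simpa [testD] using this

theorem exists_compact_fiber (φ : HeisTest) : ∃ K : Set (ℝ × ℝ), IsCompact K ∧ ∃ C, 0 ≤ C ∧
    ∀ x w, ‖φ (x, w)‖ ≤ K.indicator (fun _ => C) w := by
  obtain ⟨C, hC⟩ := φ.hasCompactSupport.exists_bound_of_continuous φ.continuous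
  refine ⟨_, φ.hasCompactSupport.isCompact.image continuous_snd, C,
    (norm_nonneg _).trans (hC 0), fun x w => ?_⟩
  by_cases hw : w ∈ Prod.snd '' tsupport φ
  · rw [Set.indicator_of_mem hw]
    exact hC _
  · rw [Set.indicator_of_notMem hw, norm_le_zero_iff]
    by_contra hne
    exact hw ⟨(x, w), subset_tsupport _ hne, rfl⟩

theorem integrable_indicator_const {K : Set (ℝ × ℝ)} (hK : IsCompact K) (C : ℝ) :
    Integrable (K.indicator fun _ => C) :=
  (integrable_indicator_iff hK.measurableSet).2 (integrableOn_const hK.measure_ne_top)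

theorem exists_norm_fiberCoeff_le (φ : HeisTest) :
    ∃ C, 0 ≤ C ∧ ∀ n ℓ x, ‖fiberCoeff n ℓ φ x‖ ≤ C := by
  obtain ⟨K, hK, C, hC, h⟩ := exists_compact_fiber φ
  refine ⟨∫ w, K.indicator (fun _ => C) w,
    integral_nonneg fun w => Set.indicator_nonneg (fun _ _ => hC) w, fun n ℓ x => ?_⟩
  refine norm_integral_le_of_norm_le (integrable_indicator_const hK C)
    (Filter.Eventually.of_forall fun w => ?_)
  rw [norm_mul, norm_e, one_mul]
  exact h x w

theorem exists_norm_fiberCoeff_le_inv (φ : HeisTest) :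
    ∃ C, 0 ≤ C ∧ ∀ n ℓ x, ‖fiberCoeff n ℓ φ x‖ ≤ C * (1 + (2 * Real.pi * (ℓ : ℝ)) ^ 2)⁻¹ := by
  obtain ⟨C₀, h0, hC0⟩ := exists_norm_fiberCoeff_le φ
  obtain ⟨C₁, h1, hC1⟩ := exists_norm_fiberCoeff_le (testDy (testDy φ))
  refine ⟨C₀ + C₁, add_nonneg h0 h1, fun n ℓ x => ?_⟩
  have key : ((1 + (2 * Real.pi * ℓ) ^ 2 : ℝ) : ℂ) * fiberCoeff n ℓ φ x
      = fiberCoeff n ℓ φ x - fiberCoeff n ℓ (testDy (testDy φ)) x := by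
    rw [fiberCoeff_testDy, fiberCoeff_testDy]
    push_cast
    linear_combination (2 * Real.pi * ℓ : ℂ) ^ 2 * fiberCoeff n ℓ φ x * Complex.I_sq
  rw [← div_eq_mul_inv, le_div_iff₀ (by positivity), mul_comm]
  calc _ = ‖((1 + (2 * Real.pi * ℓ) ^ 2 : ℝ) : ℂ) * fiberCoeff n ℓ φ x‖ := by
        rw [norm_mul, Complex.norm_real, Real.norm_eq_abs, abs_of_pos (by positivity)]
    _ ≤ C₀ + C₁ := by
        rw [key]
        exact (norm_sub_le _ _).trans (add_le_add (hC0 n ℓ x) (hC1 n ℓ x))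

theorem hasDerivAt_fiberCoeff (n ℓ : ℤ) (φ : HeisTest) (x : ℝ) :
    HasDerivAt (fiberCoeff n ℓ φ) (fiberCoeff n ℓ (testD (frame 0) φ) x) x := by
  obtain ⟨K, hK, C, hC, h⟩ := exists_compact_fiber (testD (frame 0) φ)
  refine (hasDerivAt_integral_of_dominated_loc_of_deriv_le
    (F := fun x (w : ℝ × ℝ) => e (n * w.2 + ℓ * w.1) * φ (x, w))
    (F' := fun x (w : ℝ × ℝ) => e (n * w.2 + ℓ * w.1) * testD (frame 0) φ (x, w))
    (bound := K.indicator fun _ => C) Filter.univ_mem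
    (Filter.Eventually.of_forall fun x => (integrable_fiber n ℓ φ x).aestronglyMeasurable)
    (integrable_fiber n ℓ φ x) (integrable_fiber n ℓ _ x).aestronglyMeasurable
    (Filter.Eventually.of_forall fun w x _ => ?_) (integrable_indicator_const hK C)
    (Filter.Eventually.of_forall fun w x _ => ?_)).2
  · rw [norm_mul, norm_e, one_mul]
    exact h x w
  · refine HasDerivAt.const_mul _ ?_
    have h1 := (testFunction_differentiableAt φ (x, w)).hasFDerivAt.comp_hasDerivAt x
      ((hasDerivAt_id x).prodMk (hasDerivAt_const x w))
    convert! h1 using 1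
    rw [testD_apply, fieldDeriv]
    congr 1
    ext <;> simp [leftField, frame]

theorem schwartzFrame_sigmaTest (n : NonzeroInt) (ℓ : ℤ) (j : Fin 3) (φ : HeisTest) :
    schwartzFrame n j (sigmaTest n.1 ℓ φ) = sigmaTest n.1 ℓ (testD (frame j) φ) := by
  have hn : (n.1 : ℂ) ≠ 0 := Int.cast_ne_zero.2 n.2
  ext t
  rw [sigmaTest_apply]
  fin_cases j
  · change SchwartzMap.derivCLM ℂ ℂ (sigmaTest n.1 ℓ φ) t = _
    rw [SchwartzMap.derivCLM_apply]
    exact ((hasDerivAt_fiberCoeff n.1 ℓ φ (t - ℓ / n.1)).comp_sub_const t _).deriv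
  · change mulVar n (sigmaTest n.1 ℓ φ) t = fiberCoeff n.1 ℓ (testD (frame 1) φ) _
    rw [mulVar_apply, sigmaTest_apply, fiberCoeff_testD_one]
    push_cast
    field_simp
    ring
  · change -(2 * Real.pi * Complex.I * n.1) * sigmaTest n.1 ℓ φ t
      = fiberCoeff n.1 ℓ (testD (frame 2) φ) _
    rw [sigmaTest_apply, fiberCoeff_testD_two]
    ring

theorem decayNorm_le {f : 𝓢(ℝ, ℂ)} {M : ℝ} (h : ∀ t, (1 + t ^ 2) * ‖f t‖ ≤ M) :
    decayNorm f ≤ 2 * M := by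
  have hM : 0 ≤ M := le_trans (by positivity) (h 0)
  have key : ∀ k, (k = 0 ∨ k = 2) → SchwartzMap.seminorm ℂ k 0 f ≤ M := fun k hk => by
    refine SchwartzMap.seminorm_le_bound ℂ k 0 f hM fun t => ?_
    rw [norm_iteratedFDeriv_zero]
    refine le_trans (mul_le_mul_of_nonneg_right ?_ (norm_nonneg _)) (h t)
    rcases hk with rfl | rfl
    · simpa using sq_nonneg t
    · simp
  have h0 := key 0 (Or.inl rfl)
  have h2 := key 2 (Or.inr rfl)
  change SchwartzMap.seminorm ℂ 0 0 f + SchwartzMap.seminorm ℂ 2 0 f ≤ _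
  linarith

/-- The operator `testD (frame 1)` acts on `sigmaTest n ℓ φ` as multiplication by a multiple of the
variable, which provides the decay; the uniform bound in `ℓ` is that of `fiberCoeff`. -/
theorem exists_decayNorm_sigmaTest_le (n : NonzeroInt) (φ : HeisTest) :
    ∃ C, ∀ ℓ, decayNorm (sigmaTest n.1 ℓ φ) ≤ C * (1 + (2 * Real.pi * (ℓ : ℝ)) ^ 2)⁻¹ := by
  obtain ⟨C₀, h0, hC0⟩ := exists_norm_fiberCoeff_le_inv φ
  obtain ⟨C₁, h1, hC1⟩ := exists_norm_fiberCoeff_le_inv (testD (frame 1) (testD (frame 1) φ))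
  refine ⟨2 * (C₀ + C₁), fun ℓ => ?_⟩
  rw [mul_assoc]
  refine decayNorm_le fun t => ?_
  have hn : (1 : ℝ) ≤ (2 * Real.pi * n.1) ^ 2 := by
    have h4 : 1 ≤ (2 * Real.pi) ^ 2 := by nlinarith [Real.pi_gt_three]
    have h5 : (1 : ℝ) ≤ (n.1 : ℝ) ^ 2 := by
      have h : (1 : ℤ) ≤ n.1 ^ 2 := by
        have h6 := sq_nonneg n.1
        have h7 : n.1 ^ 2 ≠ 0 := pow_ne_zero 2 n.2
        omega
      exact_mod_cast h
    rw [mul_pow]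
    nlinarith
  have hsq : ‖sigmaTest n.1 ℓ (testD (frame 1) (testD (frame 1) φ)) t‖
      = (2 * Real.pi * n.1) ^ 2 * t ^ 2 * ‖sigmaTest n.1 ℓ φ t‖ := by
    rw [← schwartzFrame_sigmaTest, ← schwartzFrame_sigmaTest]
    change ‖mulVar n (mulVar n (sigmaTest n.1 ℓ φ)) t‖ = _
    rw [mulVar_apply, mulVar_apply, ← mul_assoc, norm_mul]
    congr 1
    rw [show -(2 * Real.pi * Complex.I * n.1) * (t : ℂ) * (-(2 * Real.pi * Complex.I * n.1) * t)
      = ((-((2 * Real.pi * n.1) ^ 2 * t ^ 2) : ℝ) : ℂ) by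
        push_cast
        linear_combination (2 * Real.pi * n.1 * t : ℂ) ^ 2 * Complex.I_sq,
      Complex.norm_real, Real.norm_eq_abs, abs_neg, abs_of_nonneg (by positivity)]
  have hb := hC1 n.1 ℓ (t - ℓ / n.1)
  rw [← sigmaTest_apply, hsq] at hb
  have ha := hC0 n.1 ℓ (t - ℓ / n.1)
  rw [← sigmaTest_apply] at ha
  have hc : t ^ 2 * ‖sigmaTest n.1 ℓ φ t‖
      ≤ (2 * Real.pi * n.1) ^ 2 * t ^ 2 * ‖sigmaTest n.1 ℓ φ t‖ := by
    rw [mul_assoc]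
    exact le_mul_of_one_le_left (by positivity) hn
  rw [add_mul, add_mul, one_mul]
  exact add_le_add ha (hc.trans hb)

/-! ### Poisson summation for averages of test functions -/

theorem exists_apply_eq_zero (φ : HeisTest) :
    ∃ R : ℝ, ∀ x y z : ℝ, (R < |x| ∨ R < |y| ∨ R < |z|) → φ (x, y, z) = 0 := by
  obtain ⟨R, hR⟩ := φ.hasCompactSupport.isCompact.isBounded.subset_closedBall (0 : Heis)
  refine ⟨R, fun x y z h => ?_⟩
  by_contra hne
  have hq := hR (subset_tsupport _ hne)
  simp only [Metric.mem_closedBall, dist_zero_right, Prod.norm_def, sup_le_iff,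
    Real.norm_eq_abs] at hq
  obtain ⟨h1, h2, h3⟩ := hq
  rcases h with h | h | h <;> linarith

/-- The Fourier coefficient `∫ e(nz) φ(x, y, z) dz` of a test function in the central variable. -/
def centralCoeff (n : ℤ) (φ : HeisTest) (x y : ℝ) : ℂ := ∫ u : ℝ, e (n * u) * φ (x, y, u)

theorem centralCoeff_eq_zero {φ : HeisTest} {R : ℝ}
    (hR : ∀ x y z : ℝ, (R < |x| ∨ R < |y| ∨ R < |z|) → φ (x, y, z) = 0) (n : ℤ) {x y : ℝ}
    (hy : R < |y|) : centralCoeff n φ x y = 0 := by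
  simp [centralCoeff, hR x y _ (Or.inr (Or.inl hy))]

theorem fiberCoeff_eq_zero {φ : HeisTest} {R : ℝ}
    (hR : ∀ x y z : ℝ, (R < |x| ∨ R < |y| ∨ R < |z|) → φ (x, y, z) = 0) (n ℓ : ℤ) {x : ℝ}
    (hx : R < |x|) : fiberCoeff n ℓ φ x = 0 := by
  have : ∀ w : ℝ × ℝ, φ (x, w) = 0 := fun w => hR x w.1 w.2 (Or.inl hx)
  simp [fiberCoeff, this]

theorem continuous_centralCoeff (n : ℤ) (φ : HeisTest) (x : ℝ) :
    Continuous (centralCoeff n φ x) := by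
  obtain ⟨R, hR⟩ := exists_apply_eq_zero φ
  have h : centralCoeff n φ x = fun y => ∫ u in Set.Icc (-R) R, e (n * u) * φ (x, y, u) := by
    ext y
    refine (setIntegral_eq_integral_of_forall_compl_eq_zero fun u hu => ?_).symm
    rw [hR x y u (Or.inr (Or.inr (by
      rw [Set.mem_Icc, ← abs_le] at hu
      exact not_le.1 hu))), mul_zero]
  rw [h]
  refine continuous_parametric_integral_of_continuous ?_ isCompact_Icc
  exact (continuous_e.comp (by fun_prop)).mul (φ.continuous.comp (by fun_prop))

theorem fourier_centralCoeff (n ℓ : ℤ) (φ : HeisTest) (x : ℝ) :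
    𝓕 (centralCoeff n φ x) (ℓ : ℝ) = fiberCoeff n (-ℓ) φ x := by
  rw [Real.fourier_real_eq_integral_exp_smul, fiberCoeff,
    Measure.volume_eq_prod, integral_prod _ (by exact integrable_fiber n (-ℓ) φ x)]
  congr 1
  ext v
  rw [centralCoeff, smul_eq_mul, ← integral_const_mul]
  congr 1
  ext u
  rw [← mul_assoc]
  congr 1
  rw [add_comm, e_add]
  congr 1
  rw [e]
  congr 1
  push_cast
  ring

/-- Poisson summation in the variable `y`. -/
theorem hasSum_fiberCoeff (n : ℤ) (φ : HeisTest) (x y : ℝ) :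
    HasSum (fun ℓ : ℤ => e (-(ℓ * y)) * fiberCoeff n ℓ φ x)
      (∑' b : ℤ, centralCoeff n φ x (y + b)) := by
  obtain ⟨R, hR⟩ := exists_apply_eq_zero φ
  obtain ⟨C, hC0, hC⟩ := exists_norm_fiberCoeff_le_inv φ
  have hO : centralCoeff n φ x =O[Filter.cocompact ℝ] fun t : ℝ => |t| ^ (-2 : ℝ) := by
    refine Filter.EventuallyEq.trans_isBigO (f₂ := fun _ => (0 : ℂ)) ?_
      (Asymptotics.isBigO_zero _ _)
    refine Filter.mem_cocompact.2 ⟨Set.Icc (-R) R, isCompact_Icc, fun y hy => ?_⟩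
    rw [Set.mem_compl_iff, Set.mem_Icc, ← abs_le, not_le] at hy
    exact centralCoeff_eq_zero hR n hy
  have hs : Summable fun ℓ : ℤ => fiberCoeff n (-ℓ) φ x := by
    refine Summable.of_norm_bounded (summable_inv_one_add_sq.mul_left C) fun ℓ => ?_
    simpa using hC n (-ℓ) x
  have hP := Real.tsum_eq_tsum_fourier_of_rpow_decay_of_summable
    (continuous_centralCoeff n φ x) one_lt_two hO
    (by simpa only [fourier_centralCoeff] using hs) y
  rw [hP]
  have hterm : ∀ ℓ : ℤ, 𝓕 (centralCoeff n φ x) (ℓ : ℝ) * fourier ℓ (y : UnitAddCircle)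
      = e (-((-ℓ : ℤ) * y)) * fiberCoeff n (-ℓ) φ x := fun ℓ => by
    rw [fourier_centralCoeff, mul_comm, fourier_coe_apply, e]
    congr 2
    push_cast
    ring
  simp only [hterm]
  rw [show ∑' ℓ : ℤ, e (-((-ℓ : ℤ) * y)) * fiberCoeff n (-ℓ) φ x
    = ∑' ℓ : ℤ, e (-(ℓ * y)) * fiberCoeff n ℓ φ x from
      (Equiv.neg ℤ).tsum_eq fun ℓ : ℤ => e (-(ℓ * y)) * fiberCoeff n ℓ φ x]
  refine Summable.hasSum (Summable.of_norm_bounded (summable_inv_one_add_sq.mul_left C) fun ℓ => ?_)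
  rw [norm_mul, norm_e, one_mul]
  exact hC n ℓ x

/-- The orthogonality of the characters of `ℤ/nℤ` selects the Fourier coefficients in one residue
class. -/
theorem hasSum_fiberCoeff_residue (n : NonzeroInt) (k : Residue n) (φ : HeisTest) (x y : ℝ) :
    HasSum (fun ℓ : {ℓ : ℤ // (ℓ : Residue n) = k} => e (-(ℓ.1 * y)) * fiberCoeff n.1 ℓ.1 φ x)
      ((n.1.natAbs : ℂ)⁻¹ * ∑ j : Residue n, e ((j.val : ℝ) * (k.val : ℝ) / n.1)
        * ∑' b : ℤ, centralCoeff n.1 φ x (y + j.val / n.1 + b)) := by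
  have h := ((hasSum_sum (s := Finset.univ) fun (j : Residue n) _ =>
    (hasSum_fiberCoeff n.1 φ x (y + j.val / n.1)).mul_left
      (e ((j.val : ℝ) * (k.val : ℝ) / n.1))).mul_left (n.1.natAbs : ℂ)⁻¹)
  refine (hasSum_subtype_iff_indicator (s := {ℓ : ℤ | (ℓ : Residue n) = k})
    (f := fun ℓ : ℤ => e (-(ℓ * y)) * fiberCoeff n.1 ℓ φ x)).2 ?_
  refine h.congr_fun fun ℓ => ?_
  have horth := sum_e_val_mul_val n (k - ℓ)
  have hterm : ∀ j : Residue n, e ((j.val : ℝ) * (k.val : ℝ) / n.1)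
      * (e (-(ℓ * (y + j.val / n.1))) * fiberCoeff n.1 ℓ φ x)
      = e (((k - ℓ : Residue n).val : ℝ) * (j.val : ℝ) / n.1)
        * (e (-(ℓ * y)) * fiberCoeff n.1 ℓ φ x) := fun j => by
    have h1 : e (((k - ℓ : Residue n).val : ℝ) * (j.val : ℝ) / n.1)
        = e (((((k.val : ℤ) - ℓ) * j.val : ℤ) : ℝ) / n.1) := by
      rw [← e_div_congr n (a := ((k - ℓ : Residue n).val : ℤ) * (j.val : ℤ)) (by
        push_cast
        simp only [ZMod.natCast_zmod_val])]
      push_cast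
      rfl
    rw [h1, ← mul_assoc, ← mul_assoc, ← e_add, ← e_add]
    congr 2
    push_cast
    ring
  simp only [hterm]
  rw [← Finset.sum_mul, horth]
  by_cases hk : (ℓ : Residue n) = k
  · rw [Set.indicator_of_mem (by exact hk), if_pos (by rw [hk, sub_self]),
      inv_mul_cancel_left₀ (natAbs_cast_ne_zero n)]
  · rw [Set.indicator_of_notMem (by exact hk), if_neg fun h => hk (sub_eq_zero.1 h).symm, zero_mul,
      mul_zero]

/-- Unfolding of the average over the centre of `N_ℤ`. -/
theorem hasSum_centralProj_average (n : NonzeroInt) (j : ℤ) (φ : HeisTest) (x y z : ℝ) :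
    HasSum (fun a : ℤ => e (-(n.1 * z + n.1 * a * y))
        * ∑' b : ℤ, centralCoeff n.1 φ (x + a) (y + j / n.1 + b))
      (centralProj n.1 j (average φ) (x, y, z)) := by
  have hn : (n.1 : ℝ) ≠ 0 := Int.cast_ne_zero.2 n.2
  set Y : ℝ := y + j / n.1 with hY
  have hfin := finite_translates φ (‖(x, Y, z)‖ + 1)
  let I : ℤ × ℤ × ℤ → ℂ := fun g =>
    ∫ t in (0 : ℝ)..1, e (n.1 * t) * φ (Heis.mul (Heis.ofInt g) (x, Y, z + t))
  have hzero : ∀ g ∉ hfin.toFinset, ∀ t ∈ Set.uIcc (0 : ℝ) 1,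
      φ (Heis.mul (Heis.ofInt g) (x, Y, z + t)) = 0 := by
    intro g hg t ht
    by_contra hne
    refine hg ((Set.Finite.mem_toFinset _).2 ⟨_, ?_, hne⟩)
    rw [Set.uIcc_of_le zero_le_one] at ht
    have h1 : ((x, Y, z + t) : Heis) = (x, Y, z) + (0, 0, t) := by simp
    rw [h1]
    refine (norm_add_le _ _).trans (add_le_add_right ?_ _)
    simp [Prod.norm_def, abs_le, ht.2]
    linarith [ht.1]
  have hI0 : ∀ g ∉ hfin.toFinset, I g = 0 := fun g hg => by
    refine (intervalIntegral.integral_congr fun t ht => ?_).trans intervalIntegral.integral_zero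
    simp only [hzero g hg t ht, mul_zero]
  have hI : HasSum I (centralProj n.1 j (average φ) (x, y, z)) := by
    have h1 : centralProj n.1 j (average φ) (x, y, z) = ∑ g ∈ hfin.toFinset, I g := by
      rw [centralProj_apply]
      simp only [I]
      rw [← intervalIntegral.integral_finsetSum]
      · refine intervalIntegral.integral_congr fun t ht => ?_
        simp only [← hY, average_apply]
        rw [← Finset.mul_sum, tsum_eq_sum fun g hg => hzero g hg t ht]
      · intro g _
        refine Continuous.intervalIntegrable ?_ _ _
        exact (continuous_e.comp (by fun_prop)).mul (φ.continuous.comp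
          ((contDiff_mul_left _).continuous.comp (by fun_prop)))
    rw [h1]
    exact hasSum_sum_of_ne_finset_zero hI0
  have hγ : ∀ a b : ℤ, HasSum (fun c : ℤ => I (a, b, c))
      (e (-(n.1 * z + n.1 * a * y)) * centralCoeff n.1 φ (x + a) (Y + b)) := by
    intro a b
    have hint : Integrable fun u : ℝ => e (n.1 * u) * φ (x + a, Y + b, u + (z + a * Y)) := by
      refine Continuous.integrable_of_hasCompactSupport
        ((continuous_e.comp (by fun_prop)).mul (φ.continuous.comp (by fun_prop))) ?_
      refine HasCompactSupport.mul_left ?_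
      obtain ⟨R, hR⟩ := exists_apply_eq_zero φ
      refine HasCompactSupport.intro (isCompact_closedBall (-(z + a * Y)) R) fun u hu => ?_
      refine hR _ _ _ (Or.inr (Or.inr ?_))
      rw [Metric.mem_closedBall, Real.dist_eq, sub_neg_eq_add, not_le] at hu
      exact hu
    have h := hint.hasSum_intervalIntegral_comp_add_int
    have hval : ∫ u : ℝ, e (n.1 * u) * φ (x + a, Y + b, u + (z + a * Y))
        = e (-(n.1 * z + n.1 * a * y)) * centralCoeff n.1 φ (x + a) (Y + b) := by
      rw [centralCoeff, ← integral_const_mul, ← integral_add_right_eq_self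
        (fun u => e (-(n.1 * z + n.1 * a * y)) * (e (n.1 * u) * φ (x + a, Y + b, u))) (z + a * Y)]
      congr 1
      ext u
      rw [← mul_assoc, ← e_add]
      congr 1
      rw [← e_add_intCast (n.1 * u) (a * j)]
      congr 1
      rw [hY]
      push_cast
      field_simp
      ring
    rw [hval] at h
    refine h.congr_fun fun c => ?_
    refine intervalIntegral.integral_congr fun t _ => ?_
    have he : e (n.1 * (t + c)) = e (n.1 * t) := by
      rw [← e_add_intCast (n.1 * t) (n.1 * c)]
      congr 1
      push_cast
      ring
    simp only [he]
    refine congrArg (fun q : Heis => e (n.1 * t) * φ q) ?_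
    ext <;> simp [Heis.mul, Heis.ofInt] <;> ring
  have hIs : ∀ a : ℤ, Summable fun bc : ℤ × ℤ => I (a, bc) := fun a =>
    hI.summable.comp_injective (Prod.mk_right_injective a)
  refine hI.prod_fiberwise fun a => ?_
  rw [← tsum_mul_left]
  have h1 := (hIs a).hasSum.prod_fiberwise (hγ a)
  rw [h1.tsum_eq]
  exact (hIs a).hasSum

/-- The term of the double series that computes a projected average; its index `a` effectively runs
over finitely many integers. -/
def doubleTerm (n : NonzeroInt) (φ : HeisTest) (p : Heis) (a ℓ : ℤ) : ℂ :=
  e (-(n.1 * p.2.2 + n.1 * a * p.2.1)) * (e (-(ℓ * p.2.1)) * fiberCoeff n.1 ℓ φ (p.1 + a))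

theorem summable_doubleTerm (n : NonzeroInt) (φ : HeisTest) (p : Heis) :
    Summable fun q : ℤ × ℤ => doubleTerm n φ p q.1 q.2 := by
  obtain ⟨R, hR⟩ := exists_apply_eq_zero φ
  obtain ⟨C, hC0, hC⟩ := exists_norm_fiberCoeff_le_inv φ
  have hA : {a : ℤ | |p.1 + a| ≤ R}.Finite := by
    refine (Set.finite_Icc ⌊-R - p.1⌋ ⌈R - p.1⌉).subset fun a ha => ?_
    have := abs_le.1 (show |p.1 + a| ≤ R from ha)
    constructor
    · have h1 : (⌊-R - p.1⌋ : ℝ) ≤ a := (Int.floor_le _).trans (by linarith)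
      exact_mod_cast h1
    · have h1 : (a : ℝ) ≤ ⌈R - p.1⌉ := le_trans (by linarith) (Int.le_ceil _)
      exact_mod_cast h1
  have h0 : ∀ a : ℤ, 0 ≤ {a : ℤ | |p.1 + a| ≤ R}.indicator (fun _ => C) a := fun a =>
    Set.indicator_nonneg (fun _ _ => hC0) a
  have h1 : Summable fun a : ℤ => {a : ℤ | |p.1 + a| ≤ R}.indicator (fun _ => C) a :=
    summable_of_hasFiniteSupport (hA.subset Set.support_indicator_subset)
  refine Summable.of_norm_bounded (h1.mul_of_nonneg summable_inv_one_add_sq h0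
    fun ℓ => by simp only [Pi.zero_apply]; positivity) fun q => ?_
  rw [doubleTerm, norm_mul, norm_mul, norm_e, norm_e, one_mul, one_mul]
  by_cases hq : |p.1 + q.1| ≤ R
  · rw [Set.indicator_of_mem (by exact hq)]
    exact hC n.1 q.2 _
  · rw [fiberCoeff_eq_zero hR n.1 _ (not_le.1 hq), norm_zero]
    exact mul_nonneg (h0 _) (by positivity)

/-- One theta series of a test function, as a sum over the translates in the variable `x`. -/
theorem theta_sigmaTest_apply (n : NonzeroInt) (k : Residue n) (φ : HeisTest) {ℓ : ℤ}
    (hℓ : (ℓ : Residue n) = k) (x y z : ℝ) :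
    HasSum (fun a : ℤ => doubleTerm n φ (x, y, z) a ℓ)
      (theta n k.val (sigmaTest n.1 ℓ φ) (x, y, z)) := by
  have hn : (n.1 : ℝ) ≠ 0 := Int.cast_ne_zero.2 n.2
  obtain ⟨b, hb⟩ : (n.1 : ℤ) ∣ ℓ - k.val := by
    rw [← Int.natAbs_dvd, ← ZMod.intCast_zmod_eq_zero_iff_dvd]
    push_cast
    rw [hℓ, ZMod.natCast_zmod_val, sub_self]
  have hb' : (ℓ : ℝ) = k.val + n.1 * b := by
    have : ℓ = k.val + n.1 * b := by linarith
    exact_mod_cast this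
  have h := (Equiv.addRight b).hasSum_iff.2
    (summable_thetaTerm n k.val (sigmaTest n.1 ℓ φ) (x, y, z)).hasSum
  refine h.congr_fun fun a => ?_
  rw [Function.comp_apply, Equiv.coe_addRight, thetaTerm, doubleTerm, sigmaTest_apply, ← mul_assoc, ← e_add]
  congr 2
  · rw [hb']
    push_cast
    ring
  · rw [hb']
    push_cast
    field_simp
    ring

/-- The pointwise form of the expansion of a projected average into theta series. Both sides are
rearrangements of one double series. -/
theorem hasSum_theta_sigmaTest_apply (n : NonzeroInt) (k : Residue n) (φ : HeisTest) (p : Heis) :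
    HasSum (fun ℓ : {ℓ : ℤ // (ℓ : Residue n) = k} => theta n k.val (sigmaTest n.1 ℓ.1 φ) p)
      (residueProj n k (average φ) p) := by
  obtain ⟨x, y, z⟩ := p
  have hfs : Summable fun q : ℤ × {ℓ : ℤ // (ℓ : Residue n) = k} =>
      doubleTerm n φ (x, y, z) q.1 q.2.1 :=
    (summable_doubleTerm n φ (x, y, z)).comp_injective (i := Prod.map id Subtype.val)
      (Function.injective_id.prodMap Subtype.val_injective)
  have hfa : ∀ a : ℤ, HasSum (fun ℓ : {ℓ : ℤ // (ℓ : Residue n) = k} =>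
      doubleTerm n φ (x, y, z) a ℓ.1) (e (-(n.1 * z + n.1 * a * y)) *
      ((n.1.natAbs : ℂ)⁻¹ * ∑ j : Residue n, e ((j.val : ℝ) * (k.val : ℝ) / n.1)
        * ∑' b : ℤ, centralCoeff n.1 φ (x + a) (y + j.val / n.1 + b))) := fun a => by
    unfold doubleTerm
    exact (hasSum_fiberCoeff_residue n k φ (x + a) y).mul_left (e (-(n.1 * z + n.1 * a * y)))
  have hproj : HasSum (fun a : ℤ => e (-(n.1 * z + n.1 * a * y)) *
      ((n.1.natAbs : ℂ)⁻¹ * ∑ j : Residue n, e ((j.val : ℝ) * (k.val : ℝ) / n.1)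
        * ∑' b : ℤ, centralCoeff n.1 φ (x + a) (y + j.val / n.1 + b)))
      (residueProj n k (average φ) (x, y, z)) := by
    rw [residueProj_apply]
    refine ((hasSum_sum (s := Finset.univ) fun (j : Residue n) _ =>
      (hasSum_centralProj_average n (j.val : ℤ) φ x y z).mul_left
        (e ((j.val : ℝ) * (k.val : ℝ) / n.1))).mul_left (n.1.natAbs : ℂ)⁻¹).congr_fun fun a => ?_
    rw [Finset.mul_sum, Finset.mul_sum, Finset.mul_sum]
    refine Finset.sum_congr rfl fun j _ => ?_
    rw [Int.cast_natCast]
    ring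
  have htot := (hfs.hasSum.prod_fiberwise hfa).unique hproj
  have hswap : HasSum (fun q : {ℓ : ℤ // (ℓ : Residue n) = k} × ℤ =>
      doubleTerm n φ (x, y, z) q.2 q.1.1) (residueProj n k (average φ) (x, y, z)) := by
    rw [← htot]
    exact (Equiv.prodComm _ _).hasSum_iff.2 hfs.hasSum
  exact hswap.prod_fiberwise fun ℓ => theta_sigmaTest_apply n k φ ℓ.2 x y z
/-- The series of theta functions of a test function converges in `C^∞(N_ℤ \ N)`. -/
theorem hasSum_theta_sigmaTest (n : NonzeroInt) (k : Residue n) (φ : HeisTest) :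
    HasSum (fun ℓ : {ℓ : ℤ // (ℓ : Residue n) = k} => theta n k.val (sigmaTest n.1 ℓ.1 φ))
      (residueProj n k (average φ)) := by
  refine NilSmooth.hasSum_of_commute (fun j => testD (frame j))
    (fun (ℓ : {ℓ : ℤ // (ℓ : Residue n) = k}) φ => theta n k.val (sigmaTest n.1 ℓ.1 φ))
    (fun φ => residueProj n k (average φ)) (fun ℓ j φ => ?_) (fun j φ => ?_) (fun φ => ?_)
    (fun φ p => hasSum_theta_sigmaTest_apply n k φ p) φ
  · rw [D_theta, schwartzFrame_sigmaTest]
  · rw [D_residueProj, D_average]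
  · obtain ⟨C, hC⟩ := exists_decayNorm_sigmaTest_le n φ
    set K := 2 * (1 + (1 + |((k.val : ℤ) : ℝ) / n.1|) ^ 2) * ∑' a : ℤ, (1 + (a : ℝ) ^ 2)⁻¹ with hK
    have hK0 : 0 ≤ K := mul_nonneg (by positivity) (tsum_nonneg fun a => by positivity)
    refine ⟨fun ℓ => K * (C * (1 + (2 * Real.pi * (ℓ.1 : ℝ)) ^ 2)⁻¹),
      ((summable_inv_one_add_sq.mul_left C).mul_left K).comp_injective
        (i := fun ℓ : {ℓ : ℤ // (ℓ : Residue n) = k} => ℓ.1) Subtype.val_injective, fun ℓ p => ?_⟩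
    exact (NilSmooth.norm_le_fieldNorm_zero _ p).trans ((fieldNorm_zero_theta_le n _ _).trans
      (mul_le_mul_of_nonneg_left (hC ℓ.1) hK0))

/-- The tempered distribution `f ↦ τ(Θ f)`, where `Θ f` is the theta series of `f` for the residue
class of `k`. -/
def thetaPullback (τ : NilDistribution) (n : NonzeroInt) (k : Residue n) : 𝓢'(ℝ, ℂ) :=
  (τ.comp (thetaCLM n k.val)).toPointwiseConvergenceCLM _ _ _ _

theorem thetaPullback_apply (τ : NilDistribution) (n : NonzeroInt) (k : Residue n) (f : 𝓢(ℝ, ℂ)) :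
    thetaPullback τ n k f = τ (theta n k.val f) := rfl

theorem isSigmaComponent_thetaPullback (τ : NilDistribution) (n : NonzeroInt) (k : Residue n) :
    IsSigmaComponent n k (thetaPullback τ n k) (residuePart τ n k) := fun φ =>
  (hasSum_theta_sigmaTest n k φ).mapL τ

/-! ### The automorphism of order four -/

/-- The automorphism `(x, y, z) ↦ (-y, x, z - xy)` of `N`, which preserves `N_ℤ`, fixes the centre
and induces a quarter turn on the quotient by the centre. -/
def quarterTurn (p : Heis) : Heis := (-p.2.1, p.1, p.2.2 - p.1 * p.2.1)

theorem contDiff_quarterTurn : ContDiff ℝ ∞ quarterTurn := by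
  unfold quarterTurn
  fun_prop

theorem quarterTurn_mul (p q : Heis) :
    quarterTurn (Heis.mul p q) = Heis.mul (quarterTurn p) (quarterTurn q) := by
  ext <;> simp [quarterTurn, Heis.mul] <;> ring

theorem quarterTurn_iterate_four (p : Heis) :
    quarterTurn (quarterTurn (quarterTurn (quarterTurn p))) = p := by
  ext <;> simp [quarterTurn]
  ring

/-- The restriction of `quarterTurn` to `N_ℤ`. -/
def quarterTurnInt : ℤ × ℤ × ℤ ≃ ℤ × ℤ × ℤ where
  toFun g := (-g.2.1, g.1, g.2.2 - g.1 * g.2.1)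
  invFun g := (g.2.1, -g.1, g.2.2 - g.1 * g.2.1)
  left_inv g := by ext <;> simp [mul_comm]
  right_inv g := by ext <;> simp [mul_comm]

theorem ofInt_quarterTurnInt (g : ℤ × ℤ × ℤ) :
    Heis.ofInt (quarterTurnInt g) = quarterTurn (Heis.ofInt g) := by
  ext <;> simp [quarterTurn, Heis.ofInt, quarterTurnInt]

theorem fieldDeriv_comp_quarterTurn (v : Heis) {F : Heis → ℂ} {p : Heis}
    (hF : DifferentiableAt ℝ F (quarterTurn p)) :
    fieldDeriv v (fun q => F (quarterTurn q)) p = fieldDeriv (-v.2.1, v.1, v.2.2) F (quarterTurn p) := by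
  have h1 : HasFDerivAt quarterTurn _ p :=
    ((ContinuousLinearMap.fst ℝ ℝ ℝ).comp (.snd ℝ ℝ (ℝ × ℝ))).hasFDerivAt.neg.prodMk
      ((ContinuousLinearMap.fst ℝ ℝ (ℝ × ℝ)).hasFDerivAt.prodMk
        (((ContinuousLinearMap.snd ℝ ℝ ℝ).comp (.snd ℝ ℝ (ℝ × ℝ))).hasFDerivAt.sub
          ((ContinuousLinearMap.fst ℝ ℝ (ℝ × ℝ)).hasFDerivAt.mul
            ((ContinuousLinearMap.fst ℝ ℝ ℝ).comp (.snd ℝ ℝ (ℝ × ℝ))).hasFDerivAt)))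
  have h2 := (hF.hasFDerivAt.comp p h1).fderiv
  unfold fieldDeriv
  rw [show (fun q => F (quarterTurn q)) = F ∘ quarterTurn from rfl, h2,
    ContinuousLinearMap.comp_apply]
  congr 1
  ext <;> simp [leftField, quarterTurn]
  ring

/-- Composition with `quarterTurn`. -/
def turn : NilSmooth →ₗ[ℂ] NilSmooth where
  toFun F := ⟨fun p => F (quarterTurn p), F.contDiff.comp contDiff_quarterTurn, fun g p => by
    change F (quarterTurn (Heis.mul (Heis.ofInt g) p)) = F (quarterTurn p)
    rw [quarterTurn_mul, ← ofInt_quarterTurnInt]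
    exact F.invariant _ _⟩
  map_add' _ _ := rfl
  map_smul' _ _ := rfl

theorem turn_apply (F : NilSmooth) (p : Heis) : turn F p = F (quarterTurn p) := rfl

theorem turn_iterate_four (F : NilSmooth) : turn (turn (turn (turn F))) = F :=
  NilSmooth.ext fun p => congrArg (F : Heis → ℂ) (quarterTurn_iterate_four p)

theorem D_turn (v : Heis) (F : NilSmooth) :
    NilSmooth.D v (turn F) = turn (NilSmooth.D (-v.2.1, v.1, v.2.2) F) :=
  NilSmooth.ext fun _ => fieldDeriv_comp_quarterTurn v (F.contDiff.contDiffAt.differentiableAt (by simp))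

theorem D_neg (v : Heis) (F : NilSmooth) : NilSmooth.D (-v) F = -NilSmooth.D v F := by
  refine NilSmooth.ext fun p => ?_
  have : leftField (-v) p = -leftField v p := by
    ext <;> simp [leftField]
    ring
  rw [NilSmooth.neg_apply, NilSmooth.D_apply, NilSmooth.D_apply, fieldDeriv, fieldDeriv, this,
    map_neg]

theorem fieldNorm_turn_le (m : ℕ) (F : NilSmooth) :
    NilSmooth.fieldNorm m (turn F) ≤ NilSmooth.fieldNorm m F := by
  induction m generalizing F with
  | zero => exact NilSmooth.fieldNorm_zero_le fun p => F.norm_le_fieldNorm_zero _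
  | succ m ih =>
    have h0 : NilSmooth.D (frame 0) (turn F) = turn (NilSmooth.D (frame 1) F) := by
      rw [D_turn]
      simp [frame]
    have h1 : NilSmooth.D (frame 1) (turn F) = -turn (NilSmooth.D (frame 0) F) := by
      rw [D_turn, ← map_neg, ← D_neg]
      simp [frame]
    have h2 : NilSmooth.D (frame 2) (turn F) = turn (NilSmooth.D (frame 2) F) := by
      rw [D_turn]
      simp [frame]
    rw [NilSmooth.fieldNorm_succ, NilSmooth.fieldNorm_succ, Fin.sum_univ_three, Fin.sum_univ_three,
      h0, h1, h2, map_neg_eq_map]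
    have i0 := ih (NilSmooth.D (frame 0) F)
    have i1 := ih (NilSmooth.D (frame 1) F)
    have i2 := ih (NilSmooth.D (frame 2) F)
    linarith [ih F]

theorem continuous_turn : Continuous turn :=
  NilSmooth.continuous_of_fieldNorm _ fun m =>
    Seminorm.continuous_of_le (p := (NilSmooth.fieldNorm m).comp turn)
      (q := NilSmooth.fieldNorm m) (NilSmooth.continuous_fieldNorm m) (fieldNorm_turn_le m)

/-- Composition with `quarterTurn` as a continuous linear map. -/
def turnCLM : NilSmooth →L[ℂ] NilSmooth := ⟨turn, continuous_turn⟩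

theorem turn_centralProj (n : ℤ) (F : NilSmooth) :
    turn (centralProj n 0 F) = centralProj n 0 (turn F) := by
  refine NilSmooth.ext fun p => ?_
  obtain ⟨x, y, z⟩ := p
  rw [turn_apply, quarterTurn, centralProj_apply, centralProj_apply]
  congr 1
  ext t
  rw [turn_apply]
  refine congrArg (fun q => e (n * t) * F q) ?_
  ext <;> simp [quarterTurn]
  ring

/-- The inverse of `quarterTurn`. -/
def quarterTurnSymm : Heis ≃ₜ Heis where
  toFun p := (p.2.1, -p.1, p.2.2 - p.1 * p.2.1)
  invFun := quarterTurn
  left_inv p := by ext <;> simp [quarterTurn, mul_comm]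
  right_inv p := by ext <;> simp [quarterTurn, mul_comm]
  continuous_toFun := by fun_prop
  continuous_invFun := contDiff_quarterTurn.continuous

/-- Composition of a test function with the inverse of `quarterTurn`. -/
def turnTest (φ : HeisTest) : HeisTest :=
  ⟨fun p => φ (p.2.1, -p.1, p.2.2 - p.1 * p.2.1), φ.contDiff.comp (by fun_prop),
    φ.hasCompactSupport.comp_homeomorph quarterTurnSymm, fun _ _ => trivial⟩

theorem turnTest_apply (φ : HeisTest) (p : Heis) :
    turnTest φ p = φ (p.2.1, -p.1, p.2.2 - p.1 * p.2.1) := rfl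

theorem turn_average_turnTest (φ : HeisTest) : turn (average (turnTest φ)) = average φ := by
  refine NilSmooth.ext fun p => ?_
  rw [turn_apply, average_apply, average_apply, ← quarterTurnInt.tsum_eq]
  refine tsum_congr fun g => ?_
  rw [ofInt_quarterTurnInt, ← quarterTurn_mul, turnTest_apply]
  exact congrArg φ (quarterTurnSymm.apply_symm_apply _)

/-- The shear `(y, z) ↦ (y, z + cy)`. -/
def shear (c : ℝ) : ℝ × ℝ ≃ₜ ℝ × ℝ where
  toFun w := (w.1, w.2 + c * w.1)
  invFun w := (w.1, w.2 - c * w.1)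
  left_inv w := by simp
  right_inv w := by simp
  continuous_toFun := by fun_prop
  continuous_invFun := by fun_prop

theorem measurePreserving_shear (c : ℝ) : MeasurePreserving (shear c) := by
  refine (MeasurePreserving.id volume).skew_product (g := fun y z => z + c * y) (by fun_prop) ?_
  exact Filter.Eventually.of_forall fun y => map_add_right_eq_self volume (c * y)

theorem rhoTest_eq_sigmaTest (n : NonzeroInt) (ℓ : ℤ) (φ : HeisTest) :
    rhoTest n.1 ℓ φ = sigmaTest n.1 ℓ (turnTest φ) := by
  have hn : (n.1 : ℝ) ≠ 0 := Int.cast_ne_zero.2 n.2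
  ext t
  rw [sigmaTest_apply, fiberCoeff,
    ← (measurePreserving_shear (t - ℓ / n.1)).integral_comp (shear _).measurableEmbedding]
  change ∫ w : ℝ × ℝ, e (n.1 * (w.2 - w.1 * (ℓ / n.1 - t)) + ℓ * w.1) * φ (w.1, ℓ / n.1 - t, w.2) = _
  congr 1
  ext w
  rw [turnTest_apply]
  congr 1
  · congr 1
    simp only [shear, Homeomorph.homeomorph_mk_coe, Equiv.coe_fn_mk]
    ring
  · refine congrArg φ ?_
    ext <;> simp [shear]

/-- The component that corresponds to `residuePart` under the automorphism `quarterTurn`. -/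
def turnedResiduePart (τ : NilDistribution) (n : NonzeroInt) (k : Residue n) : NilDistribution :=
  (residuePart (τ.comp turnCLM) n k).comp (turnCLM.comp (turnCLM.comp turnCLM))

theorem isRhoComponent_thetaPullback (τ : NilDistribution) (n : NonzeroInt) (k : Residue n) :
    IsRhoComponent n k (thetaPullback (τ.comp turnCLM) n k) (turnedResiduePart τ n k) := fun φ => by
  have h := isSigmaComponent_thetaPullback (τ.comp turnCLM) n k (turnTest φ)
  unfold sigmaTerm at h
  unfold rhoTerm
  simp only [rhoTest_eq_sigmaTest]
  convert! h using 1
  change residuePart (τ.comp turnCLM) n k (turn (turn (turn (average φ))))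
    = residuePart (τ.comp turnCLM) n k (average (turnTest φ))
  rw [← turn_average_turnTest φ, turn_iterate_four]

theorem sum_residuePart_apply (τ : NilDistribution) (n : NonzeroInt) (F : NilSmooth) :
    ∑ k, residuePart τ n k F = τ (centralProj n.1 0 F) := by
  simp only [residuePart_apply]
  rw [← map_sum, sum_residueProj]

/-- The two families of components have the same sum, because the projection to a central character
commutes with `quarterTurn`. -/
theorem sum_residuePart_eq_sum_turnedResiduePart (τ : NilDistribution) (n : NonzeroInt) :
    ∑ k, residuePart τ n k = ∑ k, turnedResiduePart τ n k := by
  refine ContinuousLinearMap.ext fun F => ?_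
  rw [_root_.sum_apply, _root_.sum_apply, sum_residuePart_apply]
  change _ = ∑ k, residuePart (τ.comp turnCLM) n k (turn (turn (turn F)))
  rw [sum_residuePart_apply]
  change _ = τ (turn (centralProj n.1 0 _))
  rw [turn_centralProj, turn_iterate_four]

/-! ### Poisson summation for theta series -/

/-- The Schwartz function `t ↦ f(t/c)`. -/
def rescale (c : ℝ) (hc : c ≠ 0) : 𝓢(ℝ, ℂ) →L[ℂ] 𝓢(ℝ, ℂ) :=
  SchwartzMap.compCLMOfContinuousLinearEquiv ℂ
    (ContinuousLinearEquiv.smulLeft (Units.mk0 c hc)⁻¹ : ℝ ≃L[ℝ] ℝ)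

theorem rescale_apply (c : ℝ) (hc : c ≠ 0) (f : 𝓢(ℝ, ℂ)) (t : ℝ) : rescale c hc f t = f (t / c) := by
  rw [div_eq_inv_mul]
  rfl

theorem fourier_schwartz_apply (f : 𝓢(ℝ, ℂ)) (s : ℝ) : 𝓕 f s = ∫ u : ℝ, e (-(u * s)) * f u := by
  rw [SchwartzMap.fourier_coe, Real.fourier_real_eq_integral_exp_smul]
  congr 1
  ext u
  rw [smul_eq_mul, e]
  congr 2
  push_cast
  ring

theorem fourier_rescale (c : ℝ) (hc : c ≠ 0) (f : 𝓢(ℝ, ℂ)) (s : ℝ) :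
    𝓕 (rescale c hc f) s = |c| * 𝓕 f (c * s) := by
  rw [fourier_schwartz_apply, fourier_schwartz_apply]
  have h := Measure.integral_comp_div (fun v : ℝ => e (-(v * (c * s))) * f v) c
  rw [Complex.real_smul] at h
  rw [← h]
  congr 1
  ext u
  rw [rescale_apply]
  congr 2
  field_simp

/-- Poisson summation for `u ↦ e(-su) f(u)`. -/
theorem hasSum_fourier_add_intCast (f : 𝓢(ℝ, ℂ)) (s v : ℝ) :
    HasSum (fun ℓ : ℤ => e (ℓ * v) * 𝓕 f (s + ℓ)) (∑' a : ℤ, e (-(s * (v + a))) * f (v + a)) := by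
  set h : ℝ → ℂ := fun u => e (-(s * u)) * f u with hh
  have hFou : ∀ ξ : ℝ, 𝓕 h ξ = 𝓕 f (s + ξ) := fun ξ => by
    rw [fourier_schwartz_apply, Real.fourier_real_eq_integral_exp_smul]
    congr 1
    ext u
    rw [smul_eq_mul, hh, ← mul_assoc, show -(u * (s + ξ)) = -(u * ξ) + -(s * u) by ring, e_add]
    congr 2
    rw [e]
    congr 1
    push_cast
    ring
  have hs : Summable fun ℓ : ℤ => 𝓕 f (s + ℓ) :=
    Summable.of_norm_bounded (summable_inv_one_add_int_sq.mul_left _)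
      fun ℓ => norm_apply_add_intCast_le (𝓕 f) s ℓ
  have hO : h =O[Filter.cocompact ℝ] fun t : ℝ => |t| ^ (-2 : ℝ) := by
    refine (Asymptotics.isBigO_of_le _ fun u => ?_).trans (f.isBigO_cocompact_rpow (-2))
    rw [hh, norm_mul, norm_e, one_mul]
  have hc : Continuous h := (continuous_e.comp (by fun_prop)).mul f.continuous
  have hP := Real.tsum_eq_tsum_fourier_of_rpow_decay_of_summable
    hc one_lt_two hO (by simpa only [hFou] using hs) v
  rw [show ∑' a : ℤ, e (-(s * (v + a))) * f (v + a) = ∑' a : ℤ, h (v + a) from rfl, hP]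
  have hterm : ∀ ℓ : ℤ, 𝓕 h (ℓ : ℝ) * fourier ℓ (v : UnitAddCircle) = e (ℓ * v) * 𝓕 f (s + ℓ) :=
    fun ℓ => by
      rw [hFou, mul_comm, fourier_coe_apply, e]
      congr 2
      push_cast
      ring
  simp only [hterm]
  refine Summable.hasSum (Summable.of_norm (hs.norm.congr fun ℓ => ?_))
  rw [norm_mul, norm_e, one_mul]

/-- Every integer is `j + nb` for a unique residue class `j`, represented in the interval
`[0, |n|)`, and a unique integer `b`. -/
def residueProdEquiv (n : NonzeroInt) : Residue n × ℤ ≃ ℤ :=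
  Equiv.ofBijective (fun q => (q.1.val : ℤ) + n.1 * q.2) (by
    have hmod : ∀ q : Residue n × ℤ, (((q.1.val : ℤ) + n.1 * q.2 : ℤ) : Residue n) = q.1 :=
      fun q => by
        have : ((n.1 : ℤ) : Residue n) = 0 :=
          (ZMod.intCast_zmod_eq_zero_iff_dvd _ _).2 (Int.natAbs_dvd.2 dvd_rfl)
        push_cast
        rw [this, zero_mul, add_zero, ZMod.natCast_zmod_val]
    refine ⟨fun q r h => ?_, fun ℓ => ?_⟩
    · have h1 : q.1 = r.1 := by
        rw [← hmod q, ← hmod r]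
        exact congrArg _ h
      have h2 : n.1 * q.2 = n.1 * r.2 := by
        simp only [h1] at h
        linarith
      exact Prod.ext h1 (mul_left_cancel₀ n.2 h2)
    · obtain ⟨b, hb⟩ : (n.1 : ℤ) ∣ ℓ - (ℓ : Residue n).val := by
        rw [← Int.natAbs_dvd, ← ZMod.intCast_zmod_eq_zero_iff_dvd]
        push_cast
        rw [ZMod.natCast_zmod_val, sub_self]
      exact ⟨((ℓ : Residue n), b), by simp only; linarith⟩)

theorem residueProdEquiv_apply (n : NonzeroInt) (j : Residue n) (b : ℤ) :
    residueProdEquiv n (j, b) = (j.val : ℤ) + n.1 * b := rfl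

/-- The transformation of theta series under the automorphism `quarterTurn`. -/
theorem turn_theta (n : NonzeroInt) (k : Residue n) (f : 𝓢(ℝ, ℂ)) :
    turn (theta n k.val f) = ∑ j : Residue n, (e ((k.val : ℝ) * (j.val : ℝ) / n.1)
      * ((|(n.1 : ℝ)|⁻¹ : ℝ) : ℂ)) •
        theta n j.val (𝓕 (rescale n.1 (Int.cast_ne_zero.2 n.2) f)) := by
  have hn : (n.1 : ℝ) ≠ 0 := Int.cast_ne_zero.2 n.2
  have hn' : ((|(n.1 : ℝ)| : ℝ) : ℂ) ≠ 0 := Complex.ofReal_ne_zero.2 (abs_ne_zero.2 hn)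
  refine NilSmooth.ext fun p => ?_
  obtain ⟨x, y, z⟩ := p
  rw [turn_apply, theta_apply, NilSmooth.sum_apply]
  have h := ((residueProdEquiv n).hasSum_iff.2
    (hasSum_fourier_add_intCast f (n.1 * x) (-y + k.val / n.1))).mul_left (e (-(n.1 * z)))
  rw [← tsum_mul_left] at h
  have hleft : ∀ a : ℤ, e (-(n.1 * z)) * (e (-(n.1 * x * (-y + k.val / n.1 + a)))
      * f (-y + k.val / n.1 + a)) = thetaTerm n k.val f a (quarterTurn (x, y, z)) := fun a => by
    rw [thetaTerm, ← mul_assoc, ← e_add, quarterTurn]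
    simp only [Int.cast_natCast]
    congr 2
    field_simp
    ring
  simp only [hleft] at h
  refine (h.prod_fiberwise fun j => ?_).unique (hasSum_fintype _)
  rw [NilSmooth.smul_apply, theta_apply]
  refine ((summable_thetaTerm n j.val _ (x, y, z)).hasSum.mul_left _).congr_fun fun b => ?_
  rw [Function.comp_apply, residueProdEquiv_apply, thetaTerm, fourier_rescale]
  have he : e (k.val * j.val / n.1)
      = e ((((j.val : ℤ) + n.1 * b : ℤ) : ℝ) * (k.val / n.1)) := by
    rw [← e_add_intCast (k.val * j.val / n.1) (b * k.val)]
    congr 1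
    push_cast
    field_simp
  have hx : (n.1 : ℝ) * (x + ((j.val : ℤ) : ℝ) / n.1 + b)
      = n.1 * x + (((j.val : ℤ) + n.1 * b : ℤ) : ℝ) := by
    push_cast
    field_simp
    ring
  rw [he, hx]
  rw [show (((j.val : ℤ) + n.1 * b : ℤ) : ℝ) * (-y + k.val / n.1)
    = (((j.val : ℤ) + n.1 * b : ℤ) : ℝ) * (k.val / n.1)
      + -((((j.val : ℤ) + n.1 * b : ℤ) : ℝ) * y) by ring, e_add,
    show -((n.1 : ℝ) * z + (((j.val : ℤ) : ℝ) + n.1 * b) * y)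
      = -(n.1 * z) + -((((j.val : ℤ) + n.1 * b : ℤ) : ℝ) * y) by push_cast; ring, e_add]
  push_cast
  field_simp

theorem thetaPullback_turn (τ : NilDistribution) (n : NonzeroInt) (k : Residue n) :
    thetaPullback (τ.comp turnCLM) n k = ∑ j : Residue n, e ((k.val : ℝ) * (j.val : ℝ) / n.1) •
      dilate (n.1 : ℝ) (Int.cast_ne_zero.2 n.2) (𝓕 (thetaPullback τ n j)) := by
  ext f
  rw [thetaPullback_apply]
  change τ (turn (theta n k.val f)) = _
  rw [turn_theta, map_sum, _root_.sum_apply]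
  refine Finset.sum_congr rfl fun j _ => ?_
  rw [map_smul, _root_.smul_apply, dilate_apply _ _ _ f _ (rescale_apply _ _ f), mul_smul,
    smul_eq_mul, smul_eq_mul]
  rfl

theorem sum_smul_thetaPullback_turn (τ : NilDistribution) (n : NonzeroInt) (a : Residue n → ℂ) :
    ∑ k, a k • thetaPullback (τ.comp turnCLM) n k = ∑ k, finiteFourier n a k •
      dilate (n.1 : ℝ) (Int.cast_ne_zero.2 n.2) (𝓕 (thetaPullback τ n k)) := by
  simp only [thetaPullback_turn]
  ext f
  simp only [_root_.sum_apply, _root_.smul_apply, smul_eq_mul, finiteFourier, Finset.mul_sum,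
    Finset.sum_mul]
  rw [Finset.sum_comm]
  refine Finset.sum_congr rfl fun j _ => Finset.sum_congr rfl fun k _ => ?_
  rw [mul_comm (j.val : ℝ)]
  ring

end HeisFourier

end

open HeisFourier in
theorem proposition3p1 (τ : NilDistribution) :
    ∃ (c : ℤ → ℤ → ℂ) (σ ρ : (n : NonzeroInt) → Residue n → 𝓢'(ℝ, ℂ))
      (A B : NilDistribution) (T S : (n : NonzeroInt) → Residue n → NilDistribution),
      -- `T n k` and `S n k` are the non-abelian components given by `σ n k` and `ρ n k`
      (∀ n k, IsSigmaComponent n k (σ n k) (T n k)) ∧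
      (∀ n k, IsRhoComponent n k (ρ n k) (S n k)) ∧
      -- the Fourier expansion, with unconditional convergence in the strong topology
      HasSum (fun rs : ℤ × ℤ => c rs.1 rs.2 • (abelianChar rs.1 rs.2).toDistribution) A ∧
      HasSum (fun nk : (n : NonzeroInt) × Residue n => T nk.1 nk.2) B ∧
      τ = A + B ∧
      -- the alternative form of the contribution of `n`
      (∀ n, ∑ k, T n k = ∑ k, S n k) ∧
      -- the relation between the two families of tempered distributions
      (∀ (n : NonzeroInt) (a : Residue n → ℂ),
        ∑ k, a k • ρ n k =
          ∑ k, finiteFourier n a k • dilate (n.1 : ℝ) (Int.cast_ne_zero.2 n.2) (𝓕 (σ n k))) := by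
  obtain ⟨A, B, hA, hB, hτ⟩ := exists_expansion τ
  exact ⟨fun r s => τ (abelianChar (-r) (-s)), fun n k => thetaPullback τ n k,
    fun n k => thetaPullback (τ.comp turnCLM) n k, A, B, fun n k => residuePart τ n k,
    fun n k => turnedResiduePart τ n k, isSigmaComponent_thetaPullback τ,
    isRhoComponent_thetaPullback τ, hA, hB, hτ, sum_residuePart_eq_sum_turnedResiduePart τ,
    sum_smul_thetaPullback_turn τ⟩
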